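/- **Setting.** Let $V,H$ be separable real Hilbert spaces with a continuous, dense, injective embedding $\iota:V\hookrightarrow H$, and let $U$ be a real Hilbert space. Let $V^*$ be the dual of $V$ with duality pairing $\langle\cdot,\cdot\rangle$, and embed $H\hookrightarrow V^*$ by $x\mapsto (x,\iota\,\cdot)_H$. Let $\mathcal L_2(U,H)$ be the space of Hilbert–Schmidt operators with norm $|||\cdot|||_H$, let $\mathbb R_+=[0,\infty)$, and for $\beta\in(0,1)$ let $\|\cdot\|_\beta$ be the norm of the complex interpolation space $[V^*,V]_\beta$. For $T>0$ put $$MR(0,T)=C([0,T];H)\cap L^2(0,T;V),\qquad \|u\|_{MR(0,T)}=\|u\|_{C([0,T];H)}+\|u\|_{L^2(0,T;V)} .$$ **Assumption on $A:\mathbb R_+\times V\to V^*$ and $B:\mathbb R_+\times V\to\mathcal L_2(U,H)$.** (1) $A(t,v)=A_0(t,v)v-F(t,v)-f(t)$ and $B(t,v)=B_0(t,v)v+G(t,v)+g(t)$, where $A_0:\mathbb R_+\times H\to\mathcal L(V,V^*)$ and $B_0:\mathbb R_+\times H\to\mathcal L(V,\mathcal L_2(U,H))$ are such that $(t,u)\mapsto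 A_0(t,u)v$ and $(t,u)\mapsto B_0(t,u)v$ are strongly $\mathcal B(\mathbb R_+)\otimes\mathcal B(H)$-measurable for every $v\in V$; $F:\mathbb R_+\times V\to V^*$ and $G:\mathbb R_+\times V\to\mathcal L_2(U,H)$ are strongly $\mathcal B(\mathbb R_+)\otimes\mathcal B(V)$-measurable; $f:\mathbb R_+\to V^*$ and $g:\mathbb R_+\to\mathcal L_2(U,H)$ are strongly Borel measurable, $f\in L^2_{loc}(\mathbb R_+;V^*)$ and $g\in L^2_{loc}(\mathbb R_+;\mathcal L_2(U,H))$. (2) For all $T>0$ and $n\ge 0$ there are $\theta_{n,T},M_{n,T}>0$ such that for all $t\in[0,T]$, $u\in H$ with $\|u\|_H\le n$ and $v\in V$, $$\langle A_0(t,u)v,v\rangle-\tfrac12|||B_0(t,u)v|||_H^2\ge\theta_{n,T}\|v\|_V^2-M_{n,T}\|v\|_H^2 .$$ (3) There are $m_F,m_G\in\mathbb N$ and, for $j\in\{1,\dots,m_F+m_G\}$, numbers $\rho_j\ge0$ and $\beta_j\in(\frac12,1)$ with $2\beta_j\le 1+\frac1{1+\rho_j}$, such that for all $T>0$ and $n\ge0$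 there is a constant $C_{n,T}$ such that for all $t\in[0,T]$ and $u,v,w\in V$ with $\|u\|_H,\|v\|_H\le n$: $$\|A_0(t,u)w\|_{V^*}\le C_{n,T}(1+\|u\|_H)\|w\|_V,\qquad \|A_0(t,u)w-A_0(t,v)w\|_{V^*}\le C_{n,T}\|u-v\|_H\|w\|_V,$$ $$|||B_0(t,u)w|||_H\le C_{n,T}(1+\|u\|_H)\|w\|_V,\qquad |||B_0(t,u)w-B_0(t,v)w|||_H\le C_{n,T}\|u-v\|_H\|w\|_V,$$ $$\|F(t,u)\|_{V^*}\le C_{n,T}\sum_{j=1}^{m_F}(1+\|u\|_{\beta_j}^{\rho_j+1}),\qquad \|F(t,u)-F(t,v)\|_{V^*}\le C_{n,T}\sum_{j=1}^{m_F}(1+\|u\|_{\beta_j}^{\rho_j}+\|v\|_{\beta_j}^{\rho_j})\|u-v\|_{\beta_j},$$ $$|||G(t,u)|||_H\le C_{n,T}\sum_{j=m_F+1}^{m_F+m_G}(1+\|u\|_{\beta_j}^{\rho_j+1}),\qquad |||G(t,u)-G(t,v)|||_H\le C_{n,T}\sum_{j=m_F+1}^{m_F+m_G}(1+\|u\|_{\beta_j}^{\rho_j}+\|v\|_{\beta_j}^{\rho_j})\|u-v\|_{\beta_j}.$$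 **Coercivity.** For every $T>0$ there are $\theta,M>0$ and $\phi\in L^2(0,T)$ such that for all $v\in V$ and $t\in[0,T]$, $$\langle A(t,v),v\rangle-\tfrac12|||B(t,v)|||_H^2\ge\theta\|v\|_V^2-M\|v\|_H^2-|\phi(t)|^2. \tag{C}$$ **Theorem.** Under these assumptions, for every $\psi\in L^2_{loc}(\mathbb R_+;U)$, $x\in H$ and $T>0$ the skeleton equation $$u'(t)=-A(t,u(t))+B(t,u(t))\psi(t),\quad t\in[0,T],\qquad u(0)=x,$$ has a unique strong solution $u\in MR(0,T)$; that is, there is exactly one $u\in MR(0,T)$ such that $A(\cdot,u)-B(\cdot,u)\psi\in L^2(0,T;V^*)+L^1(0,T;H)$ and $u(t)=x-\int_0^t\big(A(s,u(s))-B(s,u(s))\psi(s)\big)\,ds$ in $V^*$ for all $t\in[0,T]$. Moreover, for all $\theta,M>0$ and $\phi\in L^2(0,T)$ for which (C) holds for all $v\in V$ and $t\in[0,T]$, $$\|u\|_{MR(0,T)}\le\Big(2+\frac1\theta\Big)^{1/2}\big(\|x\|_H+\sqrt2\,\|\phi\|_{L^2(0,T)}\big)\exp\Big(MT+\tfrac12\|\psi\|_{L^2(0,T;U)}^2\Big).$$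 -/

import Mathlib

open MeasureTheory Set
open scoped ENNReal

/-! ### Hilbert–Schmidt operators -/

/-- The index set of a fixed orthonormal (Hilbert) basis of `U`. -/
def hsIndex (U : Type*) [NormedAddCommGroup U] [InnerProductSpace ℝ U] [CompleteSpace U] : Set U :=
  (exists_hilbertBasis ℝ U).choose

/-- A fixed orthonormal (Hilbert) basis of `U`. -/
noncomputable def hsBasis (U : Type*) [NormedAddCommGroup U] [InnerProductSpace ℝ U]
    [CompleteSpace U] : HilbertBasis (hsIndex U) ℝ U :=
  (exists_hilbertBasis ℝ U).choose_spec.choose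

/-- The operators `T` with `∑ ‖T eᵢ‖² < ∞` for an orthonormal basis `(eᵢ)` of `U`; by Parseval's
identity neither the sum nor its finiteness depends on the basis. -/
def hsSubmodule (U H : Type*) [NormedAddCommGroup U] [InnerProductSpace ℝ U] [CompleteSpace U]
    [NormedAddCommGroup H] [InnerProductSpace ℝ H] : Submodule ℝ (U →L[ℝ] H) where
  carrier := {T | Memℓp (fun i : hsIndex U => T (hsBasis U i)) 2}
  zero_mem' := (zero_memℓp : Memℓp (0 : hsIndex U → H) 2)
  add_mem' := fun hS hT => Memℓp.add hS hT
  smul_mem' := fun c _ hT => Memℓp.const_smul hT c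

/-- The space `𝓛₂(U, H)` of Hilbert–Schmidt operators. It is a type synonym, because it carries the
Hilbert–Schmidt norm and not the operator norm. -/
def HilbertSchmidt (U H : Type*) [NormedAddCommGroup U] [InnerProductSpace ℝ U] [CompleteSpace U]
    [NormedAddCommGroup H] [InnerProductSpace ℝ H] : Type _ :=
  ↥(hsSubmodule U H)

namespace HilbertSchmidt

variable {U H : Type*} [NormedAddCommGroup U] [InnerProductSpace ℝ U] [CompleteSpace U]
  [NormedAddCommGroup H] [InnerProductSpace ℝ H]

instance : AddCommGroup (HilbertSchmidt U H) := inferInstanceAs (AddCommGroup ↥(hsSubmodule U H))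

instance : Module ℝ (HilbertSchmidt U H) := inferInstanceAs (Module ℝ ↥(hsSubmodule U H))

/-- The underlying bounded operator. -/
def toCLM : HilbertSchmidt U H →ₗ[ℝ] (U →L[ℝ] H) := (hsSubmodule U H).subtype

theorem memℓp (T : HilbertSchmidt U H) :
    Memℓp (fun i : hsIndex U => toCLM T (hsBasis U i)) 2 :=
  T.2

/-- The family `(T eᵢ)` as an element of `ℓ²(H)`. -/
noncomputable def toEll2 : HilbertSchmidt U H →ₗ[ℝ] lp (fun _ : hsIndex U => H) 2 where
  toFun T := ⟨fun i => toCLM T (hsBasis U i), memℓp T⟩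
  map_add' _ _ := rfl
  map_smul' _ _ := rfl

theorem toEll2_injective : Function.Injective (toEll2 (U := U) (H := H)) := by
  intro S T h
  have h1 : ∀ i, toCLM S (hsBasis U i) = toCLM T (hsBasis U i) := fun i =>
    congrFun (congrArg Subtype.val h) i
  have h2 : toCLM S = toCLM T := by
    refine ContinuousLinearMap.ext_on
      (Submodule.dense_iff_topologicalClosure_eq_top.mpr (hsBasis U).dense_span) ?_
    rintro _ ⟨i, rfl⟩
    exact h1 i
  exact Subtype.ext h2

/-- The Hilbert–Schmidt norm `(∑ ‖T eᵢ‖²)^{1/2}`, pulled back from `ℓ²(H)`. -/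
noncomputable instance : NormedAddCommGroup (HilbertSchmidt U H) :=
  NormedAddCommGroup.induced (HilbertSchmidt U H) (lp (fun _ : hsIndex U => H) 2)
    toEll2 toEll2_injective

noncomputable instance : NormedSpace ℝ (HilbertSchmidt U H) :=
  NormedSpace.induced ℝ (HilbertSchmidt U H) (lp (fun _ : hsIndex U => H) 2) toEll2

theorem norm_sq_eq (T : HilbertSchmidt U H) :
    ‖T‖ ^ 2 = ∑' i : hsIndex U, ‖toCLM T (hsBasis U i)‖ ^ 2 := by
  have h := lp.norm_rpow_eq_tsum (p := 2) (by norm_num) (toEll2 T)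
  simp only [ENNReal.toReal_ofNat, Real.rpow_ofNat] at h
  exact h

end HilbertSchmidt

/-! ### Complex interpolation -/

/-- The norm of `x` in the complex interpolation space `[X₀, X₁]_θ`, for a complex Banach space `X₀`
and a space `X₁` that is embedded in `X₀` through `j`: the infimum of
`max (sup_t ‖f(it)‖_{X₀}) (sup_t ‖f(1+it)‖_{X₁})` over the bounded continuous functions `f` on the
closed strip `0 ≤ Re z ≤ 1` with values in `X₀ + X₁ = X₀` that are holomorphic inside, with
`t ↦ f(1+it)` bounded and continuous into `X₁`, and with `f(θ) = x`. (For `x` outside of the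
interpolation space the value is the junk value `0`; for `x` in the range of `j` constant functions
are competitors.) -/
noncomputable def complexInterpNorm {X₀ X₁ : Type*} [NormedAddCommGroup X₀] [NormedSpace ℂ X₀]
    [NormedAddCommGroup X₁] (j : X₁ → X₀) (θ : ℝ) (x : X₀) : ℝ :=
  sInf {M : ℝ | 0 ≤ M ∧ ∃ (f : ℂ → X₀) (g : ℝ → X₁),
    DiffContOnCl ℂ f {z : ℂ | 0 < z.re ∧ z.re < 1} ∧
    (∃ K : ℝ, ∀ z : ℂ, 0 ≤ z.re → z.re ≤ 1 → ‖f z‖ ≤ K) ∧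
    Continuous g ∧
    (∀ t : ℝ, f (1 + t * Complex.I) = j (g t)) ∧
    (∀ t : ℝ, ‖f (t * Complex.I)‖ ≤ M) ∧
    (∀ t : ℝ, ‖g t‖ ≤ M) ∧
    f θ = x}

section Gelfand

variable {V H U : Type*} [NormedAddCommGroup V] [InnerProductSpace ℝ V]
  [NormedAddCommGroup H] [InnerProductSpace ℝ H]
  [NormedAddCommGroup U] [InnerProductSpace ℝ U] [CompleteSpace U]

/-! ### Gelfand triples

`ι : V →L[ℝ] H` is the (injective, dense) embedding, `V* = StrongDual ℝ V`, and the duality pairing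
`⟨y, v⟩` of `y : StrongDual ℝ V` and `v : V` is `y v`. -/

/-- The embedding `j : H → V*`, `x ↦ (x, ι ·)_H`. -/
noncomputable def pivotDual (ι : V →L[ℝ] H) (x : H) : StrongDual ℝ V :=
  (innerSL ℝ x).comp ι

/-- The embedding of the complexification of `V` in the complexification of `V*`. An element `a + ib`
of the former is the pair `(a, b)`, with the norm `(‖a‖² + ‖b‖²)^{1/2}`; the latter is the complex
Banach space of the bounded real-linear maps from `V` to `ℂ`. -/
noncomputable def complexEmb (ι : V →L[ℝ] H) (p : WithLp 2 (V × V)) : V →L[ℝ] ℂ :=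
  Complex.ofRealCLM.comp (pivotDual ι (ι p.fst)) +
    Complex.I • Complex.ofRealCLM.comp (pivotDual ι (ι p.snd))

/-- The norm `‖v‖_β` of `v ∈ V` in the complex interpolation space `V_β = [V*, V]_β`. -/
noncomputable def interpNorm (ι : V →L[ℝ] H) (β : ℝ) (v : V) : ℝ :=
  complexInterpNorm (complexEmb ι) β (complexEmb ι (WithLp.toLp 2 (v, 0)))

/-- Lebesgue measure on `[0, T]`. -/
noncomputable def volIcc (T : ℝ) : Measure ℝ := volume.restrict (Icc 0 T)

/-- `h ∈ L²_loc(ℝ₊; X)`; only the values of `h` on `ℝ₊ = [0, ∞)` matter. -/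
def MemL2Loc {X : Type*} [NormedAddCommGroup X] (h : ℝ → X) : Prop :=
  ∀ T : ℝ, 0 < T → MemLp h 2 (volIcc T)

/-! ### The critical variational setting

Coefficients depend on `t ∈ ℝ₊`; they are functions on `ℝ` whose values at `t < 0` are never used. -/

/-- The assumption that `(A, B)` has the quasilinear structure
`A(t,v) = A₀(t,v)v - F(t,v) - f(t)`, `B(t,v) = B₀(t,v)v + G(t,v) + g(t)` with the measurability, local
coercivity, and (sub)critical growth and Lipschitz conditions of the critical variational setting.
Measurability of the operator-valued maps `A₀`, `B₀` is meant in the strong operator sense. -/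
def CriticalVariational [MeasurableSpace V] [MeasurableSpace H] (ι : V →L[ℝ] H)
    (A : ℝ → V → StrongDual ℝ V) (B : ℝ → V → HilbertSchmidt U H) : Prop :=
  ∃ (A₀ : ℝ → H → V →L[ℝ] StrongDual ℝ V) (B₀ : ℝ → H → V →L[ℝ] HilbertSchmidt U H)
    (F : ℝ → V → StrongDual ℝ V) (G : ℝ → V → HilbertSchmidt U H)
    (f : ℝ → StrongDual ℝ V) (g : ℝ → HilbertSchmidt U H),
    -- decomposition, measurability and integrability
    ((∀ t : ℝ, 0 ≤ t → ∀ v : V, A t v = A₀ t (ι v) v - F t v - f t) ∧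
      (∀ t : ℝ, 0 ≤ t → ∀ v : V, B t v = B₀ t (ι v) v + G t v + g t) ∧
      (∀ v : V, StronglyMeasurable fun p : Ici (0 : ℝ) × H => A₀ p.1 p.2 v) ∧
      (∀ v : V, StronglyMeasurable fun p : Ici (0 : ℝ) × H => B₀ p.1 p.2 v) ∧
      (StronglyMeasurable fun p : Ici (0 : ℝ) × V => F p.1 p.2) ∧
      (StronglyMeasurable fun p : Ici (0 : ℝ) × V => G p.1 p.2) ∧
      (StronglyMeasurable fun t : Ici (0 : ℝ) => f t) ∧
      (StronglyMeasurable fun t : Ici (0 : ℝ) => g t) ∧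
      MemL2Loc f ∧ MemL2Loc g) ∧
    -- local coercivity of the leading part
    (∀ T : ℝ, 0 < T → ∀ n : ℝ, 0 ≤ n → ∃ θ M : ℝ, 0 < θ ∧ 0 < M ∧
      ∀ t ∈ Icc 0 T, ∀ (u : H) (v : V), ‖u‖ ≤ n →
        θ * ‖v‖ ^ 2 - M * ‖ι v‖ ^ 2 ≤ A₀ t u v v - 1 / 2 * ‖B₀ t u v‖ ^ 2) ∧
    -- growth and Lipschitz conditions
    (∃ (mF mG : ℕ) (ρ β : ℕ → ℝ),
      (∀ j ∈ Finset.Icc 1 (mF + mG),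
        0 ≤ ρ j ∧ β j ∈ Ioo (1 / 2 : ℝ) 1 ∧ 2 * β j ≤ 1 + 1 / (1 + ρ j)) ∧
      ∀ T : ℝ, 0 < T → ∀ n : ℝ, 0 ≤ n → ∃ C : ℝ,
        ∀ t ∈ Icc 0 T, ∀ u v w : V, ‖ι u‖ ≤ n → ‖ι v‖ ≤ n →
          ‖A₀ t (ι u) w‖ ≤ C * (1 + ‖ι u‖) * ‖w‖ ∧
          ‖A₀ t (ι u) w - A₀ t (ι v) w‖ ≤ C * ‖ι u - ι v‖ * ‖w‖ ∧
          ‖B₀ t (ι u) w‖ ≤ C * (1 + ‖ι u‖) * ‖w‖ ∧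
          ‖B₀ t (ι u) w - B₀ t (ι v) w‖ ≤ C * ‖ι u - ι v‖ * ‖w‖ ∧
          ‖F t u‖ ≤ C * ∑ j ∈ Finset.Icc 1 mF, (1 + interpNorm ι (β j) u ^ (ρ j + 1)) ∧
          ‖F t u - F t v‖ ≤ C * ∑ j ∈ Finset.Icc 1 mF,
            (1 + interpNorm ι (β j) u ^ ρ j + interpNorm ι (β j) v ^ ρ j) *
              interpNorm ι (β j) (u - v) ∧
          ‖G t u‖ ≤ C * ∑ j ∈ Finset.Icc (mF + 1) (mF + mG),
            (1 + interpNorm ι (β j) u ^ (ρ j + 1)) ∧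
          ‖G t u - G t v‖ ≤ C * ∑ j ∈ Finset.Icc (mF + 1) (mF + mG),
            (1 + interpNorm ι (β j) u ^ ρ j + interpNorm ι (β j) v ^ ρ j) *
              interpNorm ι (β j) (u - v))

/-- `θ, M > 0` and `φ ∈ L²(0,T)` are such that for all `t ∈ [0,T]` and `v ∈ V`,
`⟨A(t,v), v⟩ - ½ ‖B(t,v)‖²_{𝓛₂} ≥ θ ‖v‖²_V - M ‖v‖²_H - |φ(t)|²`. -/
def CoerciveWith (ι : V →L[ℝ] H) (A : ℝ → V → StrongDual ℝ V) (B : ℝ → V → HilbertSchmidt U H)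
    (T θ M : ℝ) (φ : ℝ → ℝ) : Prop :=
  0 < θ ∧ 0 < M ∧ MemLp φ 2 (volIcc T) ∧
    ∀ v : V, ∀ t ∈ Icc 0 T,
      θ * ‖v‖ ^ 2 - M * ‖ι v‖ ^ 2 - |φ t| ^ 2 ≤ A t v v - 1 / 2 * ‖B t v‖ ^ 2

/-- Coercivity of `(A, B)`. -/
def Coercive (ι : V →L[ℝ] H) (A : ℝ → V → StrongDual ℝ V) (B : ℝ → V → HilbertSchmidt U H) : Prop :=
  ∀ T : ℝ, 0 < T → ∃ (θ M : ℝ) (φ : ℝ → ℝ), CoerciveWith ι A B T θ M φ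

/-! ### Strong solutions -/

/-- The maximal regularity space `MR(0,T) = C([0,T];H) ∩ L²(0,T;V)`: an element is a continuous
function with values in `H`, together with the class in `L²(0,T;V)` that agrees with it almost
everywhere (and is determined by it when `ι` is injective). -/
structure MR (ι : V →L[ℝ] H) (T : ℝ) where
  /-- the continuous `H`-valued function -/
  toCont : C(Icc (0 : ℝ) T, H)
  /-- the class in `L²(0,T;V)` -/
  toL2 : Lp V 2 (volIcc T)
  compat : ∀ᵐ t ∂(volIcc T), ∀ ht : t ∈ Icc (0 : ℝ) T, ι (toL2 t) = toCont ⟨t, ht⟩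

/-- `‖u‖_{MR(0,T)} = ‖u‖_{C([0,T];H)} + ‖u‖_{L²(0,T;V)}`. -/
noncomputable instance (ι : V →L[ℝ] H) (T : ℝ) : Norm (MR ι T) :=
  ⟨fun u => ‖u.toCont‖ + ‖u.toL2‖⟩

/-- `h ∈ L²(0,T;V*) + L¹(0,T;H)`. -/
def MemSum (ι : V →L[ℝ] H) (T : ℝ) (h : ℝ → StrongDual ℝ V) : Prop :=
  ∃ (h₁ : ℝ → StrongDual ℝ V) (h₂ : ℝ → H), MemLp h₁ 2 (volIcc T) ∧ MemLp h₂ 1 (volIcc T) ∧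
    ∀ᵐ t ∂(volIcc T), h t = h₁ t + pivotDual ι (h₂ t)

/-- `u ∈ MR(0,T)` is a strong solution to `u'(t) = -Ã(t, u(t))`, `u(0) = x`:
`Ã(·,u(·)) ∈ L²(0,T;V*) + L¹(0,T;H)`, and `u(t) = x - ∫₀ᵗ Ã(s,u(s)) ds` in `V*` for all `t ∈ [0,T]`. -/
def IsStrongSolution (ι : V →L[ℝ] H) {T : ℝ} (A' : ℝ → V → StrongDual ℝ V) (x : H)
    (u : MR ι T) : Prop :=
  MemSum ι T (fun t => A' t (u.toL2 t)) ∧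
    ∀ t : Icc (0 : ℝ) T, pivotDual ι (u.toCont t) =
      pivotDual ι x - ∫ s in (0 : ℝ)..t, A' s (u.toL2 s)

/-- The operator `(t,v) ↦ A(t,v) - B(t,v)ψ(t)`, for which `u' = -A(t,u) + B(t,u)ψ` is the equation
above. -/
noncomputable def skeletonOp (ι : V →L[ℝ] H) (A : ℝ → V → StrongDual ℝ V)
    (B : ℝ → V → HilbertSchmidt U H) (ψ : ℝ → U) (t : ℝ) (v : V) : StrongDual ℝ V :=
  A t v - pivotDual ι ((B t v).toCLM (ψ t))

end Gelfand

/-!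
# Well-posedness of the skeleton equation in the critical variational setting

With `K₁(t, v) = -A(t, v)` and `K₂(t, v) = B(t, v) ψ(t)` the skeleton equation reads
`u' = K₁(t, u) + K₂(t, u)`, with `K₁` valued in `V*` and `K₂` in `H`. The assumptions enter only
through the properties collected in `IsParabolic`: locally in `H`, the drift `K₁` is, up to a
perturbation with arbitrarily small Lipschitz constant in the norm of `V` and terms that carry a
factor in the weaker norm of `H`, a bounded coercive linear operator, and `K₂` is Lipschitz with a
square integrable weight.

That the lower order terms fit in is where criticality is used. For `β > 1/2` the dyadic
decomposition of `v` by the Lax–Milgram regularizations `smoothing` gives the interpolation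
inequality `‖v‖_β ≤ C ‖v‖_H ^ (2 - 2β) ‖v‖_V ^ (2β - 1)` (`exists_interpNorm_le`). The condition
`2β ≤ 1 + 1 / (1 + ρ)` then allows Young's inequality to bound the difference of two lower order
terms by `η ‖u - v‖_V + K ‖u - v‖_H (1 + ‖u‖_V + ‖v‖_V)` for every `η > 0`
(`exists_sum_interp_lipschitz_le`, `isParabolic_of_isQuasilinearOn`).

The energy identity holds for right-hand sides in `L²(V*) + L¹(H)`
(`exists_isEvol_energy`): the smoothed energies are differentiable because primitives of integrable
functions are absolutely continuous, and one passes to the limit. Linear problems with a bounded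
coercive operator are solved by Lions' projection theorem (`exists_linear_evol`), and the energy
identity bounds their solution operator on `H × (L²(V*) + L¹(H))` (`IsEvol.linear_le`).

Local existence follows by freezing the leading coefficient at a point `v₀ ∈ V` that is close in `H`
to the initial value, and applying Banach's fixed point theorem in `C(H) × L²(V)`
(`IsLocallyLipschitz.exists_isEvol`, `IsParabolic.exists_local`). Here `v₀` is chosen before the
length of the interval, so its norm in `V` does no harm. Uniqueness is Gronwall's inequality
for the energy of the difference of two solutions (`IsParabolic.eqOn`); the weight contains
`‖u‖_V² + ‖u'‖_V²`, which is integrable.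

Coercivity gives global bounds. The term `½ ‖B‖²` absorbs `‖B‖ ‖ψ‖ ‖u‖_H` up to
`½ ‖ψ‖² ‖u‖_H²` (`CoerciveWith.skeleton_le`), and Gronwall's inequality turns the energy identity
into the asserted estimate (`IsEvol.apriori`, `IsEvol.norm_add_le`). Being uniform in the length of
the interval, the bound allows a solution to be continued past any `β < T`, so that the supremum of
the existence times is `T` (`IsParabolic.exists_isEvol`).
-/

/-! ### Primitives of integrable functions -/

/-- A function whose increments are dominated by those of an absolutely continuous function is
absolutely continuous. -/
theorem AbsolutelyContinuousOnInterval.of_dist_le {X Y : Type*} [PseudoMetricSpace X]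
    [PseudoMetricSpace Y] {m : ℝ → X} {f : ℝ → Y} {a b C : ℝ}
    (hm : AbsolutelyContinuousOnInterval m a b)
    (h : ∀ s ∈ uIcc a b, ∀ t ∈ uIcc a b, dist (f s) (f t) ≤ C * dist (m s) (m t)) :
    AbsolutelyContinuousOnInterval f a b := by
  have h0 := Filter.Tendsto.const_mul C
    (show Filter.Tendsto _ _ _ from hm)
  rw [mul_zero] at h0
  refine squeeze_zero'
    (Filter.Eventually.of_forall fun E => Finset.sum_nonneg fun _ _ => dist_nonneg)
    ?_ h0
  have : ∀ᶠ E : ℕ × (ℕ → ℝ × ℝ) in AbsolutelyContinuousOnInterval.totalLengthFilter ⊓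
      Filter.principal (AbsolutelyContinuousOnInterval.disjWithin a b),
      E ∈ AbsolutelyContinuousOnInterval.disjWithin a b :=
    Filter.eventually_inf_principal.mpr (by simp)
  filter_upwards [this] with E hE
  rw [Finset.mul_sum]
  exact Finset.sum_le_sum fun i hi => h _ (hE.1 i hi).1 _ (hE.1 i hi).2

theorem intervalIntegrable_sub_interval {E : Type*} [NormedAddCommGroup E] {k : ℝ → E} {a b s t : ℝ}
    (hk : IntervalIntegrable k volume a b) (hs : s ∈ uIcc a b) (ht : t ∈ uIcc a b) :
    IntervalIntegrable k volume s t :=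
  hk.mono_set (uIcc_subset_uIcc hs ht)

theorem norm_primitive_sub_le {E : Type*} [NormedAddCommGroup E] [NormedSpace ℝ E]
    {k : ℝ → E} {g : ℝ → ℝ} {a b : ℝ}
    (hk : IntervalIntegrable k volume a b) (hg : IntervalIntegrable g volume a b)
    (hkg : ∀ s, ‖k s‖ ≤ g s) {s t : ℝ} (hs : s ∈ uIcc a b) (ht : t ∈ uIcc a b) :
    ‖(∫ r in a..s, k r) - ∫ r in a..t, k r‖ ≤ |(∫ r in a..s, g r) - ∫ r in a..t, g r| := by
  have ha : a ∈ uIcc a b := left_mem_uIcc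
  rw [intervalIntegral.integral_interval_sub_left (intervalIntegrable_sub_interval hk ha hs)
    (intervalIntegrable_sub_interval hk ha ht),
    intervalIntegral.integral_interval_sub_left (intervalIntegrable_sub_interval hg ha hs)
    (intervalIntegrable_sub_interval hg ha ht)]
  exact intervalIntegral.norm_integral_le_abs_of_norm_le
    (Filter.Eventually.of_forall fun r => hkg r) (intervalIntegrable_sub_interval hg ht hs)

/-- Integration by parts for a bounded bilinear form evaluated at two primitives. -/
theorem bilin_primitive_eq {X Y : Type*} [NormedAddCommGroup X] [NormedSpace ℝ X] [CompleteSpace X]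
    [NormedAddCommGroup Y] [NormedSpace ℝ Y] [CompleteSpace Y] (L : X →L[ℝ] Y →L[ℝ] ℝ)
    {a b : ℝ} {k : ℝ → X} {p : ℝ → Y} (hk : IntervalIntegrable k volume a b)
    (hp : IntervalIntegrable p volume a b) (y₀ : X) (z₀ : Y) :
    L (y₀ + ∫ r in a..b, k r) (z₀ + ∫ r in a..b, p r) = L y₀ z₀ +
      ∫ s in a..b, (L (k s) (z₀ + ∫ r in a..s, p r) + L (y₀ + ∫ r in a..s, k r) (p s)) := by
  set y : ℝ → X := fun s => y₀ + ∫ r in a..s, k r with hy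
  set z : ℝ → Y := fun s => z₀ + ∫ r in a..s, p r with hz
  set g : ℝ → ℝ := fun s => ‖k s‖ + ‖p s‖ with hg
  have hgi : IntervalIntegrable g volume a b := hk.norm.add hp.norm
  have hm := hgi.absolutelyContinuousOnInterval_intervalIntegral (c := a) left_mem_uIcc
  have ha : a ∈ uIcc a b := left_mem_uIcc
  have hyd : ∀ s ∈ uIcc a b, ∀ t ∈ uIcc a b,
      ‖y s - y t‖ ≤ |(∫ r in a..s, g r) - ∫ r in a..t, g r| := by
    intro s hs t ht
    have := norm_primitive_sub_le hk hgi (fun s => by simp [hg]) hs ht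
    simpa [hy] using this
  have hzd : ∀ s ∈ uIcc a b, ∀ t ∈ uIcc a b,
      ‖z s - z t‖ ≤ |(∫ r in a..s, g r) - ∫ r in a..t, g r| := by
    intro s hs t ht
    have := norm_primitive_sub_le hp hgi (fun s => by simp [hg]) hs ht
    simpa [hz] using this
  obtain ⟨Cm, hCm⟩ := hm.exists_bound
  have hyb : ∀ s ∈ uIcc a b, ‖y s‖ ≤ ‖y₀‖ + Cm := by
    intro s hs
    have h1 := hyd s hs a ha
    simp only [hy, intervalIntegral.integral_same, add_zero, sub_zero] at h1
    have h2 := hCm s hs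
    have h3 : ‖y₀ + ∫ r in a..s, k r‖ ≤ ‖y₀‖ + ‖y₀ + (∫ r in a..s, k r) - y₀‖ := by
      refine le_trans (le_of_eq ?_) (norm_add_le _ _)
      congr 1; abel
    rw [Real.norm_eq_abs] at h2
    exact h3.trans (by linarith)
  have hzb : ∀ s ∈ uIcc a b, ‖z s‖ ≤ ‖z₀‖ + Cm := by
    intro s hs
    have h1 := hzd s hs a ha
    simp only [hz, intervalIntegral.integral_same, add_zero, sub_zero] at h1
    have h2 := hCm s hs
    have h3 : ‖z₀ + ∫ r in a..s, p r‖ ≤ ‖z₀‖ + ‖z₀ + (∫ r in a..s, p r) - z₀‖ := by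
      refine le_trans (le_of_eq ?_) (norm_add_le _ _)
      congr 1; abel
    rw [Real.norm_eq_abs] at h2
    exact h3.trans (by linarith)
  have hac : AbsolutelyContinuousOnInterval (fun s => L (y s) (z s)) a b := by
    refine hm.of_dist_le (C := ‖L‖ * (‖z₀‖ + Cm) + ‖L‖ * (‖y₀‖ + Cm)) fun s hs t ht => ?_
    rw [Real.dist_eq, Real.dist_eq]
    have e : L (y s) (z s) - L (y t) (z t) = L (y s - y t) (z s) + L (y t) (z s - z t) := by
      simp [map_sub]
    rw [e]
    have h1 := (L.le_opNorm₂ (y s - y t) (z s))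
    have h2 := (L.le_opNorm₂ (y t) (z s - z t))
    rw [Real.norm_eq_abs] at h1 h2
    refine (abs_add_le _ _).trans ?_
    set d := |(∫ r in a..s, g r) - ∫ r in a..t, g r|
    have h3 : ‖L‖ * ‖y s - y t‖ * ‖z s‖ ≤ ‖L‖ * d * (‖z₀‖ + Cm) :=
      mul_le_mul (mul_le_mul_of_nonneg_left (hyd s hs t ht) (norm_nonneg L)) (hzb s hs)
        (norm_nonneg _) (by positivity)
    have h4 : ‖L‖ * ‖y t‖ * ‖z s - z t‖ ≤ ‖L‖ * (‖y₀‖ + Cm) * d :=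
      mul_le_mul (mul_le_mul_of_nonneg_left (hyb t ht) (norm_nonneg L)) (hzd s hs t ht)
        (norm_nonneg _) (mul_nonneg (norm_nonneg L) ((norm_nonneg _).trans (hyb t ht)))
    linarith
  have hd := hac.integral_deriv_eq_sub
  have hc : ∫ x in a..b, deriv (fun s => L (y s) (z s)) x =
      ∫ s in a..b, (L (k s) (z s) + L (y s) (p s)) := by
    apply intervalIntegral.integral_congr_ae
    filter_upwards [hk.ae_hasDerivAt_integral, hp.ae_hasDerivAt_integral] with s h1 h2 hs
    have hs' := uIoc_subset_uIcc hs
    have d1 : HasDerivAt y (k s) s := (h1 hs' a ha).const_add y₀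
    have d2 : HasDerivAt z (p s) s := (h2 hs' a ha).const_add z₀
    have d3 := (L.hasFDerivAt.comp_hasDerivAt s d1).clm_apply d2
    exact d3.deriv
  rw [hc] at hd
  have e0 : L (y a) (z a) = L y₀ z₀ := by simp [hy, hz]
  rw [e0] at hd
  linarith

/-- Gronwall's inequality with an integrable coefficient. -/
theorem le_mul_exp_integral_of_le {a b c : ℝ} (hab : a ≤ b) {E κ : ℝ → ℝ}
    (hE : ContinuousOn E (Icc a b)) (hκ : IntervalIntegrable κ volume a b) (hκ0 : ∀ t, 0 ≤ κ t)
    (h : ∀ t ∈ Icc a b, E t ≤ c + ∫ s in a..t, κ s * E s) :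
    E b ≤ c * Real.exp (∫ s in a..b, κ s) := by
  have hκE : IntervalIntegrable (fun s => κ s * E s) volume a b :=
    hκ.mul_continuousOn (by rwa [uIcc_of_le hab])
  have ha : a ∈ uIcc a b := left_mem_uIcc
  set m : ℝ → ℝ := fun t => ∫ s in a..t, κ s with hm
  set Φ : ℝ → ℝ := fun t => ∫ s in a..t, κ s * E s with hΦ
  have hmAC := hκ.absolutelyContinuousOnInterval_intervalIntegral ha
  have hΦAC := hκE.absolutelyContinuousOnInterval_intervalIntegral ha
  have hm0 : ∀ t ∈ uIcc a b, 0 ≤ m t := by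
    intro t ht
    rw [uIcc_of_le hab] at ht
    exact intervalIntegral.integral_nonneg ht.1 fun s _ => hκ0 s
  have hexp : AbsolutelyContinuousOnInterval (fun t => Real.exp (-m t)) a b := by
    refine hmAC.of_dist_le (C := 1) fun s hs t ht => ?_
    rw [one_mul, Real.dist_eq, Real.dist_eq]
    have key : ∀ x y : ℝ, 0 ≤ x → x ≤ y → |Real.exp (-x) - Real.exp (-y)| ≤ |x - y| := by
      intro x y hx hxy
      have e1 : Real.exp (-y) = Real.exp (-x) * Real.exp (x - y) := by
        rw [← Real.exp_add]; congr 1; ring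
      have e2 : Real.exp (-x) ≤ 1 := Real.exp_le_one_iff.mpr (by linarith)
      have e3 := Real.add_one_le_exp (x - y)
      have e4 : Real.exp (x - y) ≤ 1 := Real.exp_le_one_iff.mpr (by linarith)
      have e5 := Real.exp_pos (-x)
      rw [abs_of_nonneg (by rw [e1]; nlinarith), abs_of_nonpos (by linarith), e1]
      nlinarith
    rcases le_total (m s) (m t) with hst | hst
    · exact key _ _ (hm0 s hs) hst
    · rw [abs_sub_comm, abs_sub_comm (∫ _ in _.._, _)]
      exact key _ _ (hm0 t ht) hst
  have hΦc : AbsolutelyContinuousOnInterval (fun t => c + Φ t) a b :=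
    hΦAC.of_dist_le (C := 1) fun s _ t _ => by simp [hΦ]
  have hprod := hΦc.fun_mul hexp
  have hint := hprod.integral_deriv_eq_sub
  have hle : ∫ x in a..b, deriv (fun t => (c + Φ t) * Real.exp (-m t)) x ≤ 0 := by
    rw [intervalIntegral.integral_of_le hab]
    apply integral_nonpos_of_ae
    rw [Filter.EventuallyLE, ae_restrict_iff' measurableSet_Ioc]
    filter_upwards [hκ.ae_hasDerivAt_integral, hκE.ae_hasDerivAt_integral] with s h1 h2 hs
    have hs1 : s ∈ Icc a b := Ioc_subset_Icc_self hs
    have hs' : s ∈ uIcc a b := by rwa [uIcc_of_le hab]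
    have d1 : HasDerivAt m (κ s) s := h1 hs' a ha
    have d2 : HasDerivAt (fun t => c + Φ t) (κ s * E s) s := (h2 hs' a ha).const_add c
    rw [(d2.fun_mul d1.fun_neg.exp).deriv]
    have h3 := h s hs1
    have h4 := Real.exp_pos (-m s)
    have h5 := hκ0 s
    have h6 : 0 ≤ κ s * Real.exp (-m s) * (c + Φ s - E s) :=
      mul_nonneg (mul_nonneg h5 h4.le) (by simpa [hΦ] using h3)
    simp only [Pi.zero_apply]
    linarith
  have hea : (c + Φ a) * Real.exp (-m a) = c := by simp [hΦ, hm]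
  have hb := h b (right_mem_Icc.mpr hab)
  have h1 : (c + Φ b) * Real.exp (-m b) ≤ c := by
    have := hint ▸ hle
    linarith [hea]
  calc E b ≤ c + Φ b := hb
    _ = (c + Φ b) * Real.exp (-m b) * Real.exp (m b) := by
        rw [mul_assoc, ← Real.exp_add]; simp
    _ ≤ c * Real.exp (m b) := mul_le_mul_of_nonneg_right h1 (Real.exp_pos _).le

/-! ### The pivot embedding and its regularization -/

section Pivot

variable {V H : Type*} [NormedAddCommGroup V] [InnerProductSpace ℝ V]
  [NormedAddCommGroup H] [InnerProductSpace ℝ H]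

/-- The embedding `H → V*` as a bounded linear map. -/
noncomputable def pivotCLM (ι : V →L[ℝ] H) : H →L[ℝ] StrongDual ℝ V :=
  ((ContinuousLinearMap.compL ℝ V H ℝ).flip ι).comp (innerSL ℝ)

theorem pivotCLM_eq (ι : V →L[ℝ] H) (x : H) : pivotCLM ι x = pivotDual ι x := rfl

theorem pivotCLM_apply (ι : V →L[ℝ] H) (x : H) (v : V) : pivotCLM ι x v = inner ℝ x (ι v) := rfl

theorem norm_pivotCLM_apply_le (ι : V →L[ℝ] H) (x : H) : ‖pivotCLM ι x‖ ≤ ‖ι‖ * ‖x‖ := by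
  refine ContinuousLinearMap.opNorm_le_bound _ (by positivity) fun v => ?_
  rw [pivotCLM_apply]
  calc ‖inner ℝ x (ι v)‖ ≤ ‖x‖ * ‖ι v‖ := norm_inner_le_norm _ _
    _ ≤ ‖x‖ * (‖ι‖ * ‖v‖) := by gcongr; exact ι.le_opNorm v
    _ = ‖ι‖ * ‖x‖ * ‖v‖ := by ring

theorem pivotCLM_injective {ι : V →L[ℝ] H} (hι : DenseRange ι) :
    Function.Injective (pivotCLM ι) := by
  rw [injective_iff_map_eq_zero]
  intro x hx
  refine DenseRange.eq_zero_of_inner_left (𝕜 := ℝ) hι fun v => ?_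
  rw [← pivotCLM_apply, hx]; rfl

/-- The Lax–Milgram theorem for the form `ε (·, ·)_V + (ι ·, ι ·)_H`. -/
theorem exists_smoothing [CompleteSpace V] (ι : V →L[ℝ] H) {ε : ℝ} (hε : 0 < ε) :
    ∃ S : StrongDual ℝ V →L[ℝ] V, ∀ (y : StrongDual ℝ V) (w : V),
      ε * inner ℝ (S y) w + inner ℝ (ι (S y)) (ι w) = y w := by
  let I : V →L[ℝ] V →L[ℝ] ℝ := innerSL ℝ
  let L : V →L[ℝ] V →L[ℝ] ℝ := ε • I + (pivotCLM ι).comp ι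
  have hL : ∀ v w, L v w = ε * inner ℝ v w + inner ℝ (ι v) (ι w) := fun v w => rfl
  have hc : IsCoercive L := by
    refine ⟨ε, hε, fun v => ?_⟩
    rw [hL, real_inner_self_eq_norm_sq, real_inner_self_eq_norm_sq]
    nlinarith [sq_nonneg ‖ι v‖]
  refine ⟨hc.continuousLinearEquivOfBilin.symm.toContinuousLinearMap.comp
    (InnerProductSpace.toDual ℝ V).symm.toContinuousLinearEquiv.toContinuousLinearMap,
    fun y w => ?_⟩
  rw [← hL, ← hc.continuousLinearEquivOfBilin_apply]
  simp

/-- The resolvent-type map `V* → V` that sends `y` to the solution `z` of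
`ε (z, w)_V + (ι z, ι w)_H = ⟨y, w⟩` for all `w`. Composed with the embedding `V → V*`, it tends to
the identity as `ε → 0`. -/
noncomputable def smoothing [CompleteSpace V] (ι : V →L[ℝ] H) {ε : ℝ} (hε : 0 < ε) :
    StrongDual ℝ V →L[ℝ] V :=
  (exists_smoothing ι hε).choose

variable [CompleteSpace V] (ι : V →L[ℝ] H) {ε : ℝ} (hε : 0 < ε)

theorem smoothing_spec (y : StrongDual ℝ V) (w : V) :
    ε * inner ℝ (smoothing ι hε y) w + inner ℝ (ι (smoothing ι hε y)) (ι w) = y w :=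
  (exists_smoothing ι hε).choose_spec y w

theorem smoothing_symm (y y' : StrongDual ℝ V) :
    y' (smoothing ι hε y) = y (smoothing ι hε y') := by
  rw [← smoothing_spec ι hε y, ← smoothing_spec ι hε y', real_inner_comm,
    real_inner_comm (ι _) (ι _)]

theorem apply_smoothing_self (y : StrongDual ℝ V) :
    y (smoothing ι hε y) = ε * ‖smoothing ι hε y‖ ^ 2 + ‖ι (smoothing ι hε y)‖ ^ 2 := by
  rw [← smoothing_spec ι hε y, real_inner_self_eq_norm_sq, real_inner_self_eq_norm_sq]

/-- For data in `H` the smoothing is a contraction of `H`, and is of size `ε ^ (-1/2)` in `V`. -/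
theorem norm_smoothing_pivot_le (h : H) :
    ‖ι (smoothing ι hε (pivotCLM ι h))‖ ≤ ‖h‖ ∧
      ε * ‖smoothing ι hε (pivotCLM ι h)‖ ^ 2 ≤ ‖h‖ ^ 2 := by
  have h1 := apply_smoothing_self ι hε (pivotCLM ι h)
  rw [pivotCLM_apply] at h1
  set z := smoothing ι hε (pivotCLM ι h)
  have h2 := real_inner_le_norm h (ι z)
  have h3 : 0 ≤ ε * ‖z‖ ^ 2 := by positivity
  have h4 : ‖ι z‖ ≤ ‖h‖ := by
    by_contra hc
    push Not at hc
    nlinarith [norm_nonneg h, norm_nonneg (ι z)]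
  exact ⟨h4, by nlinarith [norm_nonneg h, norm_nonneg (ι z)]⟩

theorem pivot_sub_smoothing (h : H) (w : V) :
    inner ℝ (h - ι (smoothing ι hε (pivotCLM ι h))) (ι w) =
      ε * inner ℝ (smoothing ι hε (pivotCLM ι h)) w := by
  have h1 := smoothing_spec ι hε (pivotCLM ι h) w
  rw [pivotCLM_apply] at h1
  rw [inner_sub_left]; linarith

theorem norm_pivot_sub_smoothing_le (h : H) :
    ‖pivotCLM ι (h - ι (smoothing ι hε (pivotCLM ι h)))‖ ≤
      ε * ‖smoothing ι hε (pivotCLM ι h)‖ := by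
  refine ContinuousLinearMap.opNorm_le_bound _ (by positivity) fun w => ?_
  rw [pivotCLM_apply, pivot_sub_smoothing, norm_mul, Real.norm_of_nonneg hε.le, mul_assoc]
  exact mul_le_mul_of_nonneg_left (norm_inner_le_norm _ _) hε.le

theorem inner_smoothing_sub_nonneg (v : V) :
    0 ≤ inner ℝ (smoothing ι hε (pivotCLM ι (ι v))) (v - smoothing ι hε (pivotCLM ι (ι v))) := by
  have h1 := pivot_sub_smoothing ι hε (ι v) (v - smoothing ι hε (pivotCLM ι (ι v)))
  rw [map_sub, real_inner_self_eq_norm_sq] at h1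
  have : 0 ≤ ε * inner ℝ (smoothing ι hε (pivotCLM ι (ι v)))
      (v - smoothing ι hε (pivotCLM ι (ι v))) := by rw [← h1]; positivity
  exact nonneg_of_mul_nonneg_right this hε

/-- For data in `V` the smoothing is a contraction of `V`. -/
theorem norm_smoothing_le (v : V) : ‖smoothing ι hε (pivotCLM ι (ι v))‖ ≤ ‖v‖ := by
  have h1 := inner_smoothing_sub_nonneg ι hε v
  set z := smoothing ι hε (pivotCLM ι (ι v))
  rw [inner_sub_right, real_inner_self_eq_norm_sq] at h1
  have h2 := real_inner_le_norm z v
  by_contra hc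
  push Not at hc
  nlinarith [norm_nonneg v, norm_nonneg z]

end Pivot

/-! ### Interpolation inequality -/

section Interp

variable {V H : Type*} [NormedAddCommGroup V] [InnerProductSpace ℝ V]
  [NormedAddCommGroup H] [InnerProductSpace ℝ H]

/-- `M` is an upper bound for `‖v‖_β` that comes from an admissible function on the strip. -/
def IsInterpBound (ι : V →L[ℝ] H) (β : ℝ) (v : V) (M : ℝ) : Prop :=
  0 ≤ M ∧ ∃ (f : ℂ → (V →L[ℝ] ℂ)) (g : ℝ → WithLp 2 (V × V)),
    DiffContOnCl ℂ f {z : ℂ | 0 < z.re ∧ z.re < 1} ∧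
    (∃ K : ℝ, ∀ z : ℂ, 0 ≤ z.re → z.re ≤ 1 → ‖f z‖ ≤ K) ∧
    Continuous g ∧
    (∀ t : ℝ, f (1 + t * Complex.I) = complexEmb ι (g t)) ∧
    (∀ t : ℝ, ‖f (t * Complex.I)‖ ≤ M) ∧
    (∀ t : ℝ, ‖g t‖ ≤ M) ∧
    f β = complexEmb ι (WithLp.toLp 2 (v, 0))

theorem interpNorm_nonneg (ι : V →L[ℝ] H) (β : ℝ) (v : V) : 0 ≤ interpNorm ι β v :=
  Real.sInf_nonneg fun _ h => h.1

theorem IsInterpBound.interpNorm_le {ι : V →L[ℝ] H} {β : ℝ} {v : V} {M : ℝ}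
    (h : IsInterpBound ι β v M) : interpNorm ι β v ≤ M :=
  csInf_le ⟨0, fun _ h => h.1⟩ h

theorem complexEmb_apply (ι : V →L[ℝ] H) (a b x : V) :
    complexEmb ι (WithLp.toLp 2 (a, b)) x =
      (inner ℝ (ι a) (ι x) : ℝ) + Complex.I * (inner ℝ (ι b) (ι x) : ℝ) := by
  simp [complexEmb, pivotDual]

theorem complexEmb_add (ι : V →L[ℝ] H) (p q : WithLp 2 (V × V)) :
    complexEmb ι (p + q) = complexEmb ι p + complexEmb ι q := by
  ext w
  simp [complexEmb, pivotDual]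
  ring

theorem IsInterpBound.add {ι : V →L[ℝ] H} {β : ℝ} {v w : V} {M N : ℝ}
    (hv : IsInterpBound ι β v M) (hw : IsInterpBound ι β w N) :
    IsInterpBound ι β (v + w) (M + N) := by
  obtain ⟨hM, f, g, h1, ⟨K, h2⟩, h3, h4, h5, h6, h7⟩ := hv
  obtain ⟨hN, f', g', h1', ⟨K', h2'⟩, h3', h4', h5', h6', h7'⟩ := hw
  refine ⟨add_nonneg hM hN, f + f', g + g', h1.add h1', ⟨K + K', fun z hz hz' => ?_⟩,
    h3.add h3', fun t => ?_, fun t => ?_, fun t => ?_, ?_⟩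
  · exact norm_add_le_of_le (h2 z hz hz') (h2' z hz hz')
  · simp only [Pi.add_apply, h4, h4', complexEmb_add]
  · exact norm_add_le_of_le (h5 t) (h5' t)
  · exact norm_add_le_of_le (h6 t) (h6' t)
  · simp only [Pi.add_apply, h7, h7', ← complexEmb_add]
    congr 1
    rw [← WithLp.toLp_add, Prod.mk_add_mk, add_zero]

/-- The function `z ↦ c ^ (z - β) w` on the strip, for `c = α₀ / α₁`, shows that
`‖w‖_β ≤ ‖w‖_{V*} ^ (1 - β) ‖w‖_V ^ β`. -/
theorem isInterpBound_of_le (ι : V →L[ℝ] H) {β : ℝ} (w : V) {α₀ α₁ : ℝ} (h₀ : 0 < α₀) (h₁ : 0 < α₁)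
    (hw₀ : ‖pivotCLM ι (ι w)‖ ≤ α₀) (hw₁ : ‖w‖ ≤ α₁) :
    IsInterpBound ι β w (α₀ ^ (1 - β) * α₁ ^ β) := by
  set c : ℝ := α₀ / α₁ with hc
  have hc0 : 0 < c := div_pos h₀ h₁
  have hcc : (c : ℂ) ≠ 0 := Complex.ofReal_ne_zero.mpr hc0.ne'
  set e : V →L[ℝ] ℂ := complexEmb ι (WithLp.toLp 2 (w, 0)) with he
  have hnorm : ‖e‖ ≤ α₀ := by
    refine ContinuousLinearMap.opNorm_le_bound _ h₀.le fun x => ?_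
    have : e x = ((pivotCLM ι (ι w) x : ℝ) : ℂ) := by
      simp [he, complexEmb, pivotDual, pivotCLM_apply]
    rw [this, Complex.norm_real]
    exact ((pivotCLM ι (ι w)).le_opNorm x).trans (by gcongr)
  have hpow : ∀ z : ℂ, ‖(c : ℂ) ^ (z - β)‖ = c ^ (z.re - β) := fun z => by
    rw [Complex.norm_cpow_eq_rpow_re_of_pos hc0]; simp
  have hdiff : Differentiable ℂ fun z : ℂ => (c : ℂ) ^ (z - β) • e := by
    refine Differentiable.smul_const ?_ e
    intro z
    exact ((differentiableAt_id.sub_const _).const_cpow (Or.inl hcc))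
  have hM0 : c ^ (-β) * α₀ = α₀ ^ (1 - β) * α₁ ^ β := by
    rw [hc, Real.div_rpow h₀.le h₁.le, Real.rpow_sub h₀, Real.rpow_one, Real.rpow_neg h₀.le,
      Real.rpow_neg h₁.le]
    field_simp
  have hM1 : c ^ (1 - β) * α₁ = α₀ ^ (1 - β) * α₁ ^ β := by
    rw [hc, Real.div_rpow h₀.le h₁.le, Real.rpow_sub h₁, Real.rpow_one]
    field_simp
  let g : ℝ → WithLp 2 (V × V) := fun t =>
    WithLp.toLp 2 ((((c : ℂ) ^ ((1 : ℂ) + t * Complex.I - β)).re • w,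
      ((c : ℂ) ^ ((1 : ℂ) + t * Complex.I - β)).im • w))
  refine ⟨by positivity, fun z => (c : ℂ) ^ (z - β) • e, g, hdiff.diffContOnCl, ?_, ?_, ?_, ?_, ?_,
    ?_⟩
  · refine ⟨(c ^ (-β) + c ^ (1 - β)) * α₀, fun z hz0 hz1 => ?_⟩
    rw [norm_smul, hpow]
    refine mul_le_mul ?_ hnorm (norm_nonneg _) (by positivity)
    rcases le_total c 1 with h | h
    · exact (Real.rpow_le_rpow_of_exponent_ge hc0 h (by linarith : -β ≤ z.re - β)).trans
        (le_add_of_nonneg_right (by positivity))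
    · exact (Real.rpow_le_rpow_of_exponent_le h (by linarith : z.re - β ≤ 1 - β)).trans
        (le_add_of_nonneg_left (by positivity))
  · have hcont : Continuous fun t : ℝ => (c : ℂ) ^ ((1 : ℂ) + t * Complex.I - β) := by
      refine Continuous.const_cpow ?_ (Or.inl hcc)
      fun_prop
    refine (WithLp.prod_continuous_toLp 2 V V).comp ?_
    exact ((Complex.continuous_re.comp hcont).smul continuous_const).prodMk
      ((Complex.continuous_im.comp hcont).smul continuous_const)
  · intro t
    ext x
    set q := (c : ℂ) ^ ((1 : ℂ) + t * Complex.I - β)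
    change q * e x = complexEmb ι (WithLp.toLp 2 (q.re • w, q.im • w)) x
    rw [he, complexEmb_apply, complexEmb_apply]
    conv_lhs => rw [← Complex.re_add_im q]
    simp only [map_smul, real_inner_smul_left, map_zero, inner_zero_left, Complex.ofReal_mul,
      Complex.ofReal_zero]
    ring
  · intro t
    rw [norm_smul, hpow, ← hM0]
    have : ((t : ℂ) * Complex.I).re = 0 := by simp
    rw [this, zero_sub]
    gcongr
  · intro t
    have h2 : ‖g t‖ = ‖(c : ℂ) ^ ((1 : ℂ) + t * Complex.I - β)‖ * ‖w‖ := by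
      rw [WithLp.prod_norm_eq_of_L2, WithLp.toLp_fst, WithLp.toLp_snd]
      simp only [norm_smul, mul_pow, ← add_mul, Real.norm_eq_abs, sq_abs]
      rw [Real.sqrt_mul (by positivity), Real.sqrt_sq (norm_nonneg _),
        Complex.norm_eq_sqrt_sq_add_sq]
    rw [h2, hpow, ← hM1]
    have : ((1 : ℂ) + (t : ℂ) * Complex.I).re = 1 := by simp
    rw [this]
    gcongr
  · simp [he]

end Interp

section Interp

variable {V H : Type*} [NormedAddCommGroup V] [InnerProductSpace ℝ V] [CompleteSpace V]
  [NormedAddCommGroup H] [InnerProductSpace ℝ H]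

/-- The smoothing at the scale `μ ^ 2`: bounded in `H`, of size `a / μ` in `V`. As `μ → ∞` it
tends to `0` in the interpolation norm. -/
theorem isInterpBound_smoothing (ι : V →L[ℝ] H) {β a : ℝ} {v : V} (ha : 0 < a) (hav : ‖ι v‖ ≤ a)
    {μ : ℝ} (hμ : 0 < μ) :
    IsInterpBound ι β (smoothing ι (pow_pos hμ 2) (pivotCLM ι (ι v)))
      (((‖ι‖ + 1) * a) ^ (1 - β) * (a / μ) ^ β) := by
  obtain ⟨h1, h2⟩ := norm_smoothing_pivot_le ι (pow_pos hμ 2) (ι v)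
  refine isInterpBound_of_le ι _ (by positivity) (by positivity) ?_ ?_
  · refine (norm_pivotCLM_apply_le ι _).trans ?_
    have := norm_nonneg ι
    have h3 := h1.trans hav
    nlinarith [norm_nonneg (ι (smoothing ι (pow_pos hμ 2) (pivotCLM ι (ι v))))]
  · rw [le_div_iff₀ hμ]
    rw [← mul_pow] at h2
    have := abs_le_of_sq_le_sq' h2 (norm_nonneg _)
    linarith [this.2]

/-- A dyadic piece is of size `μ a` in `V*` and `a / μ` in `V`; its interpolation norm is of order
`a μ ^ (1 - 2β)`, which is summable over dyadic `μ` because `β > 1/2`. -/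
theorem isInterpBound_smoothing_sub (ι : V →L[ℝ] H) {β a : ℝ} {v : V} (ha : 0 < a)
    (hav : ‖ι v‖ ≤ a) {μ : ℝ} (hμ : 0 < μ) :
    IsInterpBound ι β (smoothing ι (pow_pos hμ 2) (pivotCLM ι (ι v)) -
        smoothing ι (pow_pos (mul_pos two_pos hμ) 2) (pivotCLM ι (ι v)))
      ((3 * μ * a) ^ (1 - β) * (2 * (a / μ)) ^ β) := by
  have key : ∀ {ν : ℝ} (hν : 0 < ν),
      ν * ‖smoothing ι (pow_pos hν 2) (pivotCLM ι (ι v))‖ ≤ a := by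
    intro ν hν
    obtain ⟨h1, h2⟩ := norm_smoothing_pivot_le ι (pow_pos hν 2) (ι v)
    rw [← mul_pow] at h2
    have := abs_le_of_sq_le_sq' h2 (norm_nonneg _)
    linarith [this.2]
  have key2 : ∀ {ν : ℝ} (hν : 0 < ν),
      ‖pivotCLM ι (ι v - ι (smoothing ι (pow_pos hν 2) (pivotCLM ι (ι v))))‖ ≤ ν * a := by
    intro ν hν
    refine (norm_pivot_sub_smoothing_le ι (pow_pos hν 2) (ι v)).trans ?_
    have := key hν
    calc ν ^ 2 * ‖smoothing ι (pow_pos hν 2) (pivotCLM ι (ι v))‖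
        = ν * (ν * ‖smoothing ι (pow_pos hν 2) (pivotCLM ι (ι v))‖) := by ring
      _ ≤ ν * a := mul_le_mul_of_nonneg_left this hν.le
  have k1 := key hμ
  have k2 := key (mul_pos two_pos hμ)
  have l1 := key2 hμ
  have l2 := key2 (mul_pos two_pos hμ)
  set z := smoothing ι (pow_pos hμ 2) (pivotCLM ι (ι v))
  set z' := smoothing ι (pow_pos (mul_pos two_pos hμ) 2) (pivotCLM ι (ι v))
  refine isInterpBound_of_le ι _ (by positivity) (by positivity) ?_ ?_
  · have e : pivotCLM ι (ι (z - z')) =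
        pivotCLM ι (ι v - ι z') - pivotCLM ι (ι v - ι z) := by
      rw [← map_sub]; congr 1; rw [map_sub]; abel
    rw [e]
    refine (norm_sub_le _ _).trans ?_
    linarith
  · refine (norm_sub_le _ _).trans ?_
    have h1 : ‖z‖ ≤ a / μ := by rw [le_div_iff₀ hμ]; linarith
    have h2 : ‖z'‖ ≤ a / μ := by
      rw [le_div_iff₀ hμ]
      nlinarith [norm_nonneg z']
    linarith

/-- The error of the smoothing at the scale `μ ^ 2` is of size `μ ^ 2 b` in `V*` and `b` in `V`. -/
theorem isInterpBound_sub_smoothing (ι : V →L[ℝ] H) {β b : ℝ} {v : V} (hb : 0 < b)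
    (hbv : ‖v‖ ≤ b) {μ : ℝ} (hμ : 0 < μ) :
    IsInterpBound ι β (v - smoothing ι (pow_pos hμ 2) (pivotCLM ι (ι v)))
      ((μ ^ 2 * b) ^ (1 - β) * (2 * b) ^ β) := by
  have h1 := norm_smoothing_le ι (pow_pos hμ 2) v
  refine isInterpBound_of_le ι _ (by positivity) (by positivity) ?_ ?_
  · rw [map_sub]
    refine (norm_pivot_sub_smoothing_le ι (pow_pos hμ 2) (ι v)).trans ?_
    gcongr
    exact h1.trans hbv
  · refine (norm_sub_le _ _).trans ?_
    linarith

/-- The interpolation inequality `‖v‖_β ≤ C ‖v‖_H ^ (2 - 2β) ‖v‖_V ^ (2β - 1)`, proved by summing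
over the dyadic pieces `J_k v - J_{k+1} v` with `J_k` the smoothing at scale `(2 ^ k μ) ^ 2`,
`μ = ‖v‖_H / ‖v‖_V`. -/
theorem exists_interpNorm_le {ι : V →L[ℝ] H} (hι : Function.Injective ι) {β : ℝ}
    (hβ : β ∈ Ioo (1 / 2 : ℝ) 1) :
    ∃ C : ℝ, 0 < C ∧ ∀ v : V,
      interpNorm ι β v ≤ C * (‖ι v‖ ^ (2 - 2 * β) * ‖v‖ ^ (2 * β - 1)) := by
  obtain ⟨hβ1, hβ2⟩ := hβ
  set q : ℝ := 2 ^ (1 - 2 * β) with hq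
  have hq0 : 0 < q := by positivity
  have hq1 : q < 1 := Real.rpow_lt_one_of_one_lt_of_neg (by norm_num) (by linarith)
  refine ⟨2 + 6 * (1 - q)⁻¹, by have := sub_pos.mpr hq1; positivity, fun v => ?_⟩
  rcases eq_or_ne v 0 with rfl | hv
  · have h0 : IsInterpBound ι β (0 : V) 0 := by
      refine ⟨le_rfl, 0, 0, differentiable_const (0 : V →L[ℝ] ℂ) |>.diffContOnCl, ⟨0, by simp⟩,
        continuous_const, ?_, by simp, by simp, ?_⟩
      · intro t; ext x; simp [complexEmb, pivotDual]
      · ext x; simp [complexEmb, pivotDual]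
    have := h0.interpNorm_le
    rw [map_zero, norm_zero, norm_zero, Real.zero_rpow (by linarith)]
    simpa using this
  set a := ‖ι v‖ with ha
  set b := ‖v‖ with hb
  have ha0 : 0 < a := norm_pos_iff.mpr ((map_ne_zero_iff ι hι).mpr hv)
  have hb0 : 0 < b := norm_pos_iff.mpr hv
  set X := a ^ (2 - 2 * β) * b ^ (2 * β - 1) with hX
  have hX0 : 0 < X := by positivity
  -- at `μ = a / b` the bounds for the error and for the first dyadic piece balance: both are
  -- multiples of `X`
  set μ : ℕ → ℝ := fun k => a / b * 2 ^ k with hμ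
  have hμ0 : ∀ k, 0 < μ k := fun k => by positivity
  have hμs : ∀ k, μ (k + 1) = 2 * μ k := fun k => by simp only [hμ, pow_succ]; ring
  let J : ℕ → V := fun k => smoothing ι (pow_pos (hμ0 k) 2) (pivotCLM ι (ι v))
  have hJ0 : IsInterpBound ι β (v - J 0) ((μ 0 ^ 2 * b) ^ (1 - β) * (2 * b) ^ β) :=
    isInterpBound_sub_smoothing ι hb0 le_rfl (hμ0 0)
  have hJs : ∀ k, IsInterpBound ι β (J k - J (k + 1))
      ((3 * μ k * a) ^ (1 - β) * (2 * (a / μ k)) ^ β) := by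
    intro k
    have h := isInterpBound_smoothing_sub ι (β := β) ha0 le_rfl (hμ0 k) (v := v)
    have e : J (k + 1) = smoothing ι (pow_pos (mul_pos two_pos (hμ0 k)) 2) (pivotCLM ι (ι v)) := by
      simp only [J, hμs k]
    rw [e]; exact h
  have hJN : ∀ N, IsInterpBound ι β (J N) (((‖ι‖ + 1) * a) ^ (1 - β) * (a / μ N) ^ β) :=
    fun N => isInterpBound_smoothing ι ha0 le_rfl (hμ0 N)
  have hsum : ∀ N, IsInterpBound ι β (v - J N) ((μ 0 ^ 2 * b) ^ (1 - β) * (2 * b) ^ β +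
      ∑ k ∈ Finset.range N, (3 * μ k * a) ^ (1 - β) * (2 * (a / μ k)) ^ β) := by
    intro N
    induction N with
    | zero => simpa using hJ0
    | succ N ih =>
      rw [Finset.sum_range_succ, ← add_assoc]
      have := ih.add (hJs N)
      rwa [sub_add_sub_cancel] at this
  have c0 : (μ 0 ^ 2 * b) ^ (1 - β) * (2 * b) ^ β ≤ 2 * X := by
    have e : (μ 0 ^ 2 * b) ^ (1 - β) * (2 * b) ^ β = 2 ^ β * X := by
      rw [Real.mul_rpow (by positivity) hb0.le, Real.mul_rpow (by norm_num) hb0.le,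
        ← Real.rpow_natCast (μ 0) 2, ← Real.rpow_mul (hμ0 0).le]
      have : μ 0 = a / b := by simp [hμ]
      rw [this, Real.div_rpow ha0.le hb0.le, hX, div_mul_eq_mul_div, div_mul_eq_mul_div,
        div_eq_iff (by positivity)]
      have e1 : (((2 : ℕ) : ℝ) * (1 - β)) = 2 - 2 * β := by push_cast; ring
      rw [e1]
      have e2 : b ^ (1 - β) * b ^ β = b ^ (2 * β - 1) * b ^ (2 - 2 * β) := by
        rw [← Real.rpow_add hb0, ← Real.rpow_add hb0]; congr 1; ring
      calc a ^ (2 - 2 * β) * b ^ (1 - β) * (2 ^ β * b ^ β)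
          = 2 ^ β * a ^ (2 - 2 * β) * (b ^ (1 - β) * b ^ β) := by ring
        _ = _ := by rw [e2]; ring
    rw [e]
    have : (2 : ℝ) ^ β ≤ 2 ^ (1 : ℝ) := Real.rpow_le_rpow_of_exponent_le (by norm_num) hβ2.le
    rw [Real.rpow_one] at this
    gcongr
  have ck : ∀ k, (3 * μ k * a) ^ (1 - β) * (2 * (a / μ k)) ^ β ≤ 6 * X * q ^ k := by
    intro k
    have e : (3 * μ k * a) ^ (1 - β) * (2 * (a / μ k)) ^ β = 3 ^ (1 - β) * 2 ^ β * (X * q ^ k) := by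
      rw [Real.mul_rpow (x := 3 * μ k) (y := a) (by have := hμ0 k; positivity) ha0.le,
        Real.mul_rpow (x := 3) (y := μ k) (by norm_num) (hμ0 k).le,
        Real.mul_rpow (x := 2) (y := a / μ k) (by norm_num) (div_pos ha0 (hμ0 k)).le,
        Real.div_rpow (x := a) (y := μ k) ha0.le (hμ0 k).le]
      have e1 : μ k ^ (1 - β) / μ k ^ β = (a / b) ^ (1 - 2 * β) * q ^ k := by
        rw [← Real.rpow_sub (hμ0 k)]
        simp only [hμ]
        rw [Real.mul_rpow (by positivity) (by positivity), hq, ← Real.rpow_natCast 2 k,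
          ← Real.rpow_natCast _ k, ← Real.rpow_mul (by norm_num), ← Real.rpow_mul (by norm_num)]
        congr 2 <;> ring
      have e2 : (a / b) ^ (1 - 2 * β) * (a ^ (1 - β) * a ^ β) = X := by
        rw [← Real.rpow_add ha0, Real.div_rpow ha0.le hb0.le, hX, div_mul_eq_mul_div,
          ← Real.rpow_add ha0, div_eq_iff (by positivity), mul_assoc, ← Real.rpow_add hb0]
        have : 2 * β - 1 + (1 - 2 * β) = 0 := by ring
        rw [this, Real.rpow_zero, mul_one]; congr 1; ring
      calc 3 ^ (1 - β) * μ k ^ (1 - β) * a ^ (1 - β) * (2 ^ β * (a ^ β / μ k ^ β))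
          = 3 ^ (1 - β) * 2 ^ β * ((μ k ^ (1 - β) / μ k ^ β) * (a ^ (1 - β) * a ^ β)) := by ring
        _ = 3 ^ (1 - β) * 2 ^ β *
            (((a / b) ^ (1 - 2 * β) * (a ^ (1 - β) * a ^ β)) * q ^ k) := by rw [e1]; ring
        _ = _ := by rw [e2]
    rw [e]
    have h3 : (3 : ℝ) ^ (1 - β) ≤ 3 ^ (1 : ℝ) :=
      Real.rpow_le_rpow_of_exponent_le (by norm_num) (by linarith)
    have h2 : (2 : ℝ) ^ β ≤ 2 ^ (1 : ℝ) := Real.rpow_le_rpow_of_exponent_le (by norm_num) hβ2.le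
    rw [Real.rpow_one] at h2 h3
    have : (3 : ℝ) ^ (1 - β) * 2 ^ β ≤ 3 * 2 := by gcongr
    calc _ ≤ 3 * 2 * (X * q ^ k) := by gcongr
      _ = _ := by ring
  have hN : ∀ N, interpNorm ι β v ≤ (2 + 6 * (1 - q)⁻¹) * X +
      ((‖ι‖ + 1) * a) ^ (1 - β) * (a / μ N) ^ β := by
    intro N
    have h := ((hsum N).add (hJN N)).interpNorm_le
    rw [sub_add_cancel] at h
    have hs : ∑ k ∈ Finset.range N, (3 * μ k * a) ^ (1 - β) * (2 * (a / μ k)) ^ β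
        ≤ 6 * X * (1 - q)⁻¹ := by
      calc _ ≤ ∑ k ∈ Finset.range N, 6 * X * q ^ k := Finset.sum_le_sum fun k _ => ck k
        _ = 6 * X * ∑ k ∈ Finset.range N, q ^ k := by rw [Finset.mul_sum]
        _ ≤ 6 * X * (1 - q)⁻¹ := by
          gcongr
          rw [← tsum_geometric_of_lt_one hq0.le hq1]
          exact (summable_geometric_of_lt_one hq0.le hq1).sum_le_tsum _ fun k _ => by positivity
    linarith
  have hlim : Filter.Tendsto (fun N => (2 + 6 * (1 - q)⁻¹) * X +
      ((‖ι‖ + 1) * a) ^ (1 - β) * (a / μ N) ^ β) Filter.atTop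
      (nhds ((2 + 6 * (1 - q)⁻¹) * X + ((‖ι‖ + 1) * a) ^ (1 - β) * 0 ^ β)) := by
    have h1 : Filter.Tendsto (fun N => a / μ N) Filter.atTop (nhds 0) := by
      have : (fun N => a / μ N) = fun N : ℕ => b * (1 / 2 : ℝ) ^ N := by
        ext N; simp only [hμ, one_div, inv_pow]; field_simp
      rw [this]
      simpa using (tendsto_pow_atTop_nhds_zero_of_lt_one (by norm_num : (0 : ℝ) ≤ 1 / 2)
        (by norm_num)).const_mul b
    exact ((h1.rpow_const (Or.inr (by linarith))).const_mul _).const_add _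
  rw [Real.zero_rpow (by linarith), mul_zero, add_zero] at hlim
  exact ge_of_tendsto' hlim hN

end Interp

section Interp

variable {V H : Type*} [NormedAddCommGroup V] [InnerProductSpace ℝ V] [CompleteSpace V]
  [NormedAddCommGroup H] [InnerProductSpace ℝ H]

/-- Young's inequality with a small constant in front of one factor. -/
theorem exists_mul_rpow_le {s η : ℝ} (hs : s ∈ Ioo (0 : ℝ) 1) (hη : 0 < η) {C : ℝ} (hC : 0 < C) :
    ∃ K : ℝ, 0 ≤ K ∧ ∀ x d : ℝ, 0 ≤ x → 0 ≤ d → C * (x ^ (1 - s) * d ^ s) ≤ η * d + K * x := by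
  have hs1 : 0 < 1 - s := sub_pos.mpr hs.2
  set K := (C * η ^ (-s)) ^ (1 / (1 - s)) with hK
  have hK0 : 0 < K := by positivity
  refine ⟨K, hK0.le, fun x d hx hd => ?_⟩
  have h1 := Real.geom_mean_le_arith_mean2_weighted hs1.le hs.1.le (mul_nonneg hK0.le hx)
    (mul_nonneg hη.le hd) (by ring)
  rw [Real.mul_rpow hK0.le hx, Real.mul_rpow hη.le hd] at h1
  have h2 : K ^ (1 - s) = C * η ^ (-s) := by
    rw [hK, ← Real.rpow_mul (by positivity), one_div_mul_cancel hs1.ne', Real.rpow_one]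
  have h3 : η ^ (-s) * η ^ s = 1 := by rw [← Real.rpow_add hη]; simp
  have h4 : C * (x ^ (1 - s) * d ^ s) = K ^ (1 - s) * x ^ (1 - s) * (η ^ s * d ^ s) := by
    rw [h2]
    calc C * (x ^ (1 - s) * d ^ s) = C * (x ^ (1 - s) * d ^ s) * (η ^ (-s) * η ^ s) := by
          rw [h3, mul_one]
      _ = _ := by ring
  rw [h4]
  refine h1.trans ?_
  have h5 : 0 ≤ K * x := by positivity
  have h6 : 0 ≤ η * d := by positivity
  nlinarith [hs.1, hs.2]

/-- The estimate for a single exponent. The interpolation inequality bounds the left-hand side by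
`‖u‖_V ^ ((2β - 1) ρ) ‖u - v‖_H ^ (2 - 2β) ‖u - v‖_V ^ (2β - 1)`; as `(2β - 1) ρ ≤ 2 - 2β` is the
(sub)criticality condition, Young's inequality with the exponents `1 / (2 - 2β)` and
`1 / (2β - 1)` leaves `‖u‖_V` with an exponent at most one. -/
theorem exists_interp_lipschitz_le {ι : V →L[ℝ] H} (hι : Function.Injective ι) {ρ β : ℝ}
    (hρ : 0 ≤ ρ) (hβ : β ∈ Ioo (1 / 2 : ℝ) 1) (hcrit : 2 * β ≤ 1 + 1 / (1 + ρ)) {n : ℝ}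
    (hn : 0 ≤ n) {η : ℝ} (hη : 0 < η) :
    ∃ K : ℝ, 0 ≤ K ∧ ∀ u v : V, ‖ι u‖ ≤ n → ‖ι v‖ ≤ n →
      (1 + interpNorm ι β u ^ ρ + interpNorm ι β v ^ ρ) * interpNorm ι β (u - v) ≤
        η * ‖u - v‖ + K * (‖ι (u - v)‖ * (1 + ‖u‖ + ‖v‖)) := by
  obtain ⟨c, hc, hint⟩ := exists_interpNorm_le hι hβ
  set s := 2 * β - 1 with hs
  have hs01 : s ∈ Ioo (0 : ℝ) 1 := ⟨by linarith [hβ.1], by linarith [hβ.2]⟩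
  have hexp : 2 - 2 * β = 1 - s := by ring
  rw [hexp] at hint
  have hsρ : s * ρ ≤ 1 - s := by
    have h1 : s ≤ 1 / (1 + ρ) := by linarith
    rw [le_div_iff₀ (by linarith)] at h1
    linarith
  set c' := c * n ^ (1 - s) with hc'
  have hc'0 : 0 ≤ c' := by positivity
  obtain ⟨K, hK, hY⟩ := exists_mul_rpow_le hs01 hη
    (show 0 < (1 + 2 * c' ^ ρ) * c by have := Real.rpow_nonneg hc'0 ρ; positivity)
  refine ⟨K, hK, fun u v hu hv => ?_⟩
  set p := 1 + ‖u‖ + ‖v‖ with hp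
  have hp1 : 1 ≤ p := by have := norm_nonneg u; have := norm_nonneg v; linarith
  have hp0 : 0 < p := by linarith
  have hb : ∀ z : V, ‖ι z‖ ≤ n → ‖z‖ ≤ p → interpNorm ι β z ^ ρ ≤ c' ^ ρ * p ^ (1 - s) := by
    intro z hz hzp
    have h1 : interpNorm ι β z ≤ c' * p ^ s := by
      refine (hint z).trans ?_
      rw [hc', mul_assoc]
      have := hs01.1
      have := hs01.2
      gcongr
    calc interpNorm ι β z ^ ρ ≤ (c' * p ^ s) ^ ρ := by
          gcongr; exact interpNorm_nonneg ι β z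
      _ = c' ^ ρ * p ^ (s * ρ) := by
          rw [Real.mul_rpow hc'0 (by positivity), ← Real.rpow_mul hp0.le]
      _ ≤ c' ^ ρ * p ^ (1 - s) := by gcongr
  have h1 := hb u hu (by have := norm_nonneg v; linarith)
  have h2 := hb v hv (by have := norm_nonneg u; linarith)
  have h3 : 1 ≤ p ^ (1 - s) := Real.one_le_rpow hp1 (by linarith [hs01.2])
  have h4 : 1 + interpNorm ι β u ^ ρ + interpNorm ι β v ^ ρ ≤ (1 + 2 * c' ^ ρ) * p ^ (1 - s) := by
    linarith
  calc (1 + interpNorm ι β u ^ ρ + interpNorm ι β v ^ ρ) * interpNorm ι β (u - v)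
      ≤ ((1 + 2 * c' ^ ρ) * p ^ (1 - s)) * (c * (‖ι (u - v)‖ ^ (1 - s) * ‖u - v‖ ^ s)) := by
        refine mul_le_mul h4 (hint _) (interpNorm_nonneg ι β _) ?_
        have := Real.rpow_nonneg hc'0 ρ
        positivity
    _ = (1 + 2 * c' ^ ρ) * c * ((‖ι (u - v)‖ * p) ^ (1 - s) * ‖u - v‖ ^ s) := by
        rw [Real.mul_rpow (norm_nonneg _) hp0.le]; ring
    _ ≤ _ := hY _ _ (by positivity) (norm_nonneg _)

/-- The (sub)critical Lipschitz bound is dominated by `η ‖u - v‖_V` with `η` arbitrarily small, plus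
a multiple of `‖u - v‖_H (1 + ‖u‖_V + ‖v‖_V)`. -/
theorem exists_sum_interp_lipschitz_le {ι : V →L[ℝ] H} (hι : Function.Injective ι)
    {s : Finset ℕ} {ρ β : ℕ → ℝ}
    (h : ∀ j ∈ s, 0 ≤ ρ j ∧ β j ∈ Ioo (1 / 2 : ℝ) 1 ∧ 2 * β j ≤ 1 + 1 / (1 + ρ j)) {n : ℝ}
    (hn : 0 ≤ n) (C : ℝ) {η : ℝ} (hη : 0 < η) :
    ∃ K : ℝ, 0 ≤ K ∧ ∀ u v : V, ‖ι u‖ ≤ n → ‖ι v‖ ≤ n →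
      C * ∑ j ∈ s, (1 + interpNorm ι (β j) u ^ ρ j + interpNorm ι (β j) v ^ ρ j) *
          interpNorm ι (β j) (u - v) ≤
        η * ‖u - v‖ + K * (‖ι (u - v)‖ * (1 + ‖u‖ + ‖v‖)) := by
  have key : ∀ η : ℝ, 0 < η → ∃ K : ℝ, 0 ≤ K ∧ ∀ u v : V, ‖ι u‖ ≤ n → ‖ι v‖ ≤ n →
      ∑ j ∈ s, (1 + interpNorm ι (β j) u ^ ρ j + interpNorm ι (β j) v ^ ρ j) *
          interpNorm ι (β j) (u - v) ≤
        η * ‖u - v‖ + K * (‖ι (u - v)‖ * (1 + ‖u‖ + ‖v‖)) := by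
    induction s using Finset.induction_on with
    | empty =>
      intro η hη
      refine ⟨0, le_rfl, fun u v _ _ => ?_⟩
      simp only [Finset.sum_empty]
      positivity
    | insert j s hj ih =>
      intro η hη
      obtain ⟨K₁, hK₁, h₁⟩ := ih (fun i hi => h i (Finset.mem_insert_of_mem hi)) (η / 2)
        (half_pos hη)
      obtain ⟨hρ, hβ, hc⟩ := h j (Finset.mem_insert_self j s)
      obtain ⟨K₂, hK₂, h₂⟩ := exists_interp_lipschitz_le hι hρ hβ hc hn (half_pos hη)
      refine ⟨K₁ + K₂, add_nonneg hK₁ hK₂, fun u v hu hv => ?_⟩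
      rw [Finset.sum_insert hj]
      have := h₁ u v hu hv
      have := h₂ u v hu hv
      linarith
  obtain ⟨K, hK, hK'⟩ := key (η / (|C| + 1)) (by positivity)
  refine ⟨|C| * K, by positivity, fun u v hu hv => ?_⟩
  have h1 := hK' u v hu hv
  set S := ∑ j ∈ s, (1 + interpNorm ι (β j) u ^ ρ j + interpNorm ι (β j) v ^ ρ j) *
          interpNorm ι (β j) (u - v)
  have hS : 0 ≤ S := Finset.sum_nonneg fun j _ => by
    have := interpNorm_nonneg ι (β j) u
    have := interpNorm_nonneg ι (β j) v
    have := interpNorm_nonneg ι (β j) (u - v)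
    positivity
  calc C * S ≤ |C| * S := mul_le_mul_of_nonneg_right (le_abs_self C) hS
    _ ≤ |C| * (η / (|C| + 1) * ‖u - v‖ + K * (‖ι (u - v)‖ * (1 + ‖u‖ + ‖v‖))) := by gcongr
    _ = |C| / (|C| + 1) * (η * ‖u - v‖) + |C| * K * (‖ι (u - v)‖ * (1 + ‖u‖ + ‖v‖)) := by
        field_simp
    _ ≤ 1 * (η * ‖u - v‖) + |C| * K * (‖ι (u - v)‖ * (1 + ‖u‖ + ‖v‖)) := by
        gcongr
        rw [div_le_one (by positivity)]
        linarith
    _ = _ := by ring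

end Interp

/-! ### Hilbert–Schmidt operators applied to vectors -/

namespace HilbertSchmidt

variable {U H : Type*} [NormedAddCommGroup U] [InnerProductSpace ℝ U] [CompleteSpace U]
  [NormedAddCommGroup H] [InnerProductSpace ℝ H]

/-- The operator norm is bounded by the Hilbert–Schmidt norm. -/
theorem norm_toCLM_apply_le (T : HilbertSchmidt U H) (x : U) : ‖toCLM T x‖ ≤ ‖T‖ * ‖x‖ := by
  have hT : Summable fun i : hsIndex U => ‖toCLM T (hsBasis U i)‖ ^ 2 := by
    have := (memℓp T).summable (by norm_num)
    simpa using this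
  have hx := (hsBasis U).hasSum_repr x
  have hx2 : Summable fun i : hsIndex U => ‖(hsBasis U).repr x i‖ ^ 2 := by
    have := (lp.memℓp ((hsBasis U).repr x)).summable (by norm_num)
    simpa using this
  have hxn : ∑' i, ‖(hsBasis U).repr x i‖ ^ 2 = ‖x‖ ^ 2 := by
    have h := lp.norm_rpow_eq_tsum (p := 2) (by norm_num) ((hsBasis U).repr x)
    simp only [ENNReal.toReal_ofNat, Real.rpow_ofNat, LinearIsometryEquiv.norm_map] at h
    exact h.symm
  have hsum : HasSum (fun i => (hsBasis U).repr x i • toCLM T (hsBasis U i)) (toCLM T x) := by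
    simpa using hx.mapL (toCLM T)
  have hfin : ∀ s : Finset (hsIndex U),
      ‖∑ i ∈ s, (hsBasis U).repr x i • toCLM T (hsBasis U i)‖ ≤ ‖T‖ * ‖x‖ := by
    intro s
    calc ‖∑ i ∈ s, (hsBasis U).repr x i • toCLM T (hsBasis U i)‖
        ≤ ∑ i ∈ s, ‖toCLM T (hsBasis U i)‖ * ‖(hsBasis U).repr x i‖ := by
          refine (norm_sum_le _ _).trans (le_of_eq (Finset.sum_congr rfl fun i _ => ?_))
          rw [norm_smul, mul_comm]
      _ ≤ √(∑ i ∈ s, ‖toCLM T (hsBasis U i)‖ ^ 2) * √(∑ i ∈ s, ‖(hsBasis U).repr x i‖ ^ 2) :=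
          Real.sum_mul_le_sqrt_mul_sqrt s _ _
      _ ≤ √(‖T‖ ^ 2) * √(‖x‖ ^ 2) := by
          rw [norm_sq_eq, ← hxn]
          gcongr
          · exact hT.sum_le_tsum s fun i _ => by positivity
          · exact hx2.sum_le_tsum s fun i _ => by positivity
      _ = ‖T‖ * ‖x‖ := by rw [Real.sqrt_sq (norm_nonneg _), Real.sqrt_sq (norm_nonneg _)]
  exact le_of_tendsto' hsum.norm hfin

/-- The evaluation `(T, x) ↦ T x` as a bounded bilinear map. -/
noncomputable def evalCLM (U H : Type*) [NormedAddCommGroup U] [InnerProductSpace ℝ U]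
    [CompleteSpace U] [NormedAddCommGroup H] [InnerProductSpace ℝ H] :
    HilbertSchmidt U H →L[ℝ] U →L[ℝ] H :=
  LinearMap.mkContinuous toCLM 1 fun T => by
    refine ContinuousLinearMap.opNorm_le_bound _ (by positivity) fun x => ?_
    rw [one_mul]
    exact norm_toCLM_apply_le T x

end HilbertSchmidt

/-! ### Evolution equations in a Gelfand triple and the energy identity -/

section Evolution

open Filter Topology

/-- Equibounded operators that converge on a dense set converge everywhere. -/
theorem tendsto_apply_of_denseRange {α β E F : Type*} [NormedAddCommGroup E] [NormedSpace ℝ E]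
    [NormedAddCommGroup F] [NormedSpace ℝ F] {l : Filter α} {T : α → E →L[ℝ] F} {T₀ : E →L[ℝ] F}
    {C : ℝ} (hC : ∀ᶠ i in l, ∀ x, ‖T i x‖ ≤ C * ‖x‖) {f : β → E} (hf : DenseRange f)
    (h : ∀ b, Tendsto (fun i => T i (f b)) l (𝓝 (T₀ (f b)))) (x : E) :
    Tendsto (fun i => T i x) l (𝓝 (T₀ x)) := by
  rw [Metric.tendsto_nhds]
  intro ε hε
  set D := |C| + ‖T₀‖ + 1 with hD
  have hD0 : 0 < D := by positivity
  obtain ⟨b, hb⟩ := hf.exists_dist_lt x (show 0 < ε / (2 * D) by positivity)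
  rw [dist_eq_norm] at hb
  filter_upwards [hC, (Metric.tendsto_nhds.mp (h b)) (ε / 2) (half_pos hε)] with i h1 h2
  have e : T i x - T₀ x = T i (x - f b) + (T i (f b) - T₀ (f b)) - T₀ (x - f b) := by
    simp only [map_sub]; abel
  rw [dist_eq_norm] at h2 ⊢
  rw [e]
  have h3 : ‖T i (x - f b)‖ ≤ |C| * ‖x - f b‖ :=
    (h1 _).trans (mul_le_mul_of_nonneg_right (le_abs_self C) (norm_nonneg _))
  have h4 := T₀.le_opNorm (x - f b)
  have h5 : D * ‖x - f b‖ ≤ ε / 2 := by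
    calc D * ‖x - f b‖ ≤ D * (ε / (2 * D)) := by gcongr
      _ = ε / 2 := by field_simp
  have h6 := norm_sub_le (T i (x - f b) + (T i (f b) - T₀ (f b))) (T₀ (x - f b))
  have h7 := norm_add_le (T i (x - f b)) (T i (f b) - T₀ (f b))
  have h8 : D * ‖x - f b‖ = |C| * ‖x - f b‖ + ‖T₀‖ * ‖x - f b‖ + ‖x - f b‖ := by rw [hD]; ring
  have := norm_nonneg (x - f b)
  linarith

theorem intervalIntegrable_of_mem {E : Type*} [NormedAddCommGroup E] {k : ℝ → E} {a b t : ℝ}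
    (hk : Integrable k (volume.restrict (Icc a b))) (ht : t ∈ Icc a b) :
    IntervalIntegrable k volume a t :=
  (intervalIntegrable_iff_integrableOn_Icc_of_le ht.1).2
    (IntegrableOn.mono_set hk (Icc_subset_Icc_right ht.2))

theorem ae_restrict_Ioc_of_ae {p : ℝ → Prop} {a b t : ℝ} (ht : t ∈ Icc a b)
    (h : ∀ᵐ s ∂volume.restrict (Icc a b), p s) : ∀ᵐ s ∂volume.restrict (Ioc a t), p s :=
  ae_restrict_of_ae_restrict_of_subset
    (Ioc_subset_Icc_self.trans (Icc_subset_Icc_right ht.2)) h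

theorem intervalIntegral_mono_ae {f g : ℝ → ℝ} {a b t : ℝ} (ht : t ∈ Icc a b)
    (hf : Integrable f (volume.restrict (Icc a b))) (hg : Integrable g (volume.restrict (Icc a b)))
    (h : ∀ᵐ s ∂volume.restrict (Icc a b), f s ≤ g s) :
    ∫ s in a..t, f s ≤ ∫ s in a..t, g s := by
  rw [intervalIntegral.integral_of_le ht.1, intervalIntegral.integral_of_le ht.1]
  have hsub : Ioc a t ⊆ Icc a b := Ioc_subset_Icc_self.trans (Icc_subset_Icc_right ht.2)
  exact integral_mono_ae (IntegrableOn.mono_set hf hsub) (IntegrableOn.mono_set hg hsub)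
    (ae_restrict_Ioc_of_ae ht h)

theorem intervalIntegral_congr_ae_of_mem {E : Type*} [NormedAddCommGroup E] [NormedSpace ℝ E]
    {f g : ℝ → E} {a b t : ℝ} (ht : t ∈ Icc a b)
    (h : ∀ᵐ s ∂volume.restrict (Icc a b), f s = g s) :
    ∫ s in a..t, f s = ∫ s in a..t, g s := by
  rw [intervalIntegral.integral_of_le ht.1, intervalIntegral.integral_of_le ht.1]
  exact integral_congr_ae (ae_restrict_Ioc_of_ae ht h)

theorem intervalIntegral_le_of_nonneg {g : ℝ → ℝ} {a b t : ℝ} (ht : t ∈ Icc a b)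
    (hg : Integrable g (volume.restrict (Icc a b))) (h0 : ∀ s, 0 ≤ g s) :
    ∫ s in a..t, g s ≤ ∫ s in Icc a b, g s := by
  rw [intervalIntegral.integral_of_le ht.1]
  exact setIntegral_mono_set hg (Eventually.of_forall h0)
    (Ioc_subset_Icc_self.trans (Icc_subset_Icc_right ht.2)).eventuallyLE

theorem continuousOn_primitive_Icc {E : Type*} [NormedAddCommGroup E] [NormedSpace ℝ E]
    {f : ℝ → E} {a b : ℝ} (hf : Integrable f (volume.restrict (Icc a b))) :
    ContinuousOn (fun t => ∫ s in a..t, f s) (Icc a b) := by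
  rcases le_or_gt a b with hab | hab
  · rw [← uIcc_of_le hab] at hf ⊢
    exact intervalIntegral.continuousOn_primitive_interval hf
  · rw [Icc_eq_empty (not_le.mpr hab)]
    exact continuousOn_empty _

variable {V H : Type*} [NormedAddCommGroup V] [InnerProductSpace ℝ V] [CompleteSpace V]
  [NormedAddCommGroup H] [InnerProductSpace ℝ H] [CompleteSpace H]

/-- A functional `y` on `V` with `|⟨y, v⟩| ≤ R ‖v‖_H` comes from an element of `H`. -/
theorem exists_pivotCLM_eq {ι : V →L[ℝ] H} (hι : Function.Injective ι) {y : StrongDual ℝ V}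
    {R : ℝ} (hR : 0 ≤ R) (h : ∀ v, |y v| ≤ R * ‖ι v‖) : ∃ w : H, pivotCLM ι w = y ∧ ‖w‖ ≤ R := by
  let e := LinearEquiv.ofInjective (ι : V →ₗ[ℝ] H) hι
  let f₀ : LinearMap.range (ι : V →ₗ[ℝ] H) →ₗ[ℝ] ℝ := (y : V →ₗ[ℝ] ℝ) ∘ₗ e.symm.toLinearMap
  have hf₀ : ∀ v, f₀ (e v) = y v := fun v => by simp [f₀]
  have hb : ∀ z, ‖f₀ z‖ ≤ R * ‖z‖ := by
    intro z
    obtain ⟨v, rfl⟩ := e.surjective z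
    rw [hf₀]
    exact h v
  let f : StrongDual ℝ (LinearMap.range (ι : V →ₗ[ℝ] H)) := f₀.mkContinuous R hb
  obtain ⟨g, hg, hgn⟩ := exists_extension_norm_eq _ f
  refine ⟨(InnerProductSpace.toDual ℝ H).symm g, ?_, ?_⟩
  · ext v
    rw [pivotCLM_apply, InnerProductSpace.toDual_symm_apply]
    have := hg (e v)
    exact this.trans (hf₀ v)
  · rw [LinearIsometryEquiv.norm_map, hgn]
    exact f₀.mkContinuous_norm_le hR hb

theorem tendsto_smoothing_pivot {ι : V →L[ℝ] H} (hd : DenseRange ι) {ε : ℕ → ℝ}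
    (hε : ∀ n, 0 < ε n) (hlim : Tendsto ε atTop (𝓝 0)) (h : H) :
    Tendsto (fun n => ι (smoothing ι (hε n) (pivotCLM ι h))) atTop (𝓝 h) := by
  refine tendsto_apply_of_denseRange
    (T := fun n => ι.comp ((smoothing ι (hε n)).comp (pivotCLM ι)))
    (T₀ := ContinuousLinearMap.id ℝ H) (C := 1) (Eventually.of_forall fun n x => ?_) hd ?_ h
  · rw [one_mul]
    exact (norm_smoothing_pivot_le ι (hε n) x).1
  · intro v
    rw [tendsto_iff_norm_sub_tendsto_zero]
    have hb : ∀ n, ‖ι (smoothing ι (hε n) (pivotCLM ι (ι v))) - ι v‖ ^ 2 ≤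
        ε n * (2 * ‖v‖ ^ 2) := by
      intro n
      have h1 := pivot_sub_smoothing ι (hε n) (ι v) (v - smoothing ι (hε n) (pivotCLM ι (ι v)))
      have h2 := norm_smoothing_le ι (hε n) v
      set z := smoothing ι (hε n) (pivotCLM ι (ι v))
      rw [map_sub, real_inner_self_eq_norm_sq] at h1
      rw [norm_sub_rev, h1]
      have h3 := real_inner_le_norm z (v - z)
      have h4 := norm_sub_le v z
      have : ‖z‖ * ‖v - z‖ ≤ ‖v‖ * (2 * ‖v‖) := by gcongr; linarith
      have := hε n
      gcongr
      nlinarith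
    have h2 : Tendsto (fun n => √(ε n * (2 * ‖v‖ ^ 2))) atTop (𝓝 0) := by
      have := (hlim.mul_const (2 * ‖v‖ ^ 2)).sqrt
      simpa using this
    refine squeeze_zero (fun n => norm_nonneg _) (fun n => ?_) h2
    exact Real.le_sqrt_of_sq_le (hb n)

/-- `V` is dense in `V*`: a functional on `V* ≅ V` that vanishes on the range vanishes, since the
embedding is symmetric and injective. -/
theorem denseRange_pivot_comp {ι : V →L[ℝ] H} (hι : Function.Injective ι) :
    DenseRange fun v => pivotCLM ι (ι v) := by
  let K : V →L[ℝ] V :=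
    (InnerProductSpace.toDual ℝ V).symm.toContinuousLinearEquiv.toContinuousLinearMap.comp
      ((pivotCLM ι).comp ι)
  have hK : DenseRange K := by
    have : (LinearMap.range (K : V →ₗ[ℝ] V)).topologicalClosure = ⊤ := by
      rw [Submodule.topologicalClosure_eq_top_iff, Submodule.eq_bot_iff]
      intro x hx
      rw [Submodule.mem_orthogonal] at hx
      have h1 := hx (K x) (LinearMap.mem_range_self _ _)
      have h2 : inner ℝ (K x) x = inner ℝ (ι x) (ι x) := InnerProductSpace.toDual_symm_apply
      rw [h2, inner_self_eq_zero] at h1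
      exact (map_eq_zero_iff ι hι).mp h1
    have h3 := Submodule.dense_iff_topologicalClosure_eq_top.mpr this
    exact h3
  have h1 := (InnerProductSpace.toDual ℝ V).surjective.denseRange.comp hK
    (InnerProductSpace.toDual ℝ V).continuous
  convert h1 using 1
  ext v : 1
  simp [K]

theorem tendsto_apply_smoothing {ι : V →L[ℝ] H} (hι : Function.Injective ι) (hd : DenseRange ι)
    {ε : ℕ → ℝ} (hε : ∀ n, 0 < ε n) (hlim : Tendsto ε atTop (𝓝 0)) (v : V) (φ : StrongDual ℝ V) :
    Tendsto (fun n => φ (smoothing ι (hε n) (pivotCLM ι (ι v)))) atTop (𝓝 (φ v)) := by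
  refine tendsto_apply_of_denseRange
    (T := fun n => ContinuousLinearMap.apply ℝ ℝ (smoothing ι (hε n) (pivotCLM ι (ι v))))
    (T₀ := ContinuousLinearMap.apply ℝ ℝ v) (C := ‖v‖) (Eventually.of_forall fun n x => ?_)
    (denseRange_pivot_comp hι) ?_ φ
  · rw [ContinuousLinearMap.apply_apply, mul_comm]
    exact (x.le_opNorm _).trans (by gcongr; exact norm_smoothing_le ι (hε n) v)
  · intro w
    simp only [ContinuousLinearMap.apply_apply, pivotCLM_apply]
    exact (tendsto_const_nhds.inner (tendsto_smoothing_pivot hd hε hlim (ι v)))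

end Evolution

section Evolution

open Filter Topology

variable {V H : Type*} [NormedAddCommGroup V] [InnerProductSpace ℝ V] [CompleteSpace V]
  [NormedAddCommGroup H] [InnerProductSpace ℝ H] [CompleteSpace H]

/-- `w ∈ C([a,b];H)`, with the representative `u ∈ L²(a,b;V)`, solves `w' = k₁ + k₂` in `V*` on
`[a,b]` with `w(a) = x`, where `k₁ ∈ L²(a,b;V*)` and `k₂ ∈ L¹(a,b;H)`. -/
structure IsEvol (ι : V →L[ℝ] H) (a b : ℝ) (x : H) (k₁ : ℝ → StrongDual ℝ V) (k₂ : ℝ → H)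
    (w : ℝ → H) (u : ℝ → V) : Prop where
  cont : ContinuousOn w (Icc a b)
  memV : MemLp u 2 (volume.restrict (Icc a b))
  mem1 : MemLp k₁ 2 (volume.restrict (Icc a b))
  int2 : Integrable k₂ (volume.restrict (Icc a b))
  ae_eq : ∀ᵐ t ∂volume.restrict (Icc a b), ι (u t) = w t
  eq : ∀ t ∈ Icc a b,
    pivotCLM ι (w t) = pivotCLM ι x + ∫ s in a..t, (k₁ s + pivotCLM ι (k₂ s))

theorem integrable_forcing (ι : V →L[ℝ] H) {a b : ℝ} {k₁ : ℝ → StrongDual ℝ V} {k₂ : ℝ → H}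
    (h₁ : MemLp k₁ 2 (volume.restrict (Icc a b))) (h₂ : Integrable k₂ (volume.restrict (Icc a b))) :
    Integrable (fun s => k₁ s + pivotCLM ι (k₂ s)) (volume.restrict (Icc a b)) :=
  (h₁.integrable (by norm_num)).add ((pivotCLM ι).integrable_comp h₂)

theorem integrable_norm_mul {E F : Type*} [NormedAddCommGroup E] [NormedAddCommGroup F]
    {μ : Measure ℝ} {f : ℝ → E} {g : ℝ → F} (hf : MemLp f 2 μ) (hg : MemLp g 2 μ) :
    Integrable (fun s => ‖f s‖ * ‖g s‖) μ :=
  hf.norm.integrable_mul hg.norm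

/-- The regularized energy `⟨y, S_ε y⟩` of a primitive `y` in `V*`. -/
theorem smoothed_energy_eq (ι : V →L[ℝ] H) {ε : ℝ} (hε : 0 < ε) {a t : ℝ}
    {h : ℝ → StrongDual ℝ V} (hh : IntervalIntegrable h volume a t) (y₀ : StrongDual ℝ V) :
    (y₀ + ∫ s in a..t, h s) (smoothing ι hε (y₀ + ∫ s in a..t, h s)) =
      y₀ (smoothing ι hε y₀) + 2 * ∫ s in a..t, h s (smoothing ι hε (y₀ + ∫ r in a..s, h r)) := by
  let L : StrongDual ℝ V →L[ℝ] StrongDual ℝ V →L[ℝ] ℝ :=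
    (ContinuousLinearMap.compL ℝ (StrongDual ℝ V) V ℝ).flip (smoothing ι hε)
  have hL : ∀ y y', L y y' = y (smoothing ι hε y') := fun _ _ => rfl
  have := bilin_primitive_eq L hh hh y₀ y₀
  simp only [hL] at this
  rw [this, ← intervalIntegral.integral_const_mul]
  congr 1
  refine intervalIntegral.integral_congr fun s _ => ?_
  rw [smoothing_symm ι hε (h s)]
  ring

theorem memLp_two_norm_sq_integrable {E : Type*} [NormedAddCommGroup E] {μ : Measure ℝ} {f : ℝ → E}
    (hf : MemLp f 2 μ) : Integrable (fun s => ‖f s‖ ^ 2) μ := by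
  simpa [pow_two] using integrable_norm_mul hf hf

/-- Uniform bound for the smoothed energies: the key is that the `L¹(H)` part of the forcing is
tested with `S_ε y`, whose `H`-norm is controlled by the energy itself. -/
theorem exists_smoothed_energy_le {ι : V →L[ℝ] H} {a b : ℝ} (hab : a ≤ b) {x : H}
    {k₁ : ℝ → StrongDual ℝ V} {k₂ : ℝ → H} {u : ℝ → V}
    (hu : MemLp u 2 (volume.restrict (Icc a b))) (h₁ : MemLp k₁ 2 (volume.restrict (Icc a b)))
    (h₂ : Integrable k₂ (volume.restrict (Icc a b)))
    (hae : ∀ᵐ t ∂volume.restrict (Icc a b), pivotCLM ι (ι (u t)) =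
      pivotCLM ι x + ∫ s in a..t, (k₁ s + pivotCLM ι (k₂ s))) :
    ∃ R : ℝ, 0 ≤ R ∧ ∀ (ε : ℝ) (hε : 0 < ε), ∀ t ∈ Icc a b,
      (pivotCLM ι x + ∫ s in a..t, (k₁ s + pivotCLM ι (k₂ s)))
        (smoothing ι hε (pivotCLM ι x + ∫ s in a..t, (k₁ s + pivotCLM ι (k₂ s)))) ≤ R ^ 2 := by
  set h : ℝ → StrongDual ℝ V := fun s => k₁ s + pivotCLM ι (k₂ s) with hh
  have hint : Integrable h (volume.restrict (Icc a b)) := integrable_forcing ι h₁ h₂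
  set y : ℝ → StrongDual ℝ V := fun t => pivotCLM ι x + ∫ s in a..t, h s with hy
  have hyc : ContinuousOn y (Icc a b) := continuousOn_const.add (continuousOn_primitive_Icc hint)
  set c₁ := ∫ s in Icc a b, ‖k₁ s‖ * ‖u s‖ with hc₁
  set c₂ := ∫ s in Icc a b, ‖k₂ s‖ with hc₂
  have hc₁0 : 0 ≤ c₁ := integral_nonneg fun s => by positivity
  have hc₂0 : 0 ≤ c₂ := integral_nonneg fun s => by positivity
  refine ⟨‖x‖ ^ 2 + 2 * c₁ + 2 * c₂ + 1, by positivity, fun ε hε t ht => ?_⟩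
  set Q : ℝ → ℝ := fun t => y t (smoothing ι hε (y t)) with hQ
  have hQc : ContinuousOn Q (Icc a b) :=
    hyc.clm_apply ((smoothing ι hε).continuous.comp_continuousOn hyc)
  have hQe : ∀ t, Q t = ε * ‖smoothing ι hε (y t)‖ ^ 2 + ‖ι (smoothing ι hε (y t))‖ ^ 2 :=
    fun t => apply_smoothing_self ι hε (y t)
  have hQ0 : ∀ t, 0 ≤ Q t := fun t => by rw [hQe]; positivity
  obtain ⟨τ, hτ, hmax⟩ := isCompact_Icc.exists_isMaxOn (nonempty_Icc.mpr hab) hQc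
  have hmax' : ∀ t ∈ Icc a b, Q t ≤ Q τ := fun t ht => hmax ht
  set R := √(Q τ) with hR
  have hR0 : 0 ≤ R := Real.sqrt_nonneg _
  have hR2 : R ^ 2 = Q τ := Real.sq_sqrt (hQ0 τ)
  have hιle : ∀ t ∈ Icc a b, ‖ι (smoothing ι hε (y t))‖ ≤ R := fun t ht => by
    refine Real.le_sqrt_of_sq_le ?_
    have := hmax' t ht
    have h2 := hQe t
    have : 0 ≤ ε * ‖smoothing ι hε (y t)‖ ^ 2 := by positivity
    linarith
  have hx0 : (pivotCLM ι x) (smoothing ι hε (pivotCLM ι x)) ≤ ‖x‖ ^ 2 := by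
    rw [pivotCLM_apply]
    refine (real_inner_le_norm _ _).trans ?_
    rw [pow_two]
    gcongr
    exact (norm_smoothing_pivot_le ι hε x).1
  have hbound : Q τ ≤ ‖x‖ ^ 2 + 2 * (c₁ + c₂ * R) := by
    have e := smoothed_energy_eq ι hε (intervalIntegrable_of_mem hint hτ) (pivotCLM ι x)
    have hQτ : Q τ = (pivotCLM ι x) (smoothing ι hε (pivotCLM ι x)) +
      2 * ∫ s in a..τ, h s (smoothing ι hε (y s)) := e
    rw [hQτ]
    have hg : Integrable (fun s => ‖k₁ s‖ * ‖u s‖ + ‖k₂ s‖ * R) (volume.restrict (Icc a b)) :=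
      (integrable_norm_mul h₁ hu).add (h₂.norm.mul_const R)
    have hyi : ContinuousOn (fun s => smoothing ι hε (y s)) (Icc a b) :=
      (smoothing ι hε).continuous.comp_continuousOn hyc
    have hle : ∀ᵐ s ∂volume.restrict (Icc a b),
        ‖h s (smoothing ι hε (y s))‖ ≤ ‖k₁ s‖ * ‖u s‖ + ‖k₂ s‖ * R := by
      filter_upwards [hae, ae_restrict_mem measurableSet_Icc] with s hs hs'
      have e1 : h s (smoothing ι hε (y s)) =
          k₁ s (smoothing ι hε (y s)) + inner ℝ (k₂ s) (ι (smoothing ι hε (y s))) := rfl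
      rw [e1]
      refine (norm_add_le _ _).trans (add_le_add ?_ ?_)
      · refine (ContinuousLinearMap.le_opNorm _ _).trans ?_
        gcongr
        have : y s = pivotCLM ι (ι (u s)) := hs.symm
        rw [this]
        exact norm_smoothing_le ι hε (u s)
      · exact (norm_inner_le_norm _ _).trans (by gcongr; exact hιle s hs')
    have hi : Integrable (fun s => h s (smoothing ι hε (y s))) (volume.restrict (Icc a b)) := by
      refine Integrable.mono' hg ?_ hle
      exact (ContinuousLinearMap.apply ℝ ℝ :
        V →L[ℝ] StrongDual ℝ V →L[ℝ] ℝ).aestronglyMeasurable_comp₂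
        (hyi.aestronglyMeasurable measurableSet_Icc) hint.1
    have h3 : ∫ s in a..τ, h s (smoothing ι hε (y s)) ≤
        ∫ s in a..τ, (‖k₁ s‖ * ‖u s‖ + ‖k₂ s‖ * R) :=
      intervalIntegral_mono_ae hτ hi hg (hle.mono fun s hs => (le_abs_self _).trans hs)
    have h4 : ∫ s in a..τ, (‖k₁ s‖ * ‖u s‖ + ‖k₂ s‖ * R) ≤ c₁ + c₂ * R := by
      refine (intervalIntegral_le_of_nonneg hτ hg fun s => by positivity).trans ?_
      rw [integral_add (integrable_norm_mul h₁ hu) (h₂.norm.mul_const R), integral_mul_const]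
    linarith
  have hRle : R ≤ ‖x‖ ^ 2 + 2 * c₁ + 2 * c₂ + 1 := by
    rw [← hR2] at hbound
    by_contra hc
    push Not at hc
    nlinarith [sq_nonneg ‖x‖]
  calc Q t ≤ Q τ := hmax' t ht
    _ = R ^ 2 := hR2.symm
    _ ≤ _ := by gcongr

/-- Regularity and energy identity: if a primitive in `V*` of `k₁ + k₂` has a representative
`u ∈ L²(a,b;V)`, then it is a continuous `H`-valued function `w`, and
`‖w(t)‖² = ‖x‖² + 2 ∫ (⟨k₁, u⟩ + (k₂, w)_H)`. -/
theorem exists_isEvol_energy {ι : V →L[ℝ] H} (hι : Function.Injective ι) (hd : DenseRange ι)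
    {a b : ℝ} (hab : a ≤ b) {x : H} {k₁ : ℝ → StrongDual ℝ V} {k₂ : ℝ → H} {u : ℝ → V}
    (hu : MemLp u 2 (volume.restrict (Icc a b))) (h₁ : MemLp k₁ 2 (volume.restrict (Icc a b)))
    (h₂ : Integrable k₂ (volume.restrict (Icc a b)))
    (hae : ∀ᵐ t ∂volume.restrict (Icc a b), pivotCLM ι (ι (u t)) =
      pivotCLM ι x + ∫ s in a..t, (k₁ s + pivotCLM ι (k₂ s))) :
    ∃ w : ℝ → H, IsEvol ι a b x k₁ k₂ w u ∧ ∀ t ∈ Icc a b,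
      ‖w t‖ ^ 2 = ‖x‖ ^ 2 + 2 * ∫ s in a..t, (k₁ s (u s) + inner ℝ (k₂ s) (w s)) := by
  obtain ⟨R, hR0, hR⟩ := exists_smoothed_energy_le hab hu h₁ h₂ hae
  set h : ℝ → StrongDual ℝ V := fun s => k₁ s + pivotCLM ι (k₂ s) with hh
  have hint : Integrable h (volume.restrict (Icc a b)) := integrable_forcing ι h₁ h₂
  set y : ℝ → StrongDual ℝ V := fun t => pivotCLM ι x + ∫ s in a..t, h s with hy
  have hyc : ContinuousOn y (Icc a b) := continuousOn_const.add (continuousOn_primitive_Icc hint)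
  have hbd : ∀ (ε : ℝ) (hε : 0 < ε), ∀ t ∈ Icc a b,
      √ε * ‖smoothing ι hε (y t)‖ ≤ R ∧ ‖ι (smoothing ι hε (y t))‖ ≤ R := by
    intro ε hε t ht
    have h3 : y t (smoothing ι hε (y t)) ≤ R ^ 2 := hR ε hε t ht
    rw [apply_smoothing_self] at h3
    have h4 : 0 ≤ ε * ‖smoothing ι hε (y t)‖ ^ 2 := by positivity
    refine ⟨?_, ?_⟩
    · refine abs_le_of_sq_le_sq' ?_ hR0 |>.2
      rw [mul_pow, Real.sq_sqrt hε.le]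
      nlinarith [sq_nonneg ‖ι (smoothing ι hε (y t))‖]
    · exact (abs_le_of_sq_le_sq' (by linarith) hR0).2
  set e : ℕ → ℝ := fun n => 1 / ((n : ℝ) + 1) with he
  have he0 : ∀ n, 0 < e n := fun n => Nat.one_div_pos_of_nat
  have helim : Tendsto e atTop (𝓝 0) := tendsto_one_div_add_atTop_nhds_zero_nat
  have hfun : ∀ t ∈ Icc a b, ∃ w : H, pivotCLM ι w = y t ∧ ‖w‖ ≤ R := by
    intro t ht
    refine exists_pivotCLM_eq hι hR0 fun v => ?_
    have hlim : Tendsto (fun n => √(e n) * R * ‖v‖ + R * ‖ι v‖) atTop (𝓝 (R * ‖ι v‖)) := by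
      have := ((helim.sqrt.mul_const R).mul_const ‖v‖).add_const (R * ‖ι v‖)
      simpa using this
    refine ge_of_tendsto' hlim fun n => ?_
    obtain ⟨h5, h6⟩ := hbd (e n) (he0 n) t ht
    rw [← smoothing_spec ι (he0 n) (y t) v]
    set z := smoothing ι (he0 n) (y t)
    have h7 := abs_add_le (e n * inner ℝ z v) (inner ℝ (ι z) (ι v))
    have h8 : |e n * inner ℝ z v| ≤ √(e n) * R * ‖v‖ := by
      rw [abs_mul, abs_of_pos (he0 n)]
      calc e n * |inner ℝ z v| ≤ e n * (‖z‖ * ‖v‖) := by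
            have := he0 n
            gcongr; exact abs_real_inner_le_norm _ _
        _ = √(e n) * (√(e n) * ‖z‖) * ‖v‖ := by
            rw [← mul_assoc (√(e n)), Real.mul_self_sqrt (he0 n).le]; ring
        _ ≤ _ := by gcongr
    have h9 : |inner ℝ (ι z) (ι v)| ≤ R * ‖ι v‖ :=
      (abs_real_inner_le_norm _ _).trans (by gcongr)
    linarith
  choose! w hw hwR using hfun
  have hwae : ∀ᵐ t ∂volume.restrict (Icc a b), ι (u t) = w t := by
    filter_upwards [hae, ae_restrict_mem measurableSet_Icc] with t ht ht'
    exact pivotCLM_injective hd (ht.trans (hw t ht').symm)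
  -- weak continuity of `w`
  have hweak : ∀ t ∈ Icc a b, ∀ g : H,
      Tendsto (fun s => inner ℝ (w s) g) (𝓝[Icc a b] t) (𝓝 (inner ℝ (w t) g)) := by
    intro t ht g
    have hb : ∀ᶠ s in 𝓝[Icc a b] t, ∀ g : H, ‖innerSL ℝ (w s) g‖ ≤ R * ‖g‖ := by
      filter_upwards [self_mem_nhdsWithin] with s hs g
      rw [innerSL_apply_apply]
      exact (norm_inner_le_norm _ _).trans (by gcongr; exact hwR s hs)
    refine tendsto_apply_of_denseRange (T := fun s => innerSL ℝ (w s)) (T₀ := innerSL ℝ (w t)) hb hd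
      (fun v => ?_) g
    have h3 : Tendsto (fun s => y s v) (𝓝[Icc a b] t) (𝓝 (y t v)) :=
      ((hyc t ht).clm_apply continuousWithinAt_const)
    refine (tendsto_congr' ?_).mp ((hw t ht) ▸ h3)
    filter_upwards [self_mem_nhdsWithin] with s hs
    rw [← hw s hs]; rfl
  -- measurability of `w`
  have hwm : AEStronglyMeasurable w (volume.restrict (Icc a b)) :=
    (ι.continuous.comp_aestronglyMeasurable hu.1).congr hwae
  have hgi : Integrable (fun s => ‖k₁ s‖ * ‖u s‖ + ‖k₂ s‖ * R) (volume.restrict (Icc a b)) :=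
    (integrable_norm_mul h₁ hu).add (h₂.norm.mul_const R)
  have hki : Integrable (fun s => k₁ s (u s) + inner ℝ (k₂ s) (w s))
      (volume.restrict (Icc a b)) := by
    refine Integrable.mono' hgi ?_ ?_
    · exact ((ContinuousLinearMap.apply ℝ ℝ :
        V →L[ℝ] StrongDual ℝ V →L[ℝ] ℝ).aestronglyMeasurable_comp₂ hu.1 h₁.1).add
        (h₂.1.inner hwm)
    · filter_upwards [ae_restrict_mem measurableSet_Icc] with s hs
      refine (norm_add_le _ _).trans (add_le_add (ContinuousLinearMap.le_opNorm _ _) ?_)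
      exact (norm_inner_le_norm _ _).trans (by gcongr; exact hwR s hs)
  -- the energy identity
  have hen : ∀ t ∈ Icc a b,
      ‖w t‖ ^ 2 = ‖x‖ ^ 2 + 2 * ∫ s in a..t, (k₁ s (u s) + inner ℝ (k₂ s) (w s)) := by
    intro t ht
    have hsq : ∀ g : H, Tendsto (fun n => pivotCLM ι g (smoothing ι (he0 n) (pivotCLM ι g))) atTop
        (𝓝 (‖g‖ ^ 2)) := by
      intro g
      simp only [pivotCLM_apply]
      rw [← real_inner_self_eq_norm_sq]
      exact tendsto_const_nhds.inner (tendsto_smoothing_pivot hd he0 helim g)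
    have hl : Tendsto (fun n => y t (smoothing ι (he0 n) (y t))) atTop (𝓝 (‖w t‖ ^ 2)) := by
      rw [← hw t ht]; exact hsq (w t)
    have hr : Tendsto (fun n => ∫ s in a..t, h s (smoothing ι (he0 n) (y s))) atTop
        (𝓝 (∫ s in a..t, (k₁ s (u s) + inner ℝ (k₂ s) (w s)))) := by
      refine intervalIntegral.tendsto_integral_filter_of_dominated_convergence
        (fun s => ‖k₁ s‖ * ‖u s‖ + ‖k₂ s‖ * R) ?_ ?_ (intervalIntegrable_of_mem hgi ht) ?_
      · refine Eventually.of_forall fun n => ?_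
        rw [uIoc_of_le ht.1]
        have hsub : Ioc a t ⊆ Icc a b := Ioc_subset_Icc_self.trans (Icc_subset_Icc_right ht.2)
        refine AEStronglyMeasurable.mono_measure ?_ (Measure.restrict_mono hsub le_rfl)
        exact (ContinuousLinearMap.apply ℝ ℝ :
          V →L[ℝ] StrongDual ℝ V →L[ℝ] ℝ).aestronglyMeasurable_comp₂
          (((smoothing ι (he0 n)).continuous.comp_continuousOn hyc).aestronglyMeasurable
            measurableSet_Icc) hint.1
      · refine Eventually.of_forall fun n => ?_
        rw [uIoc_of_le ht.1, ← ae_restrict_iff' measurableSet_Ioc]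
        refine ae_restrict_Ioc_of_ae ht ?_
        filter_upwards [hae, ae_restrict_mem measurableSet_Icc] with s hs hs'
        have e1 : h s (smoothing ι (he0 n) (y s)) = k₁ s (smoothing ι (he0 n) (y s)) +
          inner ℝ (k₂ s) (ι (smoothing ι (he0 n) (y s))) := rfl
        rw [e1]
        refine (norm_add_le _ _).trans (add_le_add ?_ ?_)
        · refine (ContinuousLinearMap.le_opNorm _ _).trans ?_
          gcongr
          have : y s = pivotCLM ι (ι (u s)) := hs.symm
          rw [this]
          exact norm_smoothing_le ι (he0 n) (u s)
        · exact (norm_inner_le_norm _ _).trans (by gcongr; exact (hbd _ (he0 n) s hs').2)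
      · rw [uIoc_of_le ht.1, ← ae_restrict_iff' measurableSet_Ioc]
        refine ae_restrict_Ioc_of_ae ht ?_
        filter_upwards [hae, hwae] with s hs hs'
        have e1 : ∀ n, h s (smoothing ι (he0 n) (y s)) =
            k₁ s (smoothing ι (he0 n) (pivotCLM ι (ι (u s)))) +
            inner ℝ (k₂ s) (ι (smoothing ι (he0 n) (pivotCLM ι (w s)))) := by
          intro n
          have : y s = pivotCLM ι (ι (u s)) := hs.symm
          rw [← hs', ← this]; rfl
        simp only [e1]
        exact (tendsto_apply_smoothing hι hd he0 helim _ _).add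
          (tendsto_const_nhds.inner (tendsto_smoothing_pivot hd he0 helim _))
    have heq : ∀ n, y t (smoothing ι (he0 n) (y t)) =
        pivotCLM ι x (smoothing ι (he0 n) (pivotCLM ι x)) +
          2 * ∫ s in a..t, h s (smoothing ι (he0 n) (y s)) := fun n =>
      smoothed_energy_eq ι (he0 n) (intervalIntegrable_of_mem hint ht) (pivotCLM ι x)
    simp only [heq] at hl
    exact tendsto_nhds_unique hl ((hsq x).add (hr.const_mul 2))
  have hnc : ContinuousOn (fun t => ‖w t‖ ^ 2) (Icc a b) := by
    refine ContinuousOn.congr ?_ hen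
    exact continuousOn_const.add (continuousOn_const.mul (continuousOn_primitive_Icc hki))
  -- weak continuity and continuity of the norm give continuity
  have hcont : ContinuousOn w (Icc a b) := by
    intro t ht
    rw [ContinuousWithinAt, tendsto_iff_norm_sub_tendsto_zero]
    have h3 : Tendsto (fun s => ‖w s‖ ^ 2 - 2 * inner ℝ (w s) (w t) + ‖w t‖ ^ 2) (𝓝[Icc a b] t)
        (𝓝 (‖w t‖ ^ 2 - 2 * inner ℝ (w t) (w t) + ‖w t‖ ^ 2)) :=
      ((hnc t ht).sub ((hweak t ht (w t)).const_mul 2)).add_const _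
    rw [real_inner_self_eq_norm_sq] at h3
    have h4 : ‖w t‖ ^ 2 - 2 * ‖w t‖ ^ 2 + ‖w t‖ ^ 2 = 0 := by ring
    rw [h4] at h3
    have h5 := h3.sqrt
    rw [Real.sqrt_zero] at h5
    refine h5.congr fun s => ?_
    rw [← norm_sub_sq_real, Real.sqrt_sq (norm_nonneg _)]
  exact ⟨w, ⟨hcont, hu, h₁, h₂, hwae, hw⟩, hen⟩

theorem IsEvol.energy {ι : V →L[ℝ] H} (hι : Function.Injective ι) (hd : DenseRange ι)
    {a b : ℝ} {x : H} {k₁ : ℝ → StrongDual ℝ V} {k₂ : ℝ → H} {w : ℝ → H} {u : ℝ → V}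
    (h : IsEvol ι a b x k₁ k₂ w u) {t : ℝ} (ht : t ∈ Icc a b) :
    ‖w t‖ ^ 2 = ‖x‖ ^ 2 + 2 * ∫ s in a..t, (k₁ s (u s) + inner ℝ (k₂ s) (w s)) := by
  have hae : ∀ᵐ t ∂volume.restrict (Icc a b), pivotCLM ι (ι (u t)) =
      pivotCLM ι x + ∫ s in a..t, (k₁ s + pivotCLM ι (k₂ s)) := by
    filter_upwards [h.ae_eq, ae_restrict_mem measurableSet_Icc] with t ht ht'
    rw [ht, h.eq t ht']
  obtain ⟨w', hw', hen⟩ := exists_isEvol_energy hι hd (ht.1.trans ht.2) h.memV h.mem1 h.int2 hae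
  have hww : ∀ s ∈ Icc a b, w s = w' s := fun s hs =>
    pivotCLM_injective hd ((h.eq s hs).trans (hw'.eq s hs).symm)
  rw [hww t ht, hen t ht]
  congr 2
  refine intervalIntegral.integral_congr fun s hs => ?_
  rw [uIcc_of_le ht.1] at hs
  rw [hww s ⟨hs.1, hs.2.trans ht.2⟩]

end Evolution

/-! ### The linear problem -/

section L2

variable {α E F : Type*} [NormedAddCommGroup E] [NormedAddCommGroup F] {m : MeasurableSpace α}
  {μ : Measure α}

theorem toReal_eLpNorm_two_sq {f : α → E} (hf : MemLp f 2 μ) :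
    (eLpNorm f 2 μ).toReal ^ 2 = ∫ s, ‖f s‖ ^ 2 ∂μ := by
  rw [hf.eLpNorm_eq_integral_rpow_norm (by norm_num) (by norm_num)]
  have h0 : 0 ≤ ∫ s, ‖f s‖ ^ 2 ∂μ := integral_nonneg fun s => by positivity
  simp only [ENNReal.toReal_ofNat, Real.rpow_ofNat]
  rw [ENNReal.toReal_ofReal (by positivity), ← Real.rpow_natCast, ← Real.rpow_mul h0]
  norm_num

theorem integral_norm_mul_le {f : α → E} {g : α → F} (hf : MemLp f 2 μ) (hg : MemLp g 2 μ) :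
    ∫ s, ‖f s‖ * ‖g s‖ ∂μ ≤ (eLpNorm f 2 μ).toReal * (eLpNorm g 2 μ).toReal := by
  have h := integral_mul_le_Lp_mul_Lq_of_nonneg (μ := μ) (p := 2) (q := 2)
    (Real.holderConjugate_iff.mpr ⟨by norm_num, by norm_num⟩)
    (Filter.Eventually.of_forall fun s => norm_nonneg (f s))
    (Filter.Eventually.of_forall fun s => norm_nonneg (g s))
    (by simpa using hf.norm) (by simpa using hg.norm)
  refine h.trans (le_of_eq ?_)
  simp only [Real.rpow_ofNat]
  rw [← toReal_eLpNorm_two_sq hf, ← toReal_eLpNorm_two_sq hg, ← Real.sqrt_eq_rpow,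
    ← Real.sqrt_eq_rpow, Real.sqrt_sq ENNReal.toReal_nonneg, Real.sqrt_sq ENNReal.toReal_nonneg]

end L2

section Lions

open Filter Topology

theorem exists_strongDual_apply_eq_of_abs_le {P W : Type*} [AddCommGroup P] [Module ℝ P]
    [NormedAddCommGroup W] [NormedSpace ℝ W] (Φ : P →ₗ[ℝ] W) (ℓ : P →ₗ[ℝ] ℝ) {C : ℝ}
    (h : ∀ p, |ℓ p| ≤ C * ‖Φ p‖) : ∃ g : StrongDual ℝ W, ∀ p, g (Φ p) = ℓ p := by
  have hker : LinearMap.ker Φ ≤ LinearMap.ker ℓ := fun p hp => by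
    have h1 := h p
    rw [LinearMap.mem_ker] at hp ⊢
    rw [hp, norm_zero, mul_zero] at h1
    exact abs_nonpos_iff.mp h1
  let f₀ : LinearMap.range Φ →ₗ[ℝ] ℝ :=
    (LinearMap.ker Φ).liftQ ℓ hker ∘ₗ Φ.quotKerEquivRange.symm.toLinearMap
  have hf₀ : ∀ p, f₀ ⟨Φ p, LinearMap.mem_range_self Φ p⟩ = ℓ p := by
    intro p
    have : Φ.quotKerEquivRange.symm ⟨Φ p, LinearMap.mem_range_self Φ p⟩ =
        (LinearMap.ker Φ).mkQ p := by
      rw [LinearEquiv.symm_apply_eq]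
      exact Subtype.ext (LinearMap.quotKerEquivRange_apply_mk Φ p).symm
    simp only [f₀, LinearMap.comp_apply, LinearEquiv.coe_coe, this]
    simp
  have hb : ∀ z, ‖f₀ z‖ ≤ C * ‖z‖ := by
    rintro ⟨_, p, rfl⟩
    rw [hf₀]
    exact h p
  obtain ⟨g, hg, -⟩ := exists_extension_norm_eq _ (f₀.mkContinuous C hb)
  exact ⟨g, fun p => (hg ⟨Φ p, LinearMap.mem_range_self Φ p⟩).trans (hf₀ p)⟩

/-- Lions' projection theorem: a linear functional `ℓ` that is controlled by `Φ p ∈ E*` is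
represented by an element of the Hilbert space `E`. -/
theorem exists_forall_apply_eq_of_abs_le {P E : Type*} [AddCommGroup P] [Module ℝ P]
    [NormedAddCommGroup E] [InnerProductSpace ℝ E] [CompleteSpace E] (Φ : P →ₗ[ℝ] StrongDual ℝ E)
    (ℓ : P →ₗ[ℝ] ℝ) {C : ℝ} (h : ∀ p, |ℓ p| ≤ C * ‖Φ p‖) : ∃ u : E, ∀ p, Φ p u = ℓ p := by
  obtain ⟨g, hg⟩ := exists_strongDual_apply_eq_of_abs_le Φ ℓ h
  let g' : StrongDual ℝ E :=
    g.comp (InnerProductSpace.toDual ℝ E).toContinuousLinearEquiv.toContinuousLinearMap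
  refine ⟨(InnerProductSpace.toDual ℝ E).symm g', fun p => ?_⟩
  rw [← hg p]
  set k := (InnerProductSpace.toDual ℝ E).symm (Φ p) with hk
  have h2 : Φ p = InnerProductSpace.toDual ℝ E k := by simp [hk]
  rw [h2, InnerProductSpace.toDual_apply_apply, real_inner_comm,
    InnerProductSpace.toDual_symm_apply]
  rfl

variable {V H : Type*} [NormedAddCommGroup V] [InnerProductSpace ℝ V] [CompleteSpace V]
  [NormedAddCommGroup H] [InnerProductSpace ℝ H] [CompleteSpace H]

theorem integrable_coeFn_Lp {a b : ℝ} (p : Lp V 2 (volume.restrict (Icc a b))) :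
    Integrable p (volume.restrict (Icc a b)) :=
  (Lp.memLp p).integrable (by norm_num)

/-- The primitive `t ↦ ∫_t^b p` that vanishes at `b`. -/
noncomputable def backPrimitive (b : ℝ) (p : ℝ → V) (t : ℝ) : V := ∫ s in t..b, p s

theorem backPrimitive_eq {a b : ℝ} {p : ℝ → V} (hp : Integrable p (volume.restrict (Icc a b)))
    {τ t : ℝ} (hτ : τ ∈ Icc a b) (ht : t ∈ Icc a b) :
    backPrimitive b p t = backPrimitive b p τ + ∫ s in τ..t, -p s := by
  have hab : a ≤ b := hτ.1.trans hτ.2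
  have h0 : IntervalIntegrable p volume a b := intervalIntegrable_of_mem hp ⟨hab, le_rfl⟩
  have hτ' : τ ∈ uIcc a b := by rwa [uIcc_of_le hab]
  have ht' : t ∈ uIcc a b := by rwa [uIcc_of_le hab]
  rw [backPrimitive, backPrimitive, intervalIntegral.integral_neg, ← sub_eq_add_neg,
    ← intervalIntegral.integral_add_adjacent_intervals
      (intervalIntegrable_sub_interval h0 hτ' ht')
      (intervalIntegrable_sub_interval h0 ht' right_mem_uIcc)]
  abel

theorem continuousOn_backPrimitive {a b : ℝ} {p : ℝ → V}
    (hp : Integrable p (volume.restrict (Icc a b))) :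
    ContinuousOn (backPrimitive b p) (Icc a b) := by
  intro t ht
  have hab : a ≤ b := ht.1.trans ht.2
  have h1 : ContinuousOn (fun t => backPrimitive b p a + ∫ s in a..t, -p s) (Icc a b) :=
    continuousOn_const.add (continuousOn_primitive_Icc hp.neg)
  exact (h1.congr fun s hs => backPrimitive_eq hp ⟨le_rfl, hab⟩ hs) t ht

theorem norm_backPrimitive_le {a b : ℝ} {p : ℝ → V} (hp : MemLp p 2 (volume.restrict (Icc a b)))
    {t : ℝ} (ht : t ∈ Icc a b) :
    ‖backPrimitive b p t‖ ≤ (eLpNorm (fun _ => (1 : ℝ)) 2 (volume.restrict (Icc a b))).toReal *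
      (eLpNorm p 2 (volume.restrict (Icc a b))).toReal := by
  have h1 : MemLp (fun _ : ℝ => (1 : ℝ)) 2 (volume.restrict (Icc a b)) := memLp_const _
  have h2 := integral_norm_mul_le h1 hp
  simp only [norm_one, one_mul] at h2
  refine le_trans ?_ h2
  rw [backPrimitive, intervalIntegral.integral_of_le ht.2]
  refine (norm_integral_le_integral_norm _).trans ?_
  exact setIntegral_mono_set ((hp.integrable (by norm_num)).norm)
    (Eventually.of_forall fun _ => norm_nonneg _)
    (Ioc_subset_Icc_self.trans (Icc_subset_Icc_left ht.1)).eventuallyLE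

theorem backPrimitive_coeFn_add {a b : ℝ} (p q : Lp V 2 (volume.restrict (Icc a b))) {t : ℝ}
    (ht : t ∈ Icc a b) :
    backPrimitive b (p + q : Lp V 2 (volume.restrict (Icc a b))) t =
      backPrimitive b p t + backPrimitive b q t := by
  have hsub : Ioc t b ⊆ Icc a b := Ioc_subset_Icc_self.trans (Icc_subset_Icc_left ht.1)
  simp only [backPrimitive]
  rw [intervalIntegral.integral_of_le ht.2, intervalIntegral.integral_of_le ht.2,
    intervalIntegral.integral_of_le ht.2,
    ← integral_add (IntegrableOn.mono_set (integrable_coeFn_Lp p) hsub)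
      (IntegrableOn.mono_set (integrable_coeFn_Lp q) hsub)]
  exact integral_congr_ae (ae_restrict_of_ae_restrict_of_subset hsub (Lp.coeFn_add p q))

theorem backPrimitive_coeFn_smul {a b : ℝ} (c : ℝ) (p : Lp V 2 (volume.restrict (Icc a b))) {t : ℝ}
    (ht : t ∈ Icc a b) :
    backPrimitive b (c • p : Lp V 2 (volume.restrict (Icc a b))) t = c • backPrimitive b p t := by
  have hsub : Ioc t b ⊆ Icc a b := Ioc_subset_Icc_self.trans (Icc_subset_Icc_left ht.1)
  simp only [backPrimitive]
  rw [intervalIntegral.integral_of_le ht.2, intervalIntegral.integral_of_le ht.2, ← integral_smul]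
  exact integral_congr_ae (ae_restrict_of_ae_restrict_of_subset hsub (Lp.coeFn_smul c p))

/-- Measurability and boundedness on `[a, b]` of a family of operators `V → V*`. -/
structure IsLinFamily (a b C : ℝ) (𝒜 : ℝ → V →L[ℝ] StrongDual ℝ V) : Prop where
  meas : ∀ u : ℝ → V, AEStronglyMeasurable u (volume.restrict (Icc a b)) →
    AEStronglyMeasurable (fun t => 𝒜 t (u t)) (volume.restrict (Icc a b))
  bound : ∀ t ∈ Icc a b, ∀ v, ‖𝒜 t v‖ ≤ C * ‖v‖

theorem IsLinFamily.memLp {a b C : ℝ} {𝒜 : ℝ → V →L[ℝ] StrongDual ℝ V} (h : IsLinFamily a b C 𝒜)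
    {u : ℝ → V} (hu : MemLp u 2 (volume.restrict (Icc a b))) :
    MemLp (fun t => 𝒜 t (u t)) 2 (volume.restrict (Icc a b)) := by
  refine MemLp.of_le_mul (c := C) hu (h.meas u hu.1) ?_
  filter_upwards [ae_restrict_mem measurableSet_Icc] with t ht
  exact h.bound t ht _

theorem aestronglyMeasurable_apply {k : ℝ → StrongDual ℝ V} {u : ℝ → V} {μ : Measure ℝ}
    (hk : AEStronglyMeasurable k μ) (hu : AEStronglyMeasurable u μ) :
    AEStronglyMeasurable (fun s => k s (u s)) μ :=
  (ContinuousLinearMap.apply ℝ ℝ : V →L[ℝ] StrongDual ℝ V →L[ℝ] ℝ).aestronglyMeasurable_comp₂ hu hk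

theorem integrable_apply {k : ℝ → StrongDual ℝ V} {u : ℝ → V} {μ : Measure ℝ}
    (hk : MemLp k 2 μ) (hu : MemLp u 2 μ) : Integrable (fun s => k s (u s)) μ :=
  Integrable.mono' (integrable_norm_mul hk hu) (aestronglyMeasurable_apply hk.1 hu.1)
    (Eventually.of_forall fun s => (k s).le_opNorm (u s))

theorem memLp_two_of_continuousOn {E : Type*} [NormedAddCommGroup E] {a b : ℝ} {f : ℝ → E}
    (hf : ContinuousOn f (Icc a b)) : MemLp f 2 (volume.restrict (Icc a b)) := by
  obtain ⟨C, hC⟩ := isCompact_Icc.exists_bound_of_continuousOn hf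
  refine MemLp.of_bound (hf.aestronglyMeasurable_of_isCompact isCompact_Icc measurableSet_Icc) C ?_
  filter_upwards [ae_restrict_mem measurableSet_Icc] with t ht using hC t ht

end Lions

section Lions

open Filter Topology

variable {V H : Type*} [NormedAddCommGroup V] [InnerProductSpace ℝ V] [CompleteSpace V]
  [NormedAddCommGroup H] [InnerProductSpace ℝ H] [CompleteSpace H]

theorem integrable_inner_map (ι : V →L[ℝ] H) {u p : ℝ → V} {μ : Measure ℝ} (hu : MemLp u 2 μ)
    (hp : MemLp p 2 μ) : Integrable (fun t => inner ℝ (ι (u t)) (ι (p t))) μ := by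
  refine Integrable.mono' ((integrable_norm_mul hu hp).const_mul (‖ι‖ * ‖ι‖))
    ((ι.continuous.comp_aestronglyMeasurable hu.1).inner
      (ι.continuous.comp_aestronglyMeasurable hp.1)) (Eventually.of_forall fun t => ?_)
  calc ‖inner ℝ (ι (u t)) (ι (p t))‖ ≤ ‖ι (u t)‖ * ‖ι (p t)‖ := norm_inner_le_norm _ _
    _ ≤ (‖ι‖ * ‖u t‖) * (‖ι‖ * ‖p t‖) := by gcongr <;> exact ι.le_opNorm _
    _ = _ := by ring

/-- The bilinear form `(p, u) ↦ ∫ (ι u, ι p)_H + ⟨𝒜 u, ∫_·^b p⟩` of the weak formulation. -/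
theorem exists_lions_form (ι : V →L[ℝ] H) {a b C : ℝ} {𝒜 : ℝ → V →L[ℝ] StrongDual ℝ V}
    (h𝒜 : IsLinFamily a b C 𝒜) :
    ∃ Φ : Lp V 2 (volume.restrict (Icc a b)) →L[ℝ]
        StrongDual ℝ (Lp V 2 (volume.restrict (Icc a b))),
      ∀ p u, Φ p u = ∫ t in Icc a b,
        (inner ℝ (ι (u t)) (ι (p t)) + 𝒜 t (u t) (backPrimitive b p t)) := by
  set μ := volume.restrict (Icc a b) with hμ
  have hI : ∀ p : Lp V 2 μ, MemLp (backPrimitive b p) 2 μ := fun p =>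
    memLp_two_of_continuousOn (continuousOn_backPrimitive (integrable_coeFn_Lp p))
  have hi : ∀ p u : Lp V 2 μ, Integrable
      (fun t => inner ℝ (ι (u t)) (ι (p t)) + 𝒜 t (u t) (backPrimitive b p t)) μ := fun p u =>
    (integrable_inner_map ι (Lp.memLp u) (Lp.memLp p)).add
      (integrable_apply (h𝒜.memLp (Lp.memLp u)) (hI p))
  set c := (eLpNorm (fun _ => (1 : ℝ)) 2 μ).toReal with hc
  let Φ₀ : Lp V 2 μ →ₗ[ℝ] Lp V 2 μ →ₗ[ℝ] ℝ := LinearMap.mk₂ ℝ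
    (fun p u => ∫ t, (inner ℝ (ι (u t)) (ι (p t)) + 𝒜 t (u t) (backPrimitive b p t)) ∂μ)
    (by
      intro p q u
      rw [← integral_add (hi p u) (hi q u)]
      refine integral_congr_ae ?_
      filter_upwards [Lp.coeFn_add p q, ae_restrict_mem measurableSet_Icc] with t h1 h2
      rw [backPrimitive_coeFn_add p q h2, h1, Pi.add_apply, map_add, inner_add_right, map_add]
      ring)
    (by
      intro r p u
      rw [smul_eq_mul, ← integral_const_mul]
      refine integral_congr_ae ?_
      filter_upwards [Lp.coeFn_smul r p, ae_restrict_mem measurableSet_Icc] with t h1 h2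
      rw [backPrimitive_coeFn_smul r p h2, h1, Pi.smul_apply, map_smul, inner_smul_right, map_smul,
        smul_eq_mul]
      ring)
    (by
      intro p u v
      rw [← integral_add (hi p u) (hi p v)]
      refine integral_congr_ae ?_
      filter_upwards [Lp.coeFn_add u v] with t h1
      rw [h1, Pi.add_apply, map_add, inner_add_left, map_add, add_apply]
      ring)
    (by
      intro r p u
      rw [smul_eq_mul, ← integral_const_mul]
      refine integral_congr_ae ?_
      filter_upwards [Lp.coeFn_smul r u] with t h1
      rw [h1, Pi.smul_apply, map_smul, real_inner_smul_left, map_smul, smul_apply, smul_eq_mul]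
      ring)
  refine ⟨Φ₀.mkContinuous₂ (‖ι‖ * ‖ι‖ + |C| * c * c) fun p u => ?_, fun p u => rfl⟩
  change ‖∫ t, (inner ℝ (ι (u t)) (ι (p t)) + 𝒜 t (u t) (backPrimitive b p t)) ∂μ‖ ≤ _
  have h1 := integral_norm_mul_le (Lp.memLp u) (Lp.memLp p)
  have h2 := integral_norm_mul_le (Lp.memLp u) (memLp_const (1 : ℝ) : MemLp (fun _ => (1 : ℝ)) 2 μ)
  rw [← Lp.norm_def, ← Lp.norm_def] at h1
  rw [← Lp.norm_def] at h2
  simp only [norm_one, mul_one] at h2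
  have hg1 := integrable_norm_mul (Lp.memLp u) (Lp.memLp p)
  have hg2 : Integrable (fun t => ‖u t‖) μ := (integrable_coeFn_Lp u).norm
  refine (norm_integral_le_of_norm_le
    ((hg1.const_mul (‖ι‖ * ‖ι‖)).add (hg2.const_mul (|C| * (c * ‖p‖)))) ?_).trans ?_
  · filter_upwards [ae_restrict_mem measurableSet_Icc] with t ht
    refine (norm_add_le _ _).trans (add_le_add ?_ ?_)
    · calc ‖inner ℝ (ι (u t)) (ι (p t))‖ ≤ ‖ι (u t)‖ * ‖ι (p t)‖ := norm_inner_le_norm _ _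
        _ ≤ (‖ι‖ * ‖u t‖) * (‖ι‖ * ‖p t‖) := by gcongr <;> exact ι.le_opNorm _
        _ = _ := by ring
    · have h3 := norm_backPrimitive_le (Lp.memLp p) ht
      rw [← Lp.norm_def] at h3
      calc ‖𝒜 t (u t) (backPrimitive b p t)‖ ≤ ‖𝒜 t (u t)‖ * ‖backPrimitive b p t‖ :=
            (𝒜 t (u t)).le_opNorm _
        _ ≤ (|C| * ‖u t‖) * (c * ‖p‖) := by
            gcongr
            exact (h𝒜.bound t ht _).trans (by gcongr; exact le_abs_self C)
        _ = _ := by ring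
  · simp only [Pi.add_apply]
    rw [integral_add (hg1.const_mul _) (hg2.const_mul _), integral_const_mul, integral_const_mul]
    have hc0 : 0 ≤ c := ENNReal.toReal_nonneg
    calc ‖ι‖ * ‖ι‖ * ∫ t, ‖u t‖ * ‖p t‖ ∂μ + |C| * (c * ‖p‖) * ∫ t, ‖u t‖ ∂μ
        ≤ ‖ι‖ * ‖ι‖ * (‖u‖ * ‖p‖) + |C| * (c * ‖p‖) * (‖u‖ * c) := by gcongr
      _ = _ := by ring

/-- Testing the form with `1_{[τ,b]} ∫_·^b p`: it controls both `‖∫_·^b p‖` in `L²(a,b;V)` and the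
`H`-norm of `∫_τ^b p` at every `τ`. -/
theorem lions_form_coercive (ι : V →L[ℝ] H) {a b C θ : ℝ} {𝒜 : ℝ → V →L[ℝ] StrongDual ℝ V}
    (h𝒜 : IsLinFamily a b C 𝒜) (hco : ∀ t ∈ Icc a b, ∀ v, θ * ‖v‖ ^ 2 ≤ 𝒜 t v v)
    {Φ : Lp V 2 (volume.restrict (Icc a b)) →L[ℝ] StrongDual ℝ (Lp V 2 (volume.restrict (Icc a b)))}
    (hΦ : ∀ p u, Φ p u = ∫ t in Icc a b,
        (inner ℝ (ι (u t)) (ι (p t)) + 𝒜 t (u t) (backPrimitive b p t)))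
    (p : Lp V 2 (volume.restrict (Icc a b))) {τ : ℝ} (hτ : τ ∈ Icc a b) :
    ∃ m : ℝ, 0 ≤ m ∧ m ^ 2 = ∫ t in Icc τ b, ‖backPrimitive b p t‖ ^ 2 ∧
      1 / 2 * ‖ι (backPrimitive b p τ)‖ ^ 2 + θ * m ^ 2 ≤ ‖Φ p‖ * m := by
  have hpi := integrable_coeFn_Lp p
  set z := backPrimitive b p with hz
  have hzc : ContinuousOn z (Icc a b) := continuousOn_backPrimitive hpi
  have hzm : MemLp z 2 (volume.restrict (Icc a b)) := memLp_two_of_continuousOn hzc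
  have hsub : Icc τ b ⊆ Icc a b := Icc_subset_Icc_left hτ.1
  have hqm : MemLp ((Icc τ b).indicator z) 2 (volume.restrict (Icc a b)) :=
    hzm.indicator measurableSet_Icc
  set q : Lp V 2 (volume.restrict (Icc a b)) := hqm.toLp _ with hq
  have hqe : ∀ᵐ t ∂volume.restrict (Icc a b), q t = (Icc τ b).indicator z t := hqm.coeFn_toLp
  have hqn : ‖q‖ ^ 2 = ∫ t in Icc τ b, ‖z t‖ ^ 2 := by
    rw [Lp.norm_def, toReal_eLpNorm_two_sq (Lp.memLp q)]
    have : ∀ᵐ t ∂volume.restrict (Icc a b), ‖q t‖ ^ 2 =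
        (Icc τ b).indicator (fun t => ‖z t‖ ^ 2) t := by
      filter_upwards [hqe] with t ht
      rw [ht]
      by_cases h : t ∈ Icc τ b <;> simp [h]
    rw [integral_congr_ae this, integral_indicator measurableSet_Icc,
      Measure.restrict_restrict_of_subset hsub]
  refine ⟨‖q‖, norm_nonneg _, hqn, ?_⟩
  have hle : Φ p q ≤ ‖Φ p‖ * ‖q‖ := (le_abs_self _).trans ((Φ p).le_opNorm q)
  refine le_trans ?_ hle
  have h1 : Φ p q = ∫ t in Icc τ b, (inner ℝ (ι (z t)) (ι (p t)) + 𝒜 t (z t) (z t)) := by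
    rw [hΦ]
    have : ∀ᵐ t ∂volume.restrict (Icc a b),
        (inner ℝ (ι (q t)) (ι (p t)) + 𝒜 t (q t) (backPrimitive b p t)) =
        (Icc τ b).indicator (fun t => inner ℝ (ι (z t)) (ι (p t)) + 𝒜 t (z t) (z t)) t := by
      filter_upwards [hqe] with t ht
      rw [ht]
      by_cases h : t ∈ Icc τ b <;> simp [h, hz]
    rw [integral_congr_ae this, integral_indicator measurableSet_Icc,
      Measure.restrict_restrict_of_subset hsub]
  have hi1 : IntegrableOn (fun t => inner ℝ (ι (z t)) (ι (p t))) (Icc τ b) :=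
    IntegrableOn.mono_set (integrable_inner_map ι hzm (Lp.memLp p)) hsub
  have hi2 : IntegrableOn (fun t => 𝒜 t (z t) (z t)) (Icc τ b) :=
    IntegrableOn.mono_set (integrable_apply (h𝒜.memLp hzm) hzm) hsub
  rw [h1, integral_add hi1 hi2, hqn]
  have h2 : θ * ∫ t in Icc τ b, ‖z t‖ ^ 2 ≤ ∫ t in Icc τ b, 𝒜 t (z t) (z t) := by
    rw [← integral_const_mul]
    refine setIntegral_mono_on ((IntegrableOn.mono_set
      (memLp_two_norm_sq_integrable hzm) hsub).const_mul θ) hi2 measurableSet_Icc fun t ht => ?_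
    exact hco t (hsub ht) _
  have h3 : ∫ t in Icc τ b, inner ℝ (ι (z t)) (ι (p t)) = 1 / 2 * ‖ι (z τ)‖ ^ 2 := by
    let L : V →L[ℝ] V →L[ℝ] ℝ := (pivotCLM ι).comp ι
    have hL : ∀ v w, L v w = inner ℝ (ι v) (ι w) := fun _ _ => rfl
    have hpτ : IntervalIntegrable (fun s => -p s) volume τ b :=
      ((intervalIntegrable_iff_integrableOn_Icc_of_le hτ.2).2
        (IntegrableOn.mono_set hpi hsub)).neg
    have h4 := bilin_primitive_eq L hpτ hpτ (z τ) (z τ)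
    rw [← backPrimitive_eq hpi hτ ⟨hτ.1.trans hτ.2, le_rfl⟩] at h4
    have h5 : backPrimitive b p b = 0 := by simp [backPrimitive]
    rw [h5, map_zero, hL, real_inner_self_eq_norm_sq,
      intervalIntegral.integral_of_le hτ.2, ← integral_Icc_eq_integral_Ioc] at h4
    have h6 : ∫ s in Icc τ b, (L (-p s) (z τ + ∫ r in τ..s, -p r) +
        L (z τ + ∫ r in τ..s, -p r) (-p s)) =
        ∫ s in Icc τ b, (-2) * inner ℝ (ι (z s)) (ι (p s)) := by
      refine setIntegral_congr_fun measurableSet_Icc fun s hs => ?_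
      rw [← backPrimitive_eq hpi hτ (hsub hs), hL, hL, map_neg, inner_neg_left, inner_neg_right,
        real_inner_comm]
      ring
    rw [h6, integral_const_mul] at h4
    linarith
  rw [h3]
  linarith

/-- Existence for the linear problem `w' + 𝒜(t) u = k₁ + k₂`, `w(a) = x`. -/
theorem exists_linear_evol {ι : V →L[ℝ] H} (hι : Function.Injective ι) (hd : DenseRange ι)
    {a b C θ : ℝ} (hab : a ≤ b) {𝒜 : ℝ → V →L[ℝ] StrongDual ℝ V} (h𝒜 : IsLinFamily a b C 𝒜)
    (hθ : 0 < θ) (hco : ∀ t ∈ Icc a b, ∀ v, θ * ‖v‖ ^ 2 ≤ 𝒜 t v v) (x : H)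
    {k₁ : ℝ → StrongDual ℝ V} {k₂ : ℝ → H} (h₁ : MemLp k₁ 2 (volume.restrict (Icc a b)))
    (h₂ : Integrable k₂ (volume.restrict (Icc a b))) :
    ∃ w u, IsEvol ι a b x (fun s => k₁ s - 𝒜 s (u s)) k₂ w u := by
  obtain ⟨Φ, hΦ⟩ := exists_lions_form ι h𝒜
  have haI : a ∈ Icc a b := ⟨le_rfl, hab⟩
  have hI : ∀ p : Lp V 2 (volume.restrict (Icc a b)),
      MemLp (backPrimitive b p) 2 (volume.restrict (Icc a b)) := fun p =>
    memLp_two_of_continuousOn (continuousOn_backPrimitive (integrable_coeFn_Lp p))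
  have hIc : ∀ p : Lp V 2 (volume.restrict (Icc a b)),
      AEStronglyMeasurable (fun t => ι (backPrimitive b p t)) (volume.restrict (Icc a b)) :=
    fun p => ι.continuous.comp_aestronglyMeasurable (hI p).1
  have hΦb : ∀ p : Lp V 2 (volume.restrict (Icc a b)),
      ∀ τ ∈ Icc a b, ‖ι (backPrimitive b p τ)‖ ≤ √(2 / θ) * ‖Φ p‖ := by
    intro p τ hτ
    obtain ⟨m, hm0, -, hm⟩ := lions_form_coercive ι h𝒜 hco hΦ p hτ
    refine abs_le_of_sq_le_sq' ?_ (by positivity) |>.2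
    rw [mul_pow, Real.sq_sqrt (by positivity), div_mul_eq_mul_div, le_div_iff₀ hθ]
    nlinarith [sq_nonneg (θ * m - ‖Φ p‖), sq_nonneg (θ * m)]
  have hΦm : ∀ p : Lp V 2 (volume.restrict (Icc a b)),
      (eLpNorm (backPrimitive b p) 2 (volume.restrict (Icc a b))).toReal ≤ 1 / θ * ‖Φ p‖ := by
    intro p
    obtain ⟨m, hm0, hm2, hm⟩ := lions_form_coercive ι h𝒜 hco hΦ p haI
    rw [← toReal_eLpNorm_two_sq (hI p)] at hm2
    have : m = (eLpNorm (backPrimitive b p) 2 (volume.restrict (Icc a b))).toReal :=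
      (sq_eq_sq₀ hm0 ENNReal.toReal_nonneg).mp hm2
    rw [← this, one_div, ← div_eq_inv_mul, le_div_iff₀ hθ]
    by_contra hc
    push Not at hc
    have hmp : 0 < m := by
      rcases hm0.eq_or_lt with h | h
      · rw [← h] at hc; simp at hc; linarith [norm_nonneg (Φ p)]
      · exact h
    nlinarith [sq_nonneg ‖ι (backPrimitive b p a)‖]
  have hi2 : ∀ p : Lp V 2 (volume.restrict (Icc a b)),
      Integrable (fun t => inner ℝ (k₂ t) (ι (backPrimitive b p t)))
        (volume.restrict (Icc a b)) := by
    intro p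
    refine Integrable.mono' (h₂.norm.mul_const (√(2 / θ) * ‖Φ p‖)) (h₂.1.inner (hIc p)) ?_
    filter_upwards [ae_restrict_mem measurableSet_Icc] with t ht
    exact (norm_inner_le_norm _ _).trans (by gcongr; exact hΦb p t ht)
  have hi : ∀ p : Lp V 2 (volume.restrict (Icc a b)),
      Integrable (fun t => k₁ t (backPrimitive b p t) + inner ℝ (k₂ t) (ι (backPrimitive b p t)))
        (volume.restrict (Icc a b)) := fun p =>
    (integrable_apply h₁ (hI p)).add (hi2 p)
  let ℓ : Lp V 2 (volume.restrict (Icc a b)) →ₗ[ℝ] ℝ :=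
    { toFun := fun p => inner ℝ x (ι (backPrimitive b p a)) +
        ∫ t, (k₁ t (backPrimitive b p t) + inner ℝ (k₂ t) (ι (backPrimitive b p t)))
          ∂volume.restrict (Icc a b)
      map_add' := fun p q => by
        rw [backPrimitive_coeFn_add p q haI, map_add, inner_add_right, add_add_add_comm,
          ← integral_add (hi p) (hi q)]
        congr 1
        refine integral_congr_ae ?_
        filter_upwards [ae_restrict_mem measurableSet_Icc] with t ht
        rw [backPrimitive_coeFn_add p q ht, map_add, map_add, inner_add_right]
        ring
      map_smul' := fun r p => by
        rw [backPrimitive_coeFn_smul r p haI, map_smul, real_inner_smul_right, RingHom.id_apply,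
          smul_eq_mul, mul_add, ← integral_const_mul]
        congr 1
        refine integral_congr_ae ?_
        filter_upwards [ae_restrict_mem measurableSet_Icc] with t ht
        rw [backPrimitive_coeFn_smul r p ht, map_smul, map_smul, real_inner_smul_right, smul_eq_mul]
        ring }
  have hℓ : ∀ p, |ℓ p| ≤ (‖x‖ * √(2 / θ) +
      ((eLpNorm k₁ 2 (volume.restrict (Icc a b))).toReal * (1 / θ) +
        (∫ t, ‖k₂ t‖ ∂volume.restrict (Icc a b)) * √(2 / θ))) *
      ‖(Φ : Lp V 2 (volume.restrict (Icc a b)) →ₗ[ℝ]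
        StrongDual ℝ (Lp V 2 (volume.restrict (Icc a b)))) p‖ := by
    intro p
    have e0 : ℓ p = inner ℝ x (ι (backPrimitive b p a)) +
        (∫ t, k₁ t (backPrimitive b p t) ∂volume.restrict (Icc a b) +
          ∫ t, inner ℝ (k₂ t) (ι (backPrimitive b p t)) ∂volume.restrict (Icc a b)) := by
      rw [← integral_add (integrable_apply h₁ (hI p)) (hi2 p)]; rfl
    have e1 : |inner ℝ x (ι (backPrimitive b p a))| ≤ ‖x‖ * (√(2 / θ) * ‖Φ p‖) :=
      (abs_real_inner_le_norm _ _).trans (by gcongr; exact hΦb p a haI)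
    have e2 : |∫ t, k₁ t (backPrimitive b p t) ∂volume.restrict (Icc a b)| ≤
        (eLpNorm k₁ 2 (volume.restrict (Icc a b))).toReal * (1 / θ * ‖Φ p‖) := by
      rw [← Real.norm_eq_abs]
      refine (norm_integral_le_of_norm_le (integrable_norm_mul h₁ (hI p))
        (Eventually.of_forall fun t => (k₁ t).le_opNorm _)).trans ?_
      refine (integral_norm_mul_le h₁ (hI p)).trans ?_
      gcongr
      exact hΦm p
    have e3 : |∫ t, inner ℝ (k₂ t) (ι (backPrimitive b p t)) ∂volume.restrict (Icc a b)| ≤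
        (∫ t, ‖k₂ t‖ ∂volume.restrict (Icc a b)) * (√(2 / θ) * ‖Φ p‖) := by
      rw [← integral_mul_const, ← Real.norm_eq_abs]
      refine norm_integral_le_of_norm_le (h₂.norm.mul_const _) ?_
      filter_upwards [ae_restrict_mem measurableSet_Icc] with t ht
      exact (norm_inner_le_norm _ _).trans (by gcongr; exact hΦb p t ht)
    rw [e0]
    refine (abs_add_le _ _).trans ?_
    have := abs_add_le (∫ t, k₁ t (backPrimitive b p t) ∂volume.restrict (Icc a b))
      (∫ t, inner ℝ (k₂ t) (ι (backPrimitive b p t)) ∂volume.restrict (Icc a b))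
    have e4 : (Φ : Lp V 2 (volume.restrict (Icc a b)) →ₗ[ℝ]
        StrongDual ℝ (Lp V 2 (volume.restrict (Icc a b)))) p = Φ p := rfl
    rw [e4]
    linarith
  obtain ⟨u, hu⟩ := exists_forall_apply_eq_of_abs_le
    (Φ : Lp V 2 (volume.restrict (Icc a b)) →ₗ[ℝ]
      StrongDual ℝ (Lp V 2 (volume.restrict (Icc a b)))) ℓ hℓ
  have hum : MemLp u 2 (volume.restrict (Icc a b)) := Lp.memLp u
  have h𝒜u := h𝒜.memLp hum
  set k₁' : ℝ → StrongDual ℝ V := fun s => k₁ s - 𝒜 s (u s) with hk₁'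
  have h₁' : MemLp k₁' 2 (volume.restrict (Icc a b)) := h₁.sub h𝒜u
  set f : ℝ → StrongDual ℝ V := fun s => k₁' s + pivotCLM ι (k₂ s) with hf
  have hfi : Integrable f (volume.restrict (Icc a b)) := integrable_forcing ι h₁' h₂
  set y : ℝ → StrongDual ℝ V := fun t => pivotCLM ι x + ∫ s in a..t, f s with hy
  have hyc : ContinuousOn y (Icc a b) := continuousOn_const.add (continuousOn_primitive_Icc hfi)
  have hym : MemLp y 2 (volume.restrict (Icc a b)) := memLp_two_of_continuousOn hyc
  have hPm : MemLp (fun t => pivotCLM ι (ι (u t))) 2 (volume.restrict (Icc a b)) :=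
    ((pivotCLM ι).comp ι).comp_memLp' hum
  set D : ℝ → StrongDual ℝ V := fun t => pivotCLM ι (ι (u t)) - y t with hD
  have hDm : MemLp D 2 (volume.restrict (Icc a b)) := hPm.sub hym
  -- `ι u` and `y`, both regarded in `V*`, have the same integral against every test function
  have hkey : ∀ p : Lp V 2 (volume.restrict (Icc a b)),
      ∫ t, D t (p t) ∂volume.restrict (Icc a b) = 0 := by
    intro p
    have hpi := integrable_coeFn_Lp p
    have h3 : Φ p u = ℓ p := hu p
    rw [hΦ] at h3
    have h3' : ∫ t, (inner ℝ (ι (u t)) (ι (p t)) + 𝒜 t (u t) (backPrimitive b p t))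
        ∂volume.restrict (Icc a b) =
      inner ℝ x (ι (backPrimitive b p a)) +
        ∫ t, (k₁ t (backPrimitive b p t) + inner ℝ (k₂ t) (ι (backPrimitive b p t)))
          ∂volume.restrict (Icc a b) := h3
    rw [integral_add (integrable_inner_map ι hum (Lp.memLp p))
      (integrable_apply h𝒜u (hI p))] at h3'
    -- integration by parts moves the primitive from the test function to the equation
    have h4 := bilin_primitive_eq (ContinuousLinearMap.id ℝ (StrongDual ℝ V))
      (intervalIntegrable_of_mem hfi ⟨hab, le_rfl⟩)
      (intervalIntegrable_of_mem hpi.neg ⟨hab, le_rfl⟩) (pivotCLM ι x) (backPrimitive b p a)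
    simp only [Pi.neg_apply] at h4
    rw [← backPrimitive_eq hpi haI ⟨hab, le_rfl⟩] at h4
    have h5 : backPrimitive b p b = 0 := by simp [backPrimitive]
    rw [h5, map_zero, intervalIntegral.integral_of_le hab, ← integral_Icc_eq_integral_Ioc] at h4
    have h6 : ∫ s in Icc a b, ((ContinuousLinearMap.id ℝ (StrongDual ℝ V)) (f s)
          (backPrimitive b p a + ∫ r in a..s, -p r) +
        (ContinuousLinearMap.id ℝ (StrongDual ℝ V)) (pivotCLM ι x + ∫ r in a..s, f r) (-p s)) =
        ∫ s, (((k₁ s (backPrimitive b p s) + inner ℝ (k₂ s) (ι (backPrimitive b p s))) -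
          𝒜 s (u s) (backPrimitive b p s)) - y s (p s)) ∂volume.restrict (Icc a b) := by
      refine setIntegral_congr_fun measurableSet_Icc fun s hs => ?_
      simp only [ContinuousLinearMap.id_apply]
      rw [← backPrimitive_eq hpi haI hs, map_neg, ← sub_eq_add_neg]
      congr 1
      simp only [hf, hk₁', add_apply, sub_apply, pivotCLM_apply]
      ring
    have hsub : Integrable (fun t => (k₁ t (backPrimitive b p t) +
        inner ℝ (k₂ t) (ι (backPrimitive b p t))) - 𝒜 t (u t) (backPrimitive b p t))
        (volume.restrict (Icc a b)) := (hi p).sub (integrable_apply h𝒜u (hI p))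
    rw [h6, integral_sub hsub (integrable_apply hym (Lp.memLp p)),
      integral_sub (hi p) (integrable_apply h𝒜u (hI p))] at h4
    have h7 : ∫ t, D t (p t) ∂volume.restrict (Icc a b) =
        ∫ t, inner ℝ (ι (u t)) (ι (p t)) ∂volume.restrict (Icc a b) -
          ∫ t, y t (p t) ∂volume.restrict (Icc a b) := by
      rw [← integral_sub (integrable_inner_map ι hum (Lp.memLp p))
        (integrable_apply hym (Lp.memLp p))]
      rfl
    rw [h7]
    simp only [ContinuousLinearMap.id_apply, pivotCLM_apply] at h4
    linarith
  have hae : ∀ᵐ t ∂volume.restrict (Icc a b), pivotCLM ι (ι (u t)) = y t := by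
    let R := (InnerProductSpace.toDual ℝ V).symm
    have hRm : MemLp (fun t => R (D t)) 2 (volume.restrict (Icc a b)) :=
      hDm.of_le (R.continuous.comp_aestronglyMeasurable hDm.1)
        (Eventually.of_forall fun t => by simp)
    have h3 := hkey (hRm.toLp _)
    have h4 : ∫ t, D t ((hRm.toLp _ : Lp V 2 (volume.restrict (Icc a b))) t)
        ∂volume.restrict (Icc a b) = ∫ t, ‖D t‖ ^ 2 ∂volume.restrict (Icc a b) := by
      refine integral_congr_ae ?_
      filter_upwards [hRm.coeFn_toLp] with t ht
      rw [ht]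
      have : D t (R (D t)) = inner ℝ (R (D t)) (R (D t)) :=
        (InnerProductSpace.toDual_symm_apply (𝕜 := ℝ)).symm
      rw [this, real_inner_self_eq_norm_sq, LinearIsometryEquiv.norm_map]
    rw [h4, integral_eq_zero_iff_of_nonneg (fun t => by positivity)
      (memLp_two_norm_sq_integrable hDm)] at h3
    filter_upwards [h3] with t ht
    have : D t = 0 := by simpa using ht
    exact sub_eq_zero.mp this
  obtain ⟨w, hw, -⟩ := exists_isEvol_energy hι hd hab hum h₁' h₂ hae
  exact ⟨w, u, hw⟩

end Lions

section Evolution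

open Filter Topology

variable {V H : Type*} [NormedAddCommGroup V] [InnerProductSpace ℝ V] [CompleteSpace V]
  [NormedAddCommGroup H] [InnerProductSpace ℝ H] [CompleteSpace H]

theorem IsEvol.sub {ι : V →L[ℝ] H} {a b : ℝ} {x x' : H} {k₁ k₁' : ℝ → StrongDual ℝ V}
    {k₂ k₂' : ℝ → H} {w w' : ℝ → H} {u u' : ℝ → V} (h : IsEvol ι a b x k₁ k₂ w u)
    (h' : IsEvol ι a b x' k₁' k₂' w' u') :
    IsEvol ι a b (x - x') (fun s => k₁ s - k₁' s) (fun s => k₂ s - k₂' s) (fun s => w s - w' s)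
      (fun s => u s - u' s) where
  cont := h.cont.sub h'.cont
  memV := h.memV.sub h'.memV
  mem1 := h.mem1.sub h'.mem1
  int2 := h.int2.sub h'.int2
  ae_eq := by
    filter_upwards [h.ae_eq, h'.ae_eq] with t ht ht'
    rw [map_sub, ht, ht']
  eq t ht := by
    have e : (fun s => k₁ s - k₁' s + pivotCLM ι (k₂ s - k₂' s)) =
        fun s => (k₁ s + pivotCLM ι (k₂ s)) - (k₁' s + pivotCLM ι (k₂' s)) := by
      funext s; rw [map_sub]; abel
    rw [e, intervalIntegral.integral_sub
      (intervalIntegrable_of_mem (integrable_forcing ι h.mem1 h.int2) ht)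
      (intervalIntegrable_of_mem (integrable_forcing ι h'.mem1 h'.int2) ht), map_sub, map_sub,
      h.eq t ht, h'.eq t ht]
    abel

theorem IsEvol.congr {ι : V →L[ℝ] H} {a b : ℝ} {x : H} {k₁ k₁' : ℝ → StrongDual ℝ V}
    {k₂ k₂' : ℝ → H} {w w' : ℝ → H} {u u' : ℝ → V} (h : IsEvol ι a b x k₁ k₂ w u)
    (h₁ : k₁ =ᵐ[volume.restrict (Icc a b)] k₁') (h₂ : k₂ =ᵐ[volume.restrict (Icc a b)] k₂')
    (hw : EqOn w w' (Icc a b)) (hu : u =ᵐ[volume.restrict (Icc a b)] u') :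
    IsEvol ι a b x k₁' k₂' w' u' where
  cont := h.cont.congr hw.symm
  memV := (memLp_congr_ae hu).1 h.memV
  mem1 := (memLp_congr_ae h₁).1 h.mem1
  int2 := h.int2.congr h₂
  ae_eq := by
    filter_upwards [h.ae_eq, hu, ae_restrict_mem measurableSet_Icc] with t ht ht' htm
    rw [← ht', ht, hw htm]
  eq t ht := by
    rw [← hw ht, h.eq t ht]
    congr 1
    refine intervalIntegral_congr_ae_of_mem ht ?_
    filter_upwards [h₁, h₂] with s h3 h4
    rw [h3, h4]

theorem IsEvol.mono {ι : V →L[ℝ] H} {a b c : ℝ} {x : H} {k₁ : ℝ → StrongDual ℝ V}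
    {k₂ : ℝ → H} {w : ℝ → H} {u : ℝ → V} (h : IsEvol ι a b x k₁ k₂ w u) (hc : c ≤ b) :
    IsEvol ι a c x k₁ k₂ w u := by
  have hs : Icc a c ⊆ Icc a b := Icc_subset_Icc_right hc
  have hm : volume.restrict (Icc a c) ≤ volume.restrict (Icc a b) :=
    Measure.restrict_mono hs le_rfl
  exact ⟨h.cont.mono hs, h.memV.mono_measure hm, h.mem1.mono_measure hm, h.int2.mono_measure hm,
    ae_restrict_of_ae_restrict_of_subset hs h.ae_eq, fun t ht => h.eq t (hs ht)⟩

/-- The solution map of the linear problem is bounded. -/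
theorem IsEvol.linear_le {ι : V →L[ℝ] H} (hι : Function.Injective ι) (hd : DenseRange ι)
    {a b θ : ℝ} (hab : a ≤ b) {𝒜 : ℝ → V →L[ℝ] StrongDual ℝ V} (hθ : 0 < θ)
    (hco : ∀ t ∈ Icc a b, ∀ v, θ * ‖v‖ ^ 2 ≤ 𝒜 t v v) {x : H} {k₁ : ℝ → StrongDual ℝ V}
    {k₂ : ℝ → H} {w : ℝ → H} {u : ℝ → V} (h₁ : MemLp k₁ 2 (volume.restrict (Icc a b)))
    (h : IsEvol ι a b x (fun s => k₁ s - 𝒜 s (u s)) k₂ w u) {R : ℝ}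
    (hR : ‖x‖ + (eLpNorm k₁ 2 (volume.restrict (Icc a b))).toReal + ∫ s in Icc a b, ‖k₂ s‖ ≤ R) :
    (∀ t ∈ Icc a b, ‖w t‖ ≤ 2 / min 1 (2 * θ) * R) ∧
      (eLpNorm u 2 (volume.restrict (Icc a b))).toReal ≤ 2 / min 1 (2 * θ) * R := by
  obtain ⟨τ, hτ, hmax⟩ := isCompact_Icc.exists_isMaxOn (nonempty_Icc.mpr hab) h.cont.norm
  have hS : ∀ t ∈ Icc a b, ‖w t‖ ≤ ‖w τ‖ := fun t ht => hmax ht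
  set S := ‖w τ‖
  set Y := (eLpNorm u 2 (volume.restrict (Icc a b))).toReal with hY
  set X₁ := (eLpNorm k₁ 2 (volume.restrict (Icc a b))).toReal with hX₁
  set X₂ := ∫ s in Icc a b, ‖k₂ s‖ with hX₂
  have hX₁0 : 0 ≤ X₁ := ENNReal.toReal_nonneg
  have hX₂0 : 0 ≤ X₂ := integral_nonneg fun _ => norm_nonneg _
  have hY0 : 0 ≤ Y := ENNReal.toReal_nonneg
  have hS0 : 0 ≤ S := norm_nonneg _
  have hxS : ‖x‖ ≤ S := by
    have h0 := h.energy hι hd (t := a) ⟨le_rfl, hab⟩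
    rw [intervalIntegral.integral_same, mul_zero, add_zero] at h0
    rw [← (sq_eq_sq₀ (norm_nonneg _) (norm_nonneg _)).mp h0]
    exact hS a ⟨le_rfl, hab⟩
  have hg₁ : Integrable (fun s => ‖k₁ s‖ * ‖u s‖ + ‖k₂ s‖ * S) (volume.restrict (Icc a b)) :=
    (integrable_norm_mul h₁ h.memV).add (h.int2.norm.mul_const S)
  have hg₂ : Integrable (fun s => θ * ‖u s‖ ^ 2) (volume.restrict (Icc a b)) :=
    (memLp_two_norm_sq_integrable h.memV).const_mul θ
  have hwm : AEStronglyMeasurable w (volume.restrict (Icc a b)) :=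
    h.cont.aestronglyMeasurable measurableSet_Icc
  have hi : Integrable (fun s => (k₁ s - 𝒜 s (u s)) (u s) + inner ℝ (k₂ s) (w s))
      (volume.restrict (Icc a b)) := by
    refine (integrable_apply h.mem1 h.memV).add ?_
    refine Integrable.mono' (h.int2.norm.mul_const S) (h.int2.1.inner hwm) ?_
    filter_upwards [ae_restrict_mem measurableSet_Icc] with t ht
    exact (norm_inner_le_norm _ _).trans (by gcongr; exact hS t ht)
  have hen : ∀ t ∈ Icc a b, ‖w t‖ ^ 2 ≤
      ‖x‖ ^ 2 + 2 * (X₁ * Y + X₂ * S) - 2 * ∫ s in a..t, θ * ‖u s‖ ^ 2 := by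
    intro t ht
    rw [h.energy hι hd ht]
    have h3 : ∫ s in a..t, ((k₁ s - 𝒜 s (u s)) (u s) + inner ℝ (k₂ s) (w s)) ≤
        ∫ s in a..t, ((‖k₁ s‖ * ‖u s‖ + ‖k₂ s‖ * S) - θ * ‖u s‖ ^ 2) := by
      refine intervalIntegral_mono_ae ht hi (hg₁.sub hg₂) ?_
      filter_upwards [ae_restrict_mem measurableSet_Icc] with s hs
      have h4 : inner ℝ (k₂ s) (w s) ≤ ‖k₂ s‖ * S :=
        (real_inner_le_norm _ _).trans (by gcongr; exact hS s hs)
      have h5 : k₁ s (u s) ≤ ‖k₁ s‖ * ‖u s‖ := (le_abs_self _).trans ((k₁ s).le_opNorm _)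
      have h6 := hco s hs (u s)
      rw [sub_apply]
      linarith
    rw [intervalIntegral.integral_sub (intervalIntegrable_of_mem hg₁ ht)
      (intervalIntegrable_of_mem hg₂ ht)] at h3
    have h4 : ∫ s in a..t, (‖k₁ s‖ * ‖u s‖ + ‖k₂ s‖ * S) ≤ X₁ * Y + X₂ * S := by
      refine (intervalIntegral_le_of_nonneg ht hg₁ fun s => by positivity).trans ?_
      rw [integral_add (integrable_norm_mul h₁ h.memV) (h.int2.norm.mul_const S),
        integral_mul_const]
      gcongr
      exact integral_norm_mul_le h₁ h.memV
    linarith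
  have hSS : S ^ 2 ≤ ‖x‖ ^ 2 + 2 * (X₁ * Y + X₂ * S) := by
    have h3 := hen τ hτ
    have h4 : 0 ≤ ∫ s in a..τ, θ * ‖u s‖ ^ 2 :=
      intervalIntegral.integral_nonneg hτ.1 fun s _ => by positivity
    linarith
  have hYY : 2 * θ * Y ^ 2 ≤ ‖x‖ ^ 2 + 2 * (X₁ * Y + X₂ * S) := by
    have h3 := hen b ⟨hab, le_rfl⟩
    rw [intervalIntegral.integral_of_le hab, ← integral_Icc_eq_integral_Ioc, integral_const_mul,
      ← toReal_eLpNorm_two_sq h.memV] at h3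
    nlinarith [sq_nonneg ‖w b‖]
  set c := min 1 (2 * θ) with hc
  have hc0 : 0 < c := lt_min one_pos (by positivity)
  have hmain : c * max S Y ≤ 2 * R := by
    set N := max S Y with hN
    have hSN : S ≤ N := le_max_left _ _
    have hYN : Y ≤ N := le_max_right _ _
    have hN0 : 0 ≤ N := hS0.trans hSN
    have h3 : c * N ^ 2 ≤ ‖x‖ ^ 2 + 2 * (X₁ * Y + X₂ * S) := by
      rcases max_choice S Y with h4 | h4
      · rw [hN, h4]
        have : c * S ^ 2 ≤ 1 * S ^ 2 := by gcongr; exact min_le_left _ _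
        linarith
      · rw [hN, h4]
        have : c * Y ^ 2 ≤ 2 * θ * Y ^ 2 := by gcongr; exact min_le_right _ _
        linarith
    have h5 : c * N ^ 2 ≤ ‖x‖ * N + 2 * (X₁ * N + X₂ * N) := by
      refine h3.trans ?_
      rw [pow_two ‖x‖]
      gcongr
      exact hxS.trans hSN
    rcases hN0.eq_or_lt with h6 | h6
    · rw [← h6, mul_zero]; linarith [norm_nonneg x]
    · have h7 : c * N ≤ ‖x‖ + 2 * (X₁ + X₂) := by
        refine le_of_mul_le_mul_right ?_ h6
        linarith
      linarith [norm_nonneg x]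
  have hfin : max S Y ≤ 2 / c * R := by
    rw [div_mul_eq_mul_div, le_div_iff₀ hc0]; linarith
  exact ⟨fun t ht => (hS t ht).trans ((le_max_left _ _).trans hfin), (le_max_right _ _).trans hfin⟩

theorem memLp_two_add_measure {E : Type*} [NormedAddCommGroup E] {f : ℝ → E} {μ ν : Measure ℝ}
    (hμ : MemLp f 2 μ) (hν : MemLp f 2 ν) : MemLp f 2 (μ + ν) := by
  have hm : AEStronglyMeasurable f (μ + ν) := hμ.1.add_measure hν.1
  rw [← memLp_norm_iff hm, memLp_two_iff_integrable_sq_norm hm.norm]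
  simp only [norm_norm]
  exact (memLp_two_norm_sq_integrable hμ).add_measure (memLp_two_norm_sq_integrable hν)

/-- Concatenation of solutions of `w' = K₁(t, u) + K₂(t, u)`. -/
theorem IsEvol.exists_glue {ι : V →L[ℝ] H} (hι : Function.Injective ι) (hd : DenseRange ι)
    {a b c : ℝ} (hab : a ≤ b) (hbc : b ≤ c) {x : H} {K₁ : ℝ → V → StrongDual ℝ V}
    {K₂ : ℝ → V → H} {w w' : ℝ → H} {u u' : ℝ → V}
    (h : IsEvol ι a b x (fun s => K₁ s (u s)) (fun s => K₂ s (u s)) w u)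
    (h' : IsEvol ι b c (w b) (fun s => K₁ s (u' s)) (fun s => K₂ s (u' s)) w' u') :
    ∃ w'' u'', IsEvol ι a c x (fun s => K₁ s (u'' s)) (fun s => K₂ s (u'' s)) w'' u'' := by
  classical
  set u'' : ℝ → V := (Iic b).piecewise u u' with hu''
  have hun : Icc a c = Icc a b ∪ Ioc b c := (Icc_union_Ioc_eq_Icc hab hbc).symm
  have hdis : Disjoint (Icc a b) (Ioc b c) := by
    rw [Set.disjoint_left]; intro t ht ht'; exact absurd ht.2 (not_le.mpr ht'.1)
  have hIoc : Ioc b c ⊆ Icc b c := Ioc_subset_Icc_self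
  have e1 : ∀ s ∈ Icc a b, u'' s = u s := fun s hs => piecewise_eq_of_mem _ _ _ hs.2
  have e2 : ∀ s ∈ Ioc b c, u'' s = u' s := fun s hs =>
    piecewise_eq_of_notMem _ _ _ (not_le.mpr hs.1)
  have a1 : ∀ᵐ s ∂volume.restrict (Icc a b), u s = u'' s := by
    filter_upwards [ae_restrict_mem measurableSet_Icc] with s hs using (e1 s hs).symm
  have a2 : ∀ᵐ s ∂volume.restrict (Ioc b c), u' s = u'' s := by
    filter_upwards [ae_restrict_mem measurableSet_Ioc] with s hs using (e2 s hs).symm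
  have hmu : volume.restrict (Icc a c) =
      volume.restrict (Icc a b) + volume.restrict (Ioc b c) := by
    rw [hun, Measure.restrict_union hdis measurableSet_Ioc]
  have hle : volume.restrict (Ioc b c) ≤ volume.restrict (Icc b c) :=
    Measure.restrict_mono hIoc le_rfl
  have hu : MemLp u'' 2 (volume.restrict (Icc a c)) := by
    rw [hmu]
    exact memLp_two_add_measure ((memLp_congr_ae a1).1 h.memV)
      ((memLp_congr_ae a2).1 (h'.memV.mono_measure hle))
  have h₁ : MemLp (fun s => K₁ s (u'' s)) 2 (volume.restrict (Icc a c)) := by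
    rw [hmu]
    refine memLp_two_add_measure ((memLp_congr_ae ?_).1 h.mem1)
      ((memLp_congr_ae ?_).1 (h'.mem1.mono_measure hle))
    · filter_upwards [a1] with s hs; rw [hs]
    · filter_upwards [a2] with s hs; rw [hs]
  have h₂ : Integrable (fun s => K₂ s (u'' s)) (volume.restrict (Icc a c)) := by
    rw [hmu]
    refine Integrable.add_measure (h.int2.congr ?_) ((h'.int2.mono_measure hle).congr ?_)
    · filter_upwards [a1] with s hs; rw [hs]
    · filter_upwards [a2] with s hs; rw [hs]
  have hf := integrable_forcing ι h₁ h₂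
  have i1 : ∀ t ∈ Icc a b, ∫ s in a..t, (K₁ s (u s) + pivotCLM ι (K₂ s (u s))) =
      ∫ s in a..t, (K₁ s (u'' s) + pivotCLM ι (K₂ s (u'' s))) := by
    intro t ht
    refine intervalIntegral_congr_ae_of_mem ht ?_
    filter_upwards [a1] with s hs; rw [hs]
  have hae : ∀ᵐ t ∂volume.restrict (Icc a c), pivotCLM ι (ι (u'' t)) =
      pivotCLM ι x + ∫ s in a..t, (K₁ s (u'' s) + pivotCLM ι (K₂ s (u'' s))) := by
    rw [hmu, ae_add_measure_iff]
    constructor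
    · filter_upwards [h.ae_eq, a1, ae_restrict_mem measurableSet_Icc] with t ht ht' htm
      rw [← ht', ht, h.eq t htm, i1 t htm]
    · filter_upwards [ae_mono hle h'.ae_eq, a2, ae_restrict_mem measurableSet_Ioc]
        with t ht ht' htm
      have hb : b ∈ Icc a b := ⟨hab, le_rfl⟩
      rw [← ht', ht, h'.eq t (hIoc htm), h.eq b hb, i1 b hb, add_assoc]
      have h3 : ∫ s in b..t, (K₁ s (u' s) + pivotCLM ι (K₂ s (u' s))) =
          ∫ s in b..t, (K₁ s (u'' s) + pivotCLM ι (K₂ s (u'' s))) := by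
        rw [intervalIntegral.integral_of_le htm.1.le, intervalIntegral.integral_of_le htm.1.le]
        refine setIntegral_congr_fun measurableSet_Ioc fun s hs => ?_
        rw [e2 s ⟨hs.1, hs.2.trans htm.2⟩]
      have h0 := intervalIntegrable_of_mem hf (t := c) ⟨hab.trans hbc, le_rfl⟩
      have hac : uIcc a c = Icc a c := uIcc_of_le (hab.trans hbc)
      rw [h3, intervalIntegral.integral_add_adjacent_intervals
        (intervalIntegrable_of_mem hf ⟨hab, hbc⟩)
        (intervalIntegrable_sub_interval h0 (hac ▸ ⟨hab, hbc⟩)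
          (hac ▸ ⟨hab.trans htm.1.le, htm.2⟩))]
  obtain ⟨w'', hw'', -⟩ := exists_isEvol_energy hι hd (hab.trans hbc) hu h₁ h₂ hae
  exact ⟨w'', u'', hw''⟩

end Evolution

/-! ### Local existence by contraction -/

section L2

variable {α E F G : Type*} [NormedAddCommGroup E] [NormedAddCommGroup F] [NormedAddCommGroup G]
  {m : MeasurableSpace α} {μ : Measure α}

theorem memLp_two_fun_add {f g : α → E} (hf : MemLp f 2 μ) (hg : MemLp g 2 μ) :
    MemLp (fun t => f t + g t) 2 μ :=
  hf.add hg

theorem toReal_eLpNorm_two_le_of_norm_le_add {f : α → E} {g : α → F} {h : α → G}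
    (hf : MemLp f 2 μ) (hg : MemLp g 2 μ) (hh : ∀ᵐ t ∂μ, ‖h t‖ ≤ ‖f t‖ + ‖g t‖) :
    (eLpNorm h 2 μ).toReal ≤ (eLpNorm f 2 μ).toReal + (eLpNorm g 2 μ).toReal := by
  rw [← ENNReal.toReal_add hf.2.ne hg.2.ne]
  refine ENNReal.toReal_mono (ENNReal.add_ne_top.mpr ⟨hf.2.ne, hg.2.ne⟩) ?_
  have h1 : eLpNorm h 2 μ ≤ eLpNorm ((fun t => ‖f t‖) + fun t => ‖g t‖) 2 μ :=
    eLpNorm_mono_ae_real hh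
  refine h1.trans ((eLpNorm_add_le hf.1.norm hg.1.norm (by norm_num)).trans ?_)
  rw [eLpNorm_norm, eLpNorm_norm]

theorem toReal_eLpNorm_two_const_mul {f : α → ℝ} {c : ℝ} (hc : 0 ≤ c) :
    (eLpNorm (fun t => c * f t) 2 μ).toReal = c * (eLpNorm f 2 μ).toReal := by
  have : (fun t => c * f t) = c • f := rfl
  rw [this, eLpNorm_const_smul, ENNReal.toReal_mul, toReal_enorm, Real.norm_of_nonneg hc]

theorem memLp_one_add_norm_add_norm [IsFiniteMeasure μ] {f : α → E} {g : α → F}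
    (hf : MemLp f 2 μ) (hg : MemLp g 2 μ) : MemLp (fun t => 1 + ‖f t‖ + ‖g t‖) 2 μ :=
  ((memLp_const (1 : ℝ)).add hf.norm : MemLp (fun t => 1 + ‖f t‖) 2 μ).add hg.norm

theorem toReal_eLpNorm_two_one_add_le [IsFiniteMeasure μ] {f : α → E} {g : α → F}
    (hf : MemLp f 2 μ) (hg : MemLp g 2 μ) :
    (eLpNorm (fun t => 1 + ‖f t‖ + ‖g t‖) 2 μ).toReal ≤
      (eLpNorm (fun _ : α => (1 : ℝ)) 2 μ).toReal + (eLpNorm f 2 μ).toReal +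
        (eLpNorm g 2 μ).toReal := by
  have h1 : MemLp (fun _ : α => (1 : ℝ)) 2 μ := memLp_const 1
  have h2 : (eLpNorm (fun t => 1 + ‖f t‖) 2 μ).toReal ≤ _ :=
    toReal_eLpNorm_two_le_of_norm_le_add h1 hf (Filter.Eventually.of_forall fun t => by
      rw [norm_one, Real.norm_of_nonneg (by positivity)])
  have h3 : (eLpNorm (fun t => 1 + ‖f t‖ + ‖g t‖) 2 μ).toReal ≤ _ :=
    toReal_eLpNorm_two_le_of_norm_le_add (h1.add hf.norm) hg
      (Filter.Eventually.of_forall fun t => by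
        rw [Pi.add_apply, Real.norm_of_nonneg (by positivity), Real.norm_of_nonneg (by positivity)])
  exact h3.trans (by gcongr; exact h2)

/-- The `L²` bounds behind the local Lipschitz estimates of the nonlinearities. -/
theorem toReal_eLpNorm_two_lipschitz_le [IsFiniteMeasure μ] {f : α → E} {g : α → F} {k : α → G}
    {c d : ℝ} (hc : 0 ≤ c) (hd : 0 ≤ d) (hf : MemLp f 2 μ) (hg : MemLp g 2 μ) (hk : MemLp k 2 μ) :
    MemLp (fun t => c * ‖f t‖ + d * (1 + ‖g t‖ + ‖k t‖)) 2 μ ∧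
    (eLpNorm (fun t => c * ‖f t‖ + d * (1 + ‖g t‖ + ‖k t‖)) 2 μ).toReal ≤
      c * (eLpNorm f 2 μ).toReal + d * ((eLpNorm (fun _ : α => (1 : ℝ)) 2 μ).toReal +
        (eLpNorm g 2 μ).toReal + (eLpNorm k 2 μ).toReal) := by
  have h1 : MemLp (fun t => c * ‖f t‖) 2 μ := hf.norm.const_mul c
  have h2 : MemLp (fun t => d * (1 + ‖g t‖ + ‖k t‖)) 2 μ :=
    (memLp_one_add_norm_add_norm hg hk).const_mul d
  refine ⟨h1.add h2, ?_⟩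
  refine (toReal_eLpNorm_two_le_of_norm_le_add h1 h2
    (Filter.Eventually.of_forall fun t => norm_add_le _ _)).trans ?_
  rw [toReal_eLpNorm_two_const_mul hc, toReal_eLpNorm_two_const_mul hd, eLpNorm_norm]
  gcongr
  exact toReal_eLpNorm_two_one_add_le hg hk

theorem toReal_eLpNorm_two_const [IsFiniteMeasure μ] (v : E) :
    (eLpNorm (fun _ : α => v) 2 μ).toReal =
      ‖v‖ * (eLpNorm (fun _ : α => (1 : ℝ)) 2 μ).toReal := by
  rw [← eLpNorm_norm (fun _ : α => v), ← toReal_eLpNorm_two_const_mul (norm_nonneg v)]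
  simp

end L2

section Contraction

open Filter Topology

variable {V H : Type*} [NormedAddCommGroup V] [InnerProductSpace ℝ V] [CompleteSpace V]
  [NormedAddCommGroup H] [InnerProductSpace ℝ H] [CompleteSpace H]

/-- The nonlinearities `K₁`, `K₂` on `[a,b]` in the ball of radius `r` around `v₀`, with respect to
the norm of `H`: linearized by `-𝒜`, they have a small Lipschitz constant `lam` with respect to the
top order norm, up to terms with the weaker norm of `H` in one factor. -/
structure IsLocallyLipschitz (ι : V →L[ℝ] H) (a b : ℝ) (𝒜 : ℝ → V →L[ℝ] StrongDual ℝ V)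
    (K₁ : ℝ → V → StrongDual ℝ V) (K₂ : ℝ → V → H) (v₀ : V) (lam L r : ℝ) (κ : ℝ → ℝ) : Prop where
  meas1 : ∀ u : ℝ → V, AEStronglyMeasurable u (volume.restrict (Icc a b)) →
    AEStronglyMeasurable (fun t => K₁ t (u t)) (volume.restrict (Icc a b))
  meas2 : ∀ u : ℝ → V, AEStronglyMeasurable u (volume.restrict (Icc a b)) →
    AEStronglyMeasurable (fun t => K₂ t (u t)) (volume.restrict (Icc a b))
  mem1 : MemLp (fun t => K₁ t v₀) 2 (volume.restrict (Icc a b))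
  int2 : Integrable (fun t => K₂ t v₀) (volume.restrict (Icc a b))
  memκ : MemLp κ 2 (volume.restrict (Icc a b))
  κ_nonneg : ∀ t, 0 ≤ κ t
  lam_nonneg : 0 ≤ lam
  L_nonneg : 0 ≤ L
  r_nonneg : 0 ≤ r
  lip1 : ∀ t ∈ Icc a b, ∀ u v, ‖ι u - ι v₀‖ ≤ r → ‖ι v - ι v₀‖ ≤ r →
    ‖𝒜 t (u - v) + (K₁ t u - K₁ t v)‖ ≤ lam * ‖u - v‖ + L * ‖ι (u - v)‖ * (1 + ‖u‖ + ‖v‖)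
  lip2 : ∀ t ∈ Icc a b, ∀ u v, ‖ι u - ι v₀‖ ≤ r → ‖ι v - ι v₀‖ ≤ r →
    ‖K₂ t u - K₂ t v‖ ≤ κ t * (‖u - v‖ + ‖ι (u - v)‖ * (1 + ‖u‖ + ‖v‖))

theorem IsLocallyLipschitz.memLp_diff {ι : V →L[ℝ] H} {a b C lam L r : ℝ}
    {𝒜 : ℝ → V →L[ℝ] StrongDual ℝ V} {K₁ : ℝ → V → StrongDual ℝ V} {K₂ : ℝ → V → H} {v₀ : V}
    {κ : ℝ → ℝ} (h : IsLocallyLipschitz ι a b 𝒜 K₁ K₂ v₀ lam L r κ) (h𝒜 : IsLinFamily a b C 𝒜)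
    {u v : ℝ → V} (hu : MemLp u 2 (volume.restrict (Icc a b)))
    (hv : MemLp v 2 (volume.restrict (Icc a b)))
    (hur : ∀ᵐ t ∂volume.restrict (Icc a b), ‖ι (u t) - ι v₀‖ ≤ r)
    (hvr : ∀ᵐ t ∂volume.restrict (Icc a b), ‖ι (v t) - ι v₀‖ ≤ r) {D : ℝ}
    (hD : ∀ᵐ t ∂volume.restrict (Icc a b), ‖ι (u t - v t)‖ ≤ D) (hD0 : 0 ≤ D)
    (hD2 : (eLpNorm (fun t => u t - v t) 2 (volume.restrict (Icc a b))).toReal ≤ D)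
    (hu2 : (eLpNorm u 2 (volume.restrict (Icc a b))).toReal ≤ r)
    (hv2 : (eLpNorm v 2 (volume.restrict (Icc a b))).toReal ≤ r) :
    MemLp (fun t => 𝒜 t (u t - v t) + (K₁ t (u t) - K₁ t (v t))) 2 (volume.restrict (Icc a b)) ∧
    Integrable (fun t => K₂ t (u t) - K₂ t (v t)) (volume.restrict (Icc a b)) ∧
    (eLpNorm (fun t => 𝒜 t (u t - v t) + (K₁ t (u t) - K₁ t (v t))) 2
        (volume.restrict (Icc a b))).toReal +
      ∫ t in Icc a b, ‖K₂ t (u t) - K₂ t (v t)‖ ≤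
      (lam + L * ((eLpNorm (fun _ : ℝ => (1 : ℝ)) 2 (volume.restrict (Icc a b))).toReal + 2 * r) +
        (eLpNorm κ 2 (volume.restrict (Icc a b))).toReal *
          (1 + (eLpNorm (fun _ : ℝ => (1 : ℝ)) 2 (volume.restrict (Icc a b))).toReal + 2 * r)) *
        D := by
  have hlam := h.lam_nonneg
  have hL := h.L_nonneg
  set μ := volume.restrict (Icc a b) with hμ
  set σ := (eLpNorm (fun _ : ℝ => (1 : ℝ)) 2 μ).toReal with hσ
  have hσ0 : 0 ≤ σ := ENNReal.toReal_nonneg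
  have hduv : MemLp (fun t => u t - v t) 2 μ := hu.sub hv
  obtain ⟨g1, g2⟩ := toReal_eLpNorm_two_lipschitz_le hlam (mul_nonneg hL hD0) hduv hu hv
  obtain ⟨g3, g4⟩ := toReal_eLpNorm_two_lipschitz_le (zero_le_one' ℝ) hD0 hduv hu hv
  have b1 : ∀ᵐ t ∂μ, ‖𝒜 t (u t - v t) + (K₁ t (u t) - K₁ t (v t))‖ ≤
      lam * ‖u t - v t‖ + L * D * (1 + ‖u t‖ + ‖v t‖) := by
    filter_upwards [hur, hvr, hD, ae_restrict_mem measurableSet_Icc] with t h1 h2 h3 h4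
    exact (h.lip1 t h4 _ _ h1 h2).trans (by gcongr)
  have b2 : ∀ᵐ t ∂μ, ‖K₂ t (u t) - K₂ t (v t)‖ ≤
      ‖κ t‖ * ‖1 * ‖u t - v t‖ + D * (1 + ‖u t‖ + ‖v t‖)‖ := by
    filter_upwards [hur, hvr, hD, ae_restrict_mem measurableSet_Icc] with t h1 h2 h3 h4
    rw [Real.norm_of_nonneg (h.κ_nonneg t), Real.norm_of_nonneg (by positivity), one_mul]
    have := h.κ_nonneg t
    exact (h.lip2 t h4 _ _ h1 h2).trans (by gcongr)
  have m1 : AEStronglyMeasurable (fun t => 𝒜 t (u t - v t) + (K₁ t (u t) - K₁ t (v t))) μ :=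
    (h𝒜.meas _ hduv.1).add ((h.meas1 u hu.1).sub (h.meas1 v hv.1))
  have m2 : AEStronglyMeasurable (fun t => K₂ t (u t) - K₂ t (v t)) μ :=
    (h.meas2 u hu.1).sub (h.meas2 v hv.1)
  have i2 : Integrable (fun t => K₂ t (u t) - K₂ t (v t)) μ :=
    Integrable.mono' (integrable_norm_mul h.memκ g3) m2 b2
  refine ⟨MemLp.of_le g1 m1 (b1.mono fun t ht => ht.trans (le_abs_self _)), i2, ?_⟩
  have e1 : (eLpNorm (fun t => 𝒜 t (u t - v t) + (K₁ t (u t) - K₁ t (v t))) 2 μ).toReal ≤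
      lam * D + L * D * (σ + r + r) := by
    refine (ENNReal.toReal_mono g1.2.ne (eLpNorm_mono_ae_real b1)).trans (g2.trans ?_)
    gcongr
  have e2 : ∫ t, ‖K₂ t (u t) - K₂ t (v t)‖ ∂μ ≤
      (eLpNorm κ 2 μ).toReal * (1 * D + D * (σ + r + r)) := by
    refine (integral_mono_ae i2.norm (integrable_norm_mul h.memκ g3) b2).trans ?_
    refine (integral_norm_mul_le h.memκ g3).trans ?_
    gcongr
    refine g4.trans ?_
    gcongr
  refine (add_le_add e1 e2).trans (le_of_eq ?_)
  ring

/-- The pairs of a continuous `H`-valued function and an `L²(a,b;V)` class that agree almost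
everywhere form a closed set. -/
theorem isClosed_compat (ι : V →L[ℝ] H) (a b : ℝ) :
    IsClosed {y : C(Icc a b, H) × Lp V 2 (volume.restrict (Icc a b)) |
      ∀ᵐ t ∂volume.restrict (Icc a b), ∀ ht : t ∈ Icc a b, ι (y.2 t) = y.1 ⟨t, ht⟩} := by
  refine IsSeqClosed.isClosed fun y z hy hyz => ?_
  have h1 : Tendsto (fun n => (y n).1) atTop (𝓝 z.1) := (continuous_fst.tendsto z).comp hyz
  have h2 : Tendsto (fun n => (y n).2) atTop (𝓝 z.2) := (continuous_snd.tendsto z).comp hyz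
  have h3 : TendstoInMeasure (volume.restrict (Icc a b)) (fun n => ((y n).2 : ℝ → V)) atTop z.2 :=
    tendstoInMeasure_of_tendsto_Lp h2
  obtain ⟨ns, hns, h4⟩ := h3.exists_seq_tendsto_ae
  have h5 : ∀ᵐ t ∂volume.restrict (Icc a b), ∀ n, ∀ ht : t ∈ Icc a b,
      ι ((y n).2 t) = (y n).1 ⟨t, ht⟩ := ae_all_iff.mpr hy
  filter_upwards [h4, h5] with t ht4 ht5 ht
  refine tendsto_nhds_unique ((ι.continuous.tendsto _).comp ht4) ?_
  have h6 : Tendsto (fun n => (y (ns n)).1 ⟨t, ht⟩) atTop (𝓝 (z.1 ⟨t, ht⟩)) :=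
    ((continuous_eval_const (⟨t, ht⟩ : Icc a b)).tendsto z.1).comp
      (h1.comp hns.tendsto_atTop)
  exact h6.congr fun n => (ht5 (ns n) ht).symm

/-- Any `u` in the ball of radius `r` around `(ι v₀, 0)` is compared with the constant `v₀`. -/
theorem IsLocallyLipschitz.memLp_diff_const {ι : V →L[ℝ] H} {a b C lam L r σ : ℝ}
    {𝒜 : ℝ → V →L[ℝ] StrongDual ℝ V} {K₁ : ℝ → V → StrongDual ℝ V} {K₂ : ℝ → V → H} {v₀ : V}
    {κ : ℝ → ℝ} (h : IsLocallyLipschitz ι a b 𝒜 K₁ K₂ v₀ lam L r κ) (h𝒜 : IsLinFamily a b C 𝒜)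
    (hσ : (eLpNorm (fun _ : ℝ => (1 : ℝ)) 2 (volume.restrict (Icc a b))).toReal = σ)
    (hvr : ‖v₀‖ * σ ≤ r) {u : ℝ → V} (hu : MemLp u 2 (volume.restrict (Icc a b)))
    (hur : ∀ᵐ t ∂volume.restrict (Icc a b), ‖ι (u t) - ι v₀‖ ≤ r)
    (hu2 : (eLpNorm u 2 (volume.restrict (Icc a b))).toReal ≤ r) :
    MemLp (fun t => 𝒜 t (u t - v₀) + (K₁ t (u t) - K₁ t v₀)) 2 (volume.restrict (Icc a b)) ∧
    Integrable (fun t => K₂ t (u t) - K₂ t v₀) (volume.restrict (Icc a b)) ∧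
    (eLpNorm (fun t => 𝒜 t (u t - v₀) + (K₁ t (u t) - K₁ t v₀)) 2
        (volume.restrict (Icc a b))).toReal + ∫ t in Icc a b, ‖K₂ t (u t) - K₂ t v₀‖ ≤
      (lam + L * (σ + 2 * r) + (eLpNorm κ 2 (volume.restrict (Icc a b))).toReal *
        (1 + σ + 2 * r)) * (r + ‖v₀‖ * σ) := by
  have hσ0 : 0 ≤ σ := hσ ▸ ENNReal.toReal_nonneg
  have hvσ : 0 ≤ ‖v₀‖ * σ := by positivity
  have hr := h.r_nonneg
  have hmemv : MemLp (fun _ : ℝ => v₀) 2 (volume.restrict (Icc a b)) := memLp_const v₀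
  have hv2 : (eLpNorm (fun _ : ℝ => v₀) 2 (volume.restrict (Icc a b))).toReal = ‖v₀‖ * σ := by
    rw [toReal_eLpNorm_two_const, hσ]
  have h1 := h.memLp_diff h𝒜 (D := r + ‖v₀‖ * σ) hu hmemv hur
    (Eventually.of_forall fun t => by simpa using hr)
    (hur.mono fun t ht => by rw [map_sub]; linarith) (by positivity)
    ((toReal_eLpNorm_two_le_of_norm_le_add hu hmemv
      (Eventually.of_forall fun t => norm_sub_le _ _)).trans (by rw [hv2]; gcongr)) hu2
    (hv2.trans_le hvr)
  rwa [hσ] at h1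

theorem IsLocallyLipschitz.memLp_linearized {ι : V →L[ℝ] H} {a b C lam L r σ : ℝ}
    {𝒜 : ℝ → V →L[ℝ] StrongDual ℝ V} {K₁ : ℝ → V → StrongDual ℝ V} {K₂ : ℝ → V → H} {v₀ : V}
    {κ : ℝ → ℝ} (h : IsLocallyLipschitz ι a b 𝒜 K₁ K₂ v₀ lam L r κ) (h𝒜 : IsLinFamily a b C 𝒜)
    (hσ : (eLpNorm (fun _ : ℝ => (1 : ℝ)) 2 (volume.restrict (Icc a b))).toReal = σ)
    (hvr : ‖v₀‖ * σ ≤ r) {u : ℝ → V} (hu : MemLp u 2 (volume.restrict (Icc a b)))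
    (hur : ∀ᵐ t ∂volume.restrict (Icc a b), ‖ι (u t) - ι v₀‖ ≤ r)
    (hu2 : (eLpNorm u 2 (volume.restrict (Icc a b))).toReal ≤ r) :
    MemLp (fun t => 𝒜 t (u t) + K₁ t (u t)) 2 (volume.restrict (Icc a b)) ∧
    Integrable (fun t => K₂ t (u t)) (volume.restrict (Icc a b)) := by
  obtain ⟨d1, d2, -⟩ := h.memLp_diff_const h𝒜 hσ hvr hu hur hu2
  have h𝒜v : MemLp (fun t => 𝒜 t v₀) 2 (volume.restrict (Icc a b)) := h𝒜.memLp (memLp_const v₀)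
  constructor
  · have e : (fun t => 𝒜 t (u t) + K₁ t (u t)) = fun t => ((𝒜 t (u t - v₀) +
        (K₁ t (u t) - K₁ t v₀)) + 𝒜 t v₀) + K₁ t v₀ := by
      funext t
      rw [map_sub]
      abel
    rw [e]
    exact memLp_two_fun_add (memLp_two_fun_add d1 h𝒜v) h.mem1
  · refine (d2.add h.int2).congr (Eventually.of_forall fun t => ?_)
    simp only [Pi.add_apply, sub_add_cancel]

/-- The fixed point map does not leave the ball of radius `r` around `(ι v₀, 0)`. -/
theorem IsLocallyLipschitz.linear_mem_ball {ι : V →L[ℝ] H} (hι : Function.Injective ι)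
    (hd : DenseRange ι) {a b C θ lam L r σ : ℝ} (hab : a ≤ b) {𝒜 : ℝ → V →L[ℝ] StrongDual ℝ V}
    {K₁ : ℝ → V → StrongDual ℝ V} {K₂ : ℝ → V → H} {v₀ : V} {κ : ℝ → ℝ} {x : H}
    (h : IsLocallyLipschitz ι a b 𝒜 K₁ K₂ v₀ lam L r κ) (h𝒜 : IsLinFamily a b C 𝒜) (hθ : 0 < θ)
    (hco : ∀ t ∈ Icc a b, ∀ v, θ * ‖v‖ ^ 2 ≤ 𝒜 t v v)
    (hσ : (eLpNorm (fun _ : ℝ => (1 : ℝ)) 2 (volume.restrict (Icc a b))).toReal = σ)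
    (hs₁ : 2 / min 1 (2 * θ) * (lam + L * (σ + 2 * r) +
      (eLpNorm κ 2 (volume.restrict (Icc a b))).toReal * (1 + σ + 2 * r)) ≤ 1 / 2)
    (hs₂ : 2 / min 1 (2 * θ) * (‖x - ι v₀‖ +
      (eLpNorm (fun t => K₁ t v₀) 2 (volume.restrict (Icc a b))).toReal +
      ∫ t in Icc a b, ‖K₂ t v₀‖) + 2 * (‖v₀‖ * σ) ≤ r / 2)
    (hvr : ‖v₀‖ * σ ≤ r) {u : ℝ → V} (hu : MemLp u 2 (volume.restrict (Icc a b)))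
    (hur : ∀ᵐ t ∂volume.restrict (Icc a b), ‖ι (u t) - ι v₀‖ ≤ r)
    (hu2 : (eLpNorm u 2 (volume.restrict (Icc a b))).toReal ≤ r) {w : ℝ → H} {z : ℝ → V}
    (hz : IsEvol ι a b x (fun t => (𝒜 t (u t) + K₁ t (u t)) - 𝒜 t (z t)) (fun t => K₂ t (u t))
      w z) :
    (∀ t ∈ Icc a b, ‖w t - ι v₀‖ ≤ r) ∧
      (eLpNorm z 2 (volume.restrict (Icc a b))).toReal ≤ r := by
  have hc0 : 0 < 2 / min 1 (2 * θ) := div_pos two_pos (lt_min one_pos (by positivity))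
  have hσ0 : 0 ≤ σ := hσ ▸ ENNReal.toReal_nonneg
  have hvσ : 0 ≤ ‖v₀‖ * σ := by positivity
  have hr := h.r_nonneg
  have hmemv : MemLp (fun _ : ℝ => v₀) 2 (volume.restrict (Icc a b)) := memLp_const v₀
  have hv2 : (eLpNorm (fun _ : ℝ => v₀) 2 (volume.restrict (Icc a b))).toReal = ‖v₀‖ * σ := by
    rw [toReal_eLpNorm_two_const, hσ]
  obtain ⟨d1, d2, d3⟩ := h.memLp_diff_const h𝒜 hσ hvr hu hur hu2
  have hint2 := hz.int2
  have hconst : IsEvol ι a b (ι v₀) (fun t => 𝒜 t v₀ - 𝒜 t v₀) (fun _ => 0) (fun _ => ι v₀)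
      (fun _ => v₀) :=
    ⟨continuousOn_const, hmemv, by simp only [sub_self]; exact memLp_const (0 : StrongDual ℝ V),
      by simp, by simp, by simp⟩
  have hX : MemLp (fun t => (𝒜 t (u t - v₀) + (K₁ t (u t) - K₁ t v₀)) + K₁ t v₀) 2
    (volume.restrict (Icc a b)) := memLp_two_fun_add d1 h.mem1
  have hd' := (hz.sub hconst).congr (k₁' := fun t => ((𝒜 t (u t - v₀) +
      (K₁ t (u t) - K₁ t v₀)) + K₁ t v₀) - 𝒜 t (z t - v₀))
    (Eventually.of_forall fun t => by simp only [map_sub]; abel) (ae_eq_refl _)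
    (fun t _ => rfl) (ae_eq_refl _)
  obtain ⟨e1, e2⟩ := hd'.linear_le hι hd hab hθ hco hX le_rfl
  have e4 := toReal_eLpNorm_two_le_of_norm_le_add d1 h.mem1
    (Eventually.of_forall fun t => norm_add_le (𝒜 t (u t - v₀) + (K₁ t (u t) - K₁ t v₀))
      (K₁ t v₀))
  have e5 : ∫ t in Icc a b, ‖K₂ t (u t) - 0‖ ≤
      (∫ t in Icc a b, ‖K₂ t (u t) - K₂ t v₀‖) + ∫ t in Icc a b, ‖K₂ t v₀‖ := by
    rw [← integral_add d2.norm h.int2.norm]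
    refine integral_mono (by simpa using hint2.norm) (d2.norm.add h.int2.norm) fun t => ?_
    simp only [sub_zero]
    exact norm_le_norm_sub_add _ _
  set c := 2 / min 1 (2 * θ) with hc
  set S₀ := lam + L * (σ + 2 * r) +
    (eLpNorm κ 2 (volume.restrict (Icc a b))).toReal * (1 + σ + 2 * r) with hS₀
  set Z := ‖x - ι v₀‖ + (eLpNorm (fun t => K₁ t v₀) 2 (volume.restrict (Icc a b))).toReal +
      ∫ t in Icc a b, ‖K₂ t v₀‖ with hZ
  set B := ‖x - ι v₀‖ + (eLpNorm (fun t => (𝒜 t (u t - v₀) + (K₁ t (u t) - K₁ t v₀)) +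
      K₁ t v₀) 2 (volume.restrict (Icc a b))).toReal + ∫ t in Icc a b, ‖K₂ t (u t) - 0‖
  have e3 : B ≤ S₀ * (r + ‖v₀‖ * σ) + Z := by linarith
  have e6 : c * B + ‖v₀‖ * σ ≤ r := by
    have h5 : c * B ≤ c * S₀ * (r + ‖v₀‖ * σ) + c * Z := by
      rw [mul_assoc, ← mul_add]; gcongr
    have h6 : c * S₀ * (r + ‖v₀‖ * σ) ≤ 1 / 2 * (r + ‖v₀‖ * σ) := by gcongr
    linarith
  refine ⟨fun t ht => (e1 t ht).trans (by linarith), ?_⟩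
  refine (toReal_eLpNorm_two_le_of_norm_le_add hd'.memV hmemv
    (Eventually.of_forall fun t => norm_le_norm_sub_add _ _)).trans ?_
  rw [hv2]
  linarith

/-- The frozen iteration is a contraction with the constant `1 / 2`. -/
theorem IsLocallyLipschitz.linear_dist_le {ι : V →L[ℝ] H} (hι : Function.Injective ι)
    (hd : DenseRange ι) {a b C θ lam L r σ : ℝ} (hab : a ≤ b) {𝒜 : ℝ → V →L[ℝ] StrongDual ℝ V}
    {K₁ : ℝ → V → StrongDual ℝ V} {K₂ : ℝ → V → H} {v₀ : V} {κ : ℝ → ℝ} {x : H}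
    (h : IsLocallyLipschitz ι a b 𝒜 K₁ K₂ v₀ lam L r κ) (h𝒜 : IsLinFamily a b C 𝒜) (hθ : 0 < θ)
    (hco : ∀ t ∈ Icc a b, ∀ v, θ * ‖v‖ ^ 2 ≤ 𝒜 t v v)
    (hσ : (eLpNorm (fun _ : ℝ => (1 : ℝ)) 2 (volume.restrict (Icc a b))).toReal = σ)
    (hs₁ : 2 / min 1 (2 * θ) * (lam + L * (σ + 2 * r) +
      (eLpNorm κ 2 (volume.restrict (Icc a b))).toReal * (1 + σ + 2 * r)) ≤ 1 / 2)
    {u u' : ℝ → V} (hu : MemLp u 2 (volume.restrict (Icc a b)))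
    (hu' : MemLp u' 2 (volume.restrict (Icc a b)))
    (hur : ∀ᵐ t ∂volume.restrict (Icc a b), ‖ι (u t) - ι v₀‖ ≤ r)
    (hur' : ∀ᵐ t ∂volume.restrict (Icc a b), ‖ι (u' t) - ι v₀‖ ≤ r)
    (hu2 : (eLpNorm u 2 (volume.restrict (Icc a b))).toReal ≤ r)
    (hu2' : (eLpNorm u' 2 (volume.restrict (Icc a b))).toReal ≤ r) {D : ℝ} (hD0 : 0 ≤ D)
    (hD : ∀ᵐ t ∂volume.restrict (Icc a b), ‖ι (u t - u' t)‖ ≤ D)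
    (hD2 : (eLpNorm (fun t => u t - u' t) 2 (volume.restrict (Icc a b))).toReal ≤ D)
    {w w' : ℝ → H} {z z' : ℝ → V}
    (hz : IsEvol ι a b x (fun t => (𝒜 t (u t) + K₁ t (u t)) - 𝒜 t (z t)) (fun t => K₂ t (u t))
      w z)
    (hz' : IsEvol ι a b x (fun t => (𝒜 t (u' t) + K₁ t (u' t)) - 𝒜 t (z' t))
      (fun t => K₂ t (u' t)) w' z') :
    (∀ t ∈ Icc a b, ‖w t - w' t‖ ≤ 1 / 2 * D) ∧
      (eLpNorm (fun t => z t - z' t) 2 (volume.restrict (Icc a b))).toReal ≤ 1 / 2 * D := by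
  have hc0 : 0 < 2 / min 1 (2 * θ) := div_pos two_pos (lt_min one_pos (by positivity))
  obtain ⟨d1, d2, d3⟩ := h.memLp_diff h𝒜 hu hu' hur hur' hD hD0 hD2 hu2 hu2'
  rw [hσ] at d3
  have hd' := (hz.sub hz').congr (k₁' := fun t => (𝒜 t (u t - u' t) +
      (K₁ t (u t) - K₁ t (u' t))) - 𝒜 t (z t - z' t))
    (Eventually.of_forall fun t => by simp only [map_sub]; abel) (ae_eq_refl _)
    (fun t _ => rfl) (ae_eq_refl _)
  obtain ⟨e1, e2⟩ := hd'.linear_le hι hd hab hθ hco d1 le_rfl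
  rw [sub_self, norm_zero, zero_add] at e1 e2
  set c := 2 / min 1 (2 * θ) with hc
  set S₀ := lam + L * (σ + 2 * r) +
    (eLpNorm κ 2 (volume.restrict (Icc a b))).toReal * (1 + σ + 2 * r) with hS₀
  have e3 : c * ((eLpNorm (fun t => 𝒜 t (u t - u' t) + (K₁ t (u t) - K₁ t (u' t))) 2
      (volume.restrict (Icc a b))).toReal + ∫ t in Icc a b, ‖K₂ t (u t) - K₂ t (u' t)‖) ≤
      1 / 2 * D := by
    calc _ ≤ c * (S₀ * D) := by gcongr
      _ = c * S₀ * D := by ring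
      _ ≤ _ := by gcongr
  exact ⟨fun t ht => (e1 t ht).trans e3, e2.trans e3⟩

/-- Local existence: Banach's fixed point theorem for the map that sends `u` to the solution `z` of
`z' + 𝒜 z = 𝒜 u + K₁(u) + K₂(u)`, on the ball of radius `r` around the pair `(ι v₀, 0)` in
`C([a,b];H) × L²(a,b;V)`. -/
theorem IsLocallyLipschitz.exists_isEvol {ι : V →L[ℝ] H} (hι : Function.Injective ι)
    (hd : DenseRange ι) {a b C θ lam L r σ : ℝ} (hab : a ≤ b) {𝒜 : ℝ → V →L[ℝ] StrongDual ℝ V}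
    {K₁ : ℝ → V → StrongDual ℝ V} {K₂ : ℝ → V → H} {v₀ : V} {κ : ℝ → ℝ} {x : H}
    (h : IsLocallyLipschitz ι a b 𝒜 K₁ K₂ v₀ lam L r κ) (h𝒜 : IsLinFamily a b C 𝒜) (hθ : 0 < θ)
    (hco : ∀ t ∈ Icc a b, ∀ v, θ * ‖v‖ ^ 2 ≤ 𝒜 t v v)
    (hσ : (eLpNorm (fun _ : ℝ => (1 : ℝ)) 2 (volume.restrict (Icc a b))).toReal = σ)
    (hs₁ : 2 / min 1 (2 * θ) * (lam + L * (σ + 2 * r) +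
      (eLpNorm κ 2 (volume.restrict (Icc a b))).toReal * (1 + σ + 2 * r)) ≤ 1 / 2)
    (hs₂ : 2 / min 1 (2 * θ) * (‖x - ι v₀‖ +
      (eLpNorm (fun t => K₁ t v₀) 2 (volume.restrict (Icc a b))).toReal +
      ∫ t in Icc a b, ‖K₂ t v₀‖) + 2 * (‖v₀‖ * σ) ≤ r / 2) :
    ∃ w u, IsEvol ι a b x (fun t => K₁ t (u t)) (fun t => K₂ t (u t)) w u := by
  have hc0 : 0 < 2 / min 1 (2 * θ) := div_pos two_pos (lt_min one_pos (by positivity))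
  have hσ0 : 0 ≤ σ := hσ ▸ ENNReal.toReal_nonneg
  have hr := h.r_nonneg
  have hvr : ‖v₀‖ * σ ≤ r := by
    have hX₁0 : 0 ≤ (eLpNorm (fun t => K₁ t v₀) 2 (volume.restrict (Icc a b))).toReal :=
      ENNReal.toReal_nonneg
    have hX₂0 : 0 ≤ ∫ t in Icc a b, ‖K₂ t v₀‖ := integral_nonneg fun _ => norm_nonneg _
    have hvσ : 0 ≤ ‖v₀‖ * σ := by positivity
    have : 0 ≤ 2 / min 1 (2 * θ) * (‖x - ι v₀‖ + (eLpNorm (fun t => K₁ t v₀) 2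
      (volume.restrict (Icc a b))).toReal + ∫ t in Icc a b, ‖K₂ t v₀‖) := by positivity
    linarith
  have hmemv : MemLp (fun _ : ℝ => v₀) 2 (volume.restrict (Icc a b)) := memLp_const v₀
  let c₀ : C(Icc a b, H) × Lp V 2 (volume.restrict (Icc a b)) := (ContinuousMap.const _ (ι v₀), 0)
  obtain ⟨S, hSdef⟩ : ∃ S : Set (C(Icc a b, H) × Lp V 2 (volume.restrict (Icc a b))), S =
    {y | ∀ᵐ t ∂volume.restrict (Icc a b), ∀ ht : t ∈ Icc a b, ι (y.2 t) = y.1 ⟨t, ht⟩} ∩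
      Metric.closedBall c₀ r := ⟨_, rfl⟩
  have hSc : IsComplete S := by
    rw [hSdef]; exact ((isClosed_compat ι a b).inter Metric.isClosed_closedBall).isComplete
  have hScomp : ∀ y ∈ S, ∀ᵐ t ∂volume.restrict (Icc a b), ∀ ht : t ∈ Icc a b,
      ι (y.2 t) = y.1 ⟨t, ht⟩ := by
    intro y hy; rw [hSdef] at hy; exact hy.1
  have hSball : ∀ y ∈ S, dist y c₀ ≤ r := by
    intro y hy; rw [hSdef] at hy; exact Metric.mem_closedBall.1 hy.2
  have hSmem : ∀ y : C(Icc a b, H) × Lp V 2 (volume.restrict (Icc a b)),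
      (∀ᵐ t ∂volume.restrict (Icc a b), ∀ ht : t ∈ Icc a b, ι (y.2 t) = y.1 ⟨t, ht⟩) →
      (∀ t, ‖y.1 t - ι v₀‖ ≤ r) → ‖y.2‖ ≤ r → y ∈ S := by
    intro y h1 h2 h3
    rw [hSdef]
    refine ⟨h1, ?_⟩
    rw [Metric.mem_closedBall, Prod.dist_eq, max_le_iff]
    refine ⟨(ContinuousMap.dist_le hr).2 fun t => ?_, ?_⟩
    · rw [dist_eq_norm]; exact h2 t
    · rw [dist_zero_right]; exact h3
  have hSae : ∀ y ∈ S, ∀ᵐ t ∂volume.restrict (Icc a b), ‖ι (y.2 t) - ι v₀‖ ≤ r := by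
    intro y hy
    filter_upwards [hScomp y hy, ae_restrict_mem measurableSet_Icc] with t ht ht'
    rw [ht ht', ← dist_eq_norm]
    have h1 : dist (y.1 ⟨t, ht'⟩) (c₀.1 ⟨t, ht'⟩) ≤ dist y.1 c₀.1 :=
      ContinuousMap.dist_apply_le_dist _
    exact h1.trans ((le_max_left _ _).trans (hSball y hy))
  have hS2 : ∀ y ∈ S, (eLpNorm y.2 2 (volume.restrict (Icc a b))).toReal ≤ r := by
    intro y hy
    have h1 : dist y.2 c₀.2 ≤ r := (le_max_right _ _).trans (hSball y hy)
    rw [dist_zero_right, Lp.norm_def] at h1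
    exact h1
  obtain ⟨R, hR⟩ : ∃ R : C(Icc a b, H) × Lp V 2 (volume.restrict (Icc a b)) →
      C(Icc a b, H) × Lp V 2 (volume.restrict (Icc a b)) → Prop, ∀ y z, R y z ↔
    IsEvol ι a b x (fun t => (𝒜 t (y.2 t) + K₁ t (y.2 t)) - 𝒜 t (z.2 t)) (fun t => K₂ t (y.2 t))
      (fun t => z.1 (projIcc a b hab t)) z.2 := ⟨_, fun _ _ => Iff.rfl⟩
  have hex : ∀ y ∈ S, ∃ z, R y z := by
    intro y hy
    obtain ⟨m1, m2⟩ := h.memLp_linearized h𝒜 hσ hvr (Lp.memLp y.2) (hSae y hy) (hS2 y hy)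
    obtain ⟨w, u, hwu⟩ := exists_linear_evol hι hd hab h𝒜 hθ hco x m1 m2
    refine ⟨(⟨(Icc a b).domRestrict w, continuousOn_iff_continuous_domRestrict.1 hwu.cont⟩,
      hwu.memV.toLp u), (hR _ _).2 (hwu.congr ?_ (ae_eq_refl _) (fun t ht => ?_)
      hwu.memV.coeFn_toLp.symm)⟩
    · filter_upwards [hwu.memV.coeFn_toLp] with t ht
      rw [ht]
    · rw [projIcc_of_mem hab ht]; rfl
  have hball : ∀ y ∈ S, ∀ z, R y z → z ∈ S := by
    intro y hy z hz
    rw [hR] at hz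
    obtain ⟨e1, e2⟩ := h.linear_mem_ball hι hd hab h𝒜 hθ hco hσ hs₁ hs₂ hvr (Lp.memLp y.2)
      (hSae y hy) (hS2 y hy) hz
    refine hSmem z ?_ (fun t => ?_) ?_
    · filter_upwards [hz.ae_eq] with t ht ht'
      rw [ht, projIcc_of_mem hab ht']
    · have := e1 t t.2
      rwa [projIcc_val] at this
    · rw [Lp.norm_def]; exact e2
  have hlip : ∀ y ∈ S, ∀ y' ∈ S, ∀ z z', R y z → R y' z' → dist z z' ≤ 1 / 2 * dist y y' := by
    intro y hy y' hy' z z' hz hz'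
    rw [hR] at hz hz'
    have q1 : ∀ᵐ t ∂volume.restrict (Icc a b), ‖ι (y.2 t - y'.2 t)‖ ≤ dist y y' := by
      filter_upwards [hScomp y hy, hScomp y' hy', ae_restrict_mem measurableSet_Icc]
        with t h1 h2 h3
      rw [map_sub, h1 h3, h2 h3, ← dist_eq_norm]
      exact (ContinuousMap.dist_apply_le_dist _).trans (le_max_left _ _)
    have q2 : ∀ p p' : Lp V 2 (volume.restrict (Icc a b)),
        (eLpNorm (fun t => p t - p' t) 2 (volume.restrict (Icc a b))).toReal = dist p p' := by
      intro p p'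
      rw [Lp.dist_def]; rfl
    obtain ⟨e1, e2⟩ := h.linear_dist_le hι hd hab h𝒜 hθ hco hσ hs₁ (Lp.memLp y.2) (Lp.memLp y'.2)
      (hSae y hy) (hSae y' hy') (hS2 y hy) (hS2 y' hy') dist_nonneg q1
      ((q2 _ _).trans_le (le_max_right _ _)) hz hz'
    rw [Prod.dist_eq, max_le_iff]
    refine ⟨(ContinuousMap.dist_le (by positivity)).2 fun t => ?_, (q2 _ _).symm.trans_le e2⟩
    have := e1 t t.2
    rw [projIcc_val] at this
    rwa [dist_eq_norm]
  choose! Ψ hΨ using hex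
  have hmaps : MapsTo Ψ S S := fun y hy => hball y hy _ (hΨ y hy)
  have hcontr : ContractingWith (1 / 2) (hmaps.restrict Ψ S S) := by
    refine ⟨by norm_num, LipschitzWith.of_dist_le_mul fun y y' => ?_⟩
    have := hlip y y.2 y' y'.2 _ _ (hΨ y y.2) (hΨ y' y'.2)
    rw [Subtype.dist_eq, Subtype.dist_eq, NNReal.coe_div, NNReal.coe_one, NNReal.coe_ofNat]
    exact this
  have hne : (ContinuousMap.const _ (ι v₀), hmemv.toLp _) ∈ S := by
    refine hSmem _ ?_ (fun t => by simpa using hr) ?_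
    · filter_upwards [hmemv.coeFn_toLp] with t ht ht'
      rw [ht]; rfl
    · rw [Lp.norm_toLp, toReal_eLpNorm_two_const, hσ]
      exact hvr
  obtain ⟨y, hyS, hfix, -⟩ := hcontr.exists_fixedPoint' hSc hmaps hne (edist_ne_top _ _)
  have hy := hΨ y hyS
  rw [hfix, hR] at hy
  exact ⟨_, _, hy.congr (Eventually.of_forall fun t => by simp) (ae_eq_refl _)
    (fun t _ => rfl) (ae_eq_refl _)⟩

end Contraction

/-! ### Abstract parabolic problems -/

section Parabolic

open Filter Topology

variable {V H : Type*} [NormedAddCommGroup V] [InnerProductSpace ℝ V] [CompleteSpace V]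
  [NormedAddCommGroup H] [InnerProductSpace ℝ H] [CompleteSpace H]

/-- The properties of the nonlinearities `K₁ : [0,T] × V → V*` and `K₂ : [0,T] × V → H` that give
local existence, uniqueness and continuation for `u' = K₁(t, u) + K₂(t, u)`. -/
structure IsParabolic (ι : V →L[ℝ] H) (T : ℝ) (K₁ : ℝ → V → StrongDual ℝ V)
    (K₂ : ℝ → V → H) : Prop where
  meas1 : ∀ a b : ℝ, 0 ≤ a → b ≤ T → ∀ u : ℝ → V,
    AEStronglyMeasurable u (volume.restrict (Icc a b)) →
    AEStronglyMeasurable (fun t => K₁ t (u t)) (volume.restrict (Icc a b))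
  meas2 : ∀ a b : ℝ, 0 ≤ a → b ≤ T → ∀ u : ℝ → V,
    AEStronglyMeasurable u (volume.restrict (Icc a b)) →
    AEStronglyMeasurable (fun t => K₂ t (u t)) (volume.restrict (Icc a b))
  growth1 : ∀ n : ℝ, ∃ (g : ℝ → ℝ) (C : ℝ), MemLp g 2 (volume.restrict (Icc 0 T)) ∧
    ∀ t ∈ Icc 0 T, ∀ v, ‖ι v‖ ≤ n → ‖K₁ t v‖ ≤ g t + C * ‖v‖
  int2 : Integrable (fun t => K₂ t 0) (volume.restrict (Icc 0 T))
  lip2 : ∀ n : ℝ, ∃ κ : ℝ → ℝ, MemLp κ 2 (volume.restrict (Icc 0 T)) ∧ (∀ t, 0 ≤ κ t) ∧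
    ∀ t ∈ Icc 0 T, ∀ u v, ‖ι u‖ ≤ n → ‖ι v‖ ≤ n →
      ‖K₂ t u - K₂ t v‖ ≤ κ t * (‖u - v‖ + ‖ι (u - v)‖ * (1 + ‖u‖ + ‖v‖))
  frozen : ∀ n : ℝ, ∃ θ : ℝ, 0 < θ ∧ ∀ lam : ℝ, 0 < lam → ∃ r L : ℝ, 0 < r ∧ 0 ≤ L ∧
    ∀ v₀, ‖ι v₀‖ ≤ n → ∃ (𝒜 : ℝ → V →L[ℝ] StrongDual ℝ V) (C : ℝ),
      (∀ a b : ℝ, 0 ≤ a → b ≤ T → IsLinFamily a b C 𝒜) ∧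
      (∀ t ∈ Icc 0 T, ∀ v, θ * ‖v‖ ^ 2 ≤ 𝒜 t v v) ∧
      ∀ t ∈ Icc 0 T, ∀ u v, ‖ι u - ι v₀‖ ≤ r → ‖ι v - ι v₀‖ ≤ r →
        ‖𝒜 t (u - v) + (K₁ t u - K₁ t v)‖ ≤
          lam * ‖u - v‖ + L * ‖ι (u - v)‖ * (1 + ‖u‖ + ‖v‖)
  mono : ∀ n : ℝ, ∃ θ W : ℝ, 0 < θ ∧ 0 ≤ W ∧ ∀ t ∈ Icc 0 T, ∀ u v, ‖ι u‖ ≤ n → ‖ι v‖ ≤ n →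
    (K₁ t u - K₁ t v) (u - v) ≤
      -θ * ‖u - v‖ ^ 2 + W * ‖ι (u - v)‖ ^ 2 * (1 + ‖u‖ ^ 2 + ‖v‖ ^ 2)

theorem eventually_integral_Icc_lt {f : ℝ → ℝ} {a T ε : ℝ} (haT : a < T) (hε : 0 < ε)
    (hf : Integrable f (volume.restrict (Icc a T))) :
    ∀ᶠ b in 𝓝[>] a, ∫ t in Icc a b, f t < ε := by
  have h1 : Tendsto (fun b => ∫ t in a..b, f t) (𝓝[Icc a T] a) (𝓝 0) := by
    have := continuousOn_primitive_Icc hf a ⟨le_rfl, haT.le⟩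
    rw [ContinuousWithinAt, intervalIntegral.integral_same] at this
    exact this
  have h2 : Tendsto (fun b => ∫ t in a..b, f t) (𝓝[>] a) (𝓝 0) :=
    h1.mono_left (nhdsWithin_le_of_mem (Icc_mem_nhdsGT haT))
  filter_upwards [h2.eventually (gt_mem_nhds hε), self_mem_nhdsWithin] with b hb hb'
  rwa [intervalIntegral.integral_of_le (le_of_lt hb'), ← integral_Icc_eq_integral_Ioc] at hb

theorem eventually_toReal_eLpNorm_lt {E : Type*} [NormedAddCommGroup E] {f : ℝ → E} {a T ε : ℝ}
    (haT : a < T) (hε : 0 < ε) (hf : MemLp f 2 (volume.restrict (Icc a T))) :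
    ∀ᶠ b in 𝓝[>] a, (eLpNorm f 2 (volume.restrict (Icc a b))).toReal < ε := by
  filter_upwards [eventually_integral_Icc_lt haT (pow_pos hε 2) (memLp_two_norm_sq_integrable hf),
    Icc_mem_nhdsGT haT] with b hb hb'
  have hm : MemLp f 2 (volume.restrict (Icc a b)) :=
    hf.mono_measure (Measure.restrict_mono (Icc_subset_Icc_right hb'.2) le_rfl)
  rw [← toReal_eLpNorm_two_sq hm] at hb
  exact lt_of_pow_lt_pow_left₀ 2 hε.le hb

theorem restrict_Icc_le {a b T : ℝ} (ha : 0 ≤ a) (hb : b ≤ T) :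
    volume.restrict (Icc a b) ≤ (volume.restrict (Icc 0 T) : Measure ℝ) :=
  Measure.restrict_mono (Icc_subset_Icc ha hb) le_rfl

/-- Along a square integrable `u` that is bounded in `H`, `K₁(u) ∈ L²(V*)` and `K₂(u) ∈ L¹(H)`. -/
theorem IsParabolic.memLp {ι : V →L[ℝ] H} {T : ℝ} {K₁ : ℝ → V → StrongDual ℝ V} {K₂ : ℝ → V → H}
    (h : IsParabolic ι T K₁ K₂) {a b n : ℝ} (ha : 0 ≤ a) (hb : b ≤ T) {u : ℝ → V}
    (hu : MemLp u 2 (volume.restrict (Icc a b)))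
    (hn : ∀ᵐ t ∂volume.restrict (Icc a b), ‖ι (u t)‖ ≤ n) :
    MemLp (fun t => K₁ t (u t)) 2 (volume.restrict (Icc a b)) ∧
      Integrable (fun t => K₂ t (u t)) (volume.restrict (Icc a b)) := by
  have hsub : Icc a b ⊆ Icc 0 T := Icc_subset_Icc ha hb
  constructor
  · obtain ⟨g, C, hg, hK⟩ := h.growth1 n
    have hg' : MemLp (fun t => g t + C * ‖u t‖) 2 (volume.restrict (Icc a b)) :=
      memLp_two_fun_add (hg.mono_measure (restrict_Icc_le ha hb)) (hu.norm.const_mul C)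
    refine MemLp.of_le hg' (h.meas1 a b ha hb u hu.1) ?_
    filter_upwards [hn, ae_restrict_mem measurableSet_Icc] with t h1 h2
    exact (hK t (hsub h2) _ h1).trans (le_abs_self _)
  · obtain ⟨κ, hκ, hκ0, hK⟩ := h.lip2 (max n 0)
    have hκ' := hκ.mono_measure (restrict_Icc_le ha hb)
    have hG : MemLp (fun t => ‖u t‖ + max n 0 * (1 + ‖u t‖)) 2 (volume.restrict (Icc a b)) :=
      memLp_two_fun_add hu.norm ((memLp_two_fun_add (memLp_const (1 : ℝ)) hu.norm).const_mul _)
    have hi := (integrable_norm_mul hκ' hG).add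
      ((h.int2.mono_measure (restrict_Icc_le ha hb)).norm)
    refine Integrable.mono' hi (h.meas2 a b ha hb u hu.1) ?_
    filter_upwards [hn, ae_restrict_mem measurableSet_Icc] with t h1 h2
    have h3 := hK t (hsub h2) (u t) 0 (h1.trans (le_max_left _ _)) (by simp)
    rw [sub_zero, norm_zero, add_zero] at h3
    have h4 : ‖K₂ t (u t)‖ ≤ ‖K₂ t (u t) - K₂ t 0‖ + ‖K₂ t 0‖ := norm_le_norm_sub_add _ _
    have h5 : 0 ≤ max n 0 := le_max_right _ _
    have h6 : ‖ι (u t)‖ ≤ max n 0 := h1.trans (le_max_left _ _)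
    have h7 := hκ0 t
    refine h4.trans (add_le_add_left (h3.trans ?_) _)
    beta_reduce
    rw [Real.norm_of_nonneg h7, Real.norm_of_nonneg (by positivity)]
    gcongr

/-- Local existence. The order of the choices is: the Lipschitz constant `lam`, the radius `r`, the
point `v₀ ∈ V` close to the initial value, and last the length of the time interval. -/
theorem IsParabolic.exists_local {ι : V →L[ℝ] H} (hι : Function.Injective ι) (hd : DenseRange ι)
    {T : ℝ} {K₁ : ℝ → V → StrongDual ℝ V} {K₂ : ℝ → V → H} (h : IsParabolic ι T K₁ K₂) {a : ℝ}
    (ha : 0 ≤ a) (haT : a < T) (x : H) :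
    ∃ b, a < b ∧ b ≤ T ∧
      ∃ w u, IsEvol ι a b x (fun t => K₁ t (u t)) (fun t => K₂ t (u t)) w u := by
  obtain ⟨θ, hθ, hfro⟩ := h.frozen (‖x‖ + 2)
  set c := 2 / min 1 (2 * θ) with hc
  have hc0 : 0 < c := div_pos two_pos (lt_min one_pos (by positivity))
  obtain ⟨r₀, L, hr₀, hL, hfro⟩ := hfro (1 / (8 * c)) (by positivity)
  obtain ⟨κ, hκ, hκ0, hK₂⟩ := h.lip2 (‖x‖ + 2)
  obtain ⟨r, hr, hrr₀, hr1, hrL⟩ : ∃ r : ℝ, 0 < r ∧ r ≤ r₀ ∧ r ≤ 1 ∧ c * L * (2 * r) ≤ 1 / 8 := by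
    refine ⟨min r₀ (min 1 (1 / (16 * c * (L + 1)))),
      lt_min hr₀ (lt_min one_pos (by positivity)), min_le_left _ _,
      (min_le_right _ _).trans (min_le_left _ _), ?_⟩
    have h1 : min r₀ (min 1 (1 / (16 * c * (L + 1)))) ≤ 1 / (16 * c * (L + 1)) :=
      (min_le_right _ _).trans (min_le_right _ _)
    calc _ ≤ c * L * (2 * (1 / (16 * c * (L + 1)))) := by gcongr
      _ = 1 / 8 * (L / (L + 1)) := by field_simp; ring
      _ ≤ 1 / 8 * 1 := by gcongr; rw [div_le_one (by positivity)]; linarith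
      _ = _ := by ring
  obtain ⟨v₀, hv₀⟩ := hd.exists_dist_lt x (ε := min 1 (r / (8 * c)))
    (lt_min one_pos (by positivity))
  rw [dist_eq_norm] at hv₀
  have hv₀1 : ‖x - ι v₀‖ < 1 := hv₀.trans_le (min_le_left _ _)
  have hv₀r : c * ‖x - ι v₀‖ ≤ r / 8 := by
    have h1 : ‖x - ι v₀‖ ≤ r / (8 * c) := hv₀.le.trans (min_le_right _ _)
    calc _ ≤ c * (r / (8 * c)) := by gcongr
      _ = _ := by field_simp
  have hιv₀ : ‖ι v₀‖ ≤ ‖x‖ + 1 := by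
    have := norm_sub_norm_le (ι v₀) x
    rw [norm_sub_rev] at this
    linarith
  obtain ⟨𝒜, C, h𝒜, hco, hK₁⟩ := hfro v₀ (by linarith)
  have hsT : Icc a T ⊆ Icc 0 T := Icc_subset_Icc_left ha
  obtain ⟨m1, m2⟩ := h.memLp ha le_rfl (memLp_const v₀)
    (Eventually.of_forall fun _ => le_refl ‖ι v₀‖)
  have hκ' := hκ.mono_measure (restrict_Icc_le ha le_rfl)
  have h1m : MemLp (fun _ : ℝ => (1 : ℝ)) 2 (volume.restrict (Icc a T)) := memLp_const 1
  -- the norms over `[a, b]` of `κ`, of `1`, of `K₁(v₀)` and of `K₂(v₀)` tend to `0` as `b → a`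
  have hev := (((((eventually_toReal_eLpNorm_lt haT (ε := 1 / (32 * c)) (by positivity) hκ').and
    (eventually_toReal_eLpNorm_lt haT (ε := min 1 (min (1 / (8 * c * (L + 1)))
      (r / (16 * (‖v₀‖ + 1))))) (lt_min one_pos (lt_min (by positivity) (by positivity))) h1m)).and
    (eventually_toReal_eLpNorm_lt haT (ε := r / (16 * c)) (by positivity) m1)).and
    (eventually_integral_Icc_lt haT (ε := r / (16 * c)) (by positivity) m2.norm)).and
    (Ioc_mem_nhdsGT haT)).exists
  obtain ⟨b, ⟨⟨⟨e1, e2⟩, e3⟩, e4⟩, hab, hbT⟩ := hev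
  refine ⟨b, hab, hbT, ?_⟩
  have hsb : Icc a b ⊆ Icc 0 T := Icc_subset_Icc ha hbT
  have hmb : volume.restrict (Icc a b) ≤ (volume.restrict (Icc a T) : Measure ℝ) :=
    Measure.restrict_mono (Icc_subset_Icc_right hbT) le_rfl
  have hloc : IsLocallyLipschitz ι a b 𝒜 K₁ K₂ v₀ (1 / (8 * c)) L r κ := by
    have hb : ∀ u : V, ‖ι u - ι v₀‖ ≤ r → ‖ι u‖ ≤ ‖x‖ + 2 := fun u hu => by
      have := norm_le_norm_sub_add (ι u) (ι v₀)
      linarith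
    exact
    { meas1 := h.meas1 a b ha hbT
      meas2 := h.meas2 a b ha hbT
      mem1 := m1.mono_measure hmb
      int2 := m2.mono_measure hmb
      memκ := hκ'.mono_measure hmb
      κ_nonneg := hκ0
      lam_nonneg := by positivity
      L_nonneg := hL
      r_nonneg := hr.le
      lip1 := fun t ht u v hu hv => hK₁ t (hsb ht) u v (hu.trans hrr₀) (hv.trans hrr₀)
      lip2 := fun t ht u v hu hv => hK₂ t (hsb ht) u v (hb u hu) (hb v hv) }
  set σ := (eLpNorm (fun _ : ℝ => (1 : ℝ)) 2 (volume.restrict (Icc a b))).toReal with hσ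
  have hσ0 : 0 ≤ σ := ENNReal.toReal_nonneg
  have hσ1 : σ ≤ 1 := e2.le.trans (min_le_left _ _)
  have hσ2 : c * L * σ ≤ 1 / 8 := by
    have h1 : σ ≤ 1 / (8 * c * (L + 1)) :=
      e2.le.trans ((min_le_right _ _).trans (min_le_left _ _))
    calc _ ≤ c * L * (1 / (8 * c * (L + 1))) := by gcongr
      _ = 1 / 8 * (L / (L + 1)) := by field_simp
      _ ≤ 1 / 8 * 1 := by gcongr; rw [div_le_one (by positivity)]; linarith
      _ = _ := by ring
  have hσ3 : 2 * (‖v₀‖ * σ) ≤ r / 8 := by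
    have h1 : σ ≤ r / (16 * (‖v₀‖ + 1)) :=
      e2.le.trans ((min_le_right _ _).trans (min_le_right _ _))
    calc _ ≤ 2 * ((‖v₀‖ + 1) * (r / (16 * (‖v₀‖ + 1)))) := by gcongr; linarith
      _ = _ := by field_simp; ring
  refine hloc.exists_isEvol hι hd hab.le (h𝒜 a b ha hbT) hθ (fun t ht => hco t (hsb ht)) hσ.symm
    ?_ ?_
  · rw [← hc]
    set k := (eLpNorm κ 2 (volume.restrict (Icc a b))).toReal with hk
    have hk0 : 0 ≤ k := ENNReal.toReal_nonneg
    have h1 : c * (k * (1 + σ + 2 * r)) ≤ c * (1 / (32 * c) * 4) := by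
      gcongr
      linarith
    have h2 : c * (1 / (32 * c) * 4) = 1 / 8 := by field_simp; norm_num
    have h3 : c * (1 / (8 * c)) = 1 / 8 := by field_simp
    linarith
  · rw [← hc]
    have h1 : c * (eLpNorm (fun t => K₁ t v₀) 2 (volume.restrict (Icc a b))).toReal ≤
        c * (r / (16 * c)) := by gcongr
    have h2 : c * (∫ t in Icc a b, ‖K₂ t v₀‖) ≤ c * (r / (16 * c)) := by gcongr
    have h3 : c * (r / (16 * c)) = r / 16 := by field_simp
    linarith

end Parabolic

/-! ### Uniqueness, a priori bound and continuation -/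

section Global

open Filter Topology

variable {V H : Type*} [NormedAddCommGroup V] [InnerProductSpace ℝ V] [CompleteSpace V]
  [NormedAddCommGroup H] [InnerProductSpace ℝ H] [CompleteSpace H]

theorem IsEvol.exists_norm_le {ι : V →L[ℝ] H} {a b : ℝ} {x : H} {k₁ : ℝ → StrongDual ℝ V}
    {k₂ : ℝ → H} {w : ℝ → H} {u : ℝ → V} (h : IsEvol ι a b x k₁ k₂ w u) :
    ∃ n : ℝ, (∀ t ∈ Icc a b, ‖w t‖ ≤ n) ∧ ∀ᵐ t ∂volume.restrict (Icc a b), ‖ι (u t)‖ ≤ n := by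
  obtain ⟨n, hn⟩ := isCompact_Icc.exists_bound_of_continuousOn h.cont
  refine ⟨n, hn, ?_⟩
  filter_upwards [h.ae_eq, ae_restrict_mem measurableSet_Icc] with t ht ht'
  rw [ht]
  exact hn t ht'

theorem IsEvol.integrable_energy {ι : V →L[ℝ] H} {a b : ℝ} {x : H} {k₁ : ℝ → StrongDual ℝ V}
    {k₂ : ℝ → H} {w : ℝ → H} {u : ℝ → V} (h : IsEvol ι a b x k₁ k₂ w u) :
    Integrable (fun s => k₁ s (u s) + inner ℝ (k₂ s) (w s)) (volume.restrict (Icc a b)) := by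
  obtain ⟨n, hn, -⟩ := h.exists_norm_le
  refine (integrable_apply h.mem1 h.memV).add ?_
  refine Integrable.mono' (h.int2.norm.mul_const n)
    (h.int2.1.inner (h.cont.aestronglyMeasurable measurableSet_Icc)) ?_
  filter_upwards [ae_restrict_mem measurableSet_Icc] with t ht
  exact (norm_inner_le_norm _ _).trans (by gcongr; exact hn t ht)

/-- The form in which Young's inequality absorbs the diffusion term into `θ ‖u - u'‖_V²`. -/
theorem mul_add_mul_le_quadratic {κ p q A B θ : ℝ} (hθ : 0 < θ) :
    κ * (p + q * (1 + A + B)) * q ≤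
      θ * p ^ 2 + ((1 / (4 * θ) + 1) * κ ^ 2 + (1 + A ^ 2 + B ^ 2)) * q ^ 2 := by
  have h1 : κ * p * q ≤ θ * p ^ 2 + 1 / (4 * θ) * κ ^ 2 * q ^ 2 := by
    have e : θ * p ^ 2 + 1 / (4 * θ) * κ ^ 2 * q ^ 2 - κ * p * q =
        θ * (p - κ * q / (2 * θ)) ^ 2 := by field_simp; ring
    have : 0 ≤ θ * (p - κ * q / (2 * θ)) ^ 2 := by positivity
    linarith
  have h2 : κ * (1 + A + B) ≤ κ ^ 2 + (1 + A ^ 2 + B ^ 2) := by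
    nlinarith [sq_nonneg (κ - (1 + A + B) / 2), sq_nonneg (1 - A), sq_nonneg (1 - B),
      sq_nonneg (A - B)]
  have h3 : κ * (1 + A + B) * q ^ 2 ≤ (κ ^ 2 + (1 + A ^ 2 + B ^ 2)) * q ^ 2 := by gcongr
  nlinarith

/-- Uniqueness: by the energy identity for the difference, `‖w - w'‖²` satisfies Gronwall's
inequality with an integrable weight, since both `u` and `u'` are square integrable. -/
theorem IsParabolic.eqOn {ι : V →L[ℝ] H} (hι : Function.Injective ι) (hd : DenseRange ι)
    {T : ℝ} {K₁ : ℝ → V → StrongDual ℝ V} {K₂ : ℝ → V → H} (h : IsParabolic ι T K₁ K₂) {b : ℝ}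
    (hbT : b ≤ T) {x : H} {w w' : ℝ → H} {u u' : ℝ → V}
    (hu : IsEvol ι 0 b x (fun t => K₁ t (u t)) (fun t => K₂ t (u t)) w u)
    (hu' : IsEvol ι 0 b x (fun t => K₁ t (u' t)) (fun t => K₂ t (u' t)) w' u') :
    EqOn w w' (Icc 0 b) := by
  obtain ⟨n₁, -, hn₁⟩ := hu.exists_norm_le
  obtain ⟨n₂, -, hn₂⟩ := hu'.exists_norm_le
  obtain ⟨θ, W, hθ, hW, hm⟩ := h.mono (max n₁ n₂)
  obtain ⟨κ, hκ, hκ0, hK⟩ := h.lip2 (max n₁ n₂)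
  have hκ' := hκ.mono_measure (restrict_Icc_le le_rfl hbT)
  set g : ℝ → ℝ := fun t => (1 / (4 * θ) + 1) * κ t ^ 2 +
    (1 + W) * (1 + ‖u t‖ ^ 2 + ‖u' t‖ ^ 2) with hg
  have hg0 : ∀ t, 0 ≤ g t := fun t => by positivity
  have hgi : Integrable g (volume.restrict (Icc 0 b)) := by
    have h1 : Integrable (fun t => κ t ^ 2) (volume.restrict (Icc 0 b)) := by
      simpa using memLp_two_norm_sq_integrable hκ'
    exact (h1.const_mul _).add ((((integrable_const 1).add
      (memLp_two_norm_sq_integrable hu.memV)).add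
      (memLp_two_norm_sq_integrable hu'.memV)).const_mul _)
  have hsub := hu.sub hu'
  rw [sub_self] at hsub
  have hle : ∀ᵐ s ∂volume.restrict (Icc 0 b),
      (K₁ s (u s) - K₁ s (u' s)) (u s - u' s) +
        inner ℝ (K₂ s (u s) - K₂ s (u' s)) (w s - w' s) ≤ g s * ‖w s - w' s‖ ^ 2 := by
    filter_upwards [hn₁, hn₂, hu.ae_eq, hu'.ae_eq, ae_restrict_mem measurableSet_Icc]
      with s h1 h2 h3 h4 h5
    have h5' : s ∈ Icc 0 T := ⟨h5.1, h5.2.trans hbT⟩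
    have h1' := h1.trans (le_max_left n₁ n₂)
    have h2' := h2.trans (le_max_right n₁ n₂)
    have e1 := hm s h5' (u s) (u' s) h1' h2'
    have e2 := hK s h5' (u s) (u' s) h1' h2'
    have e3 : ι (u s - u' s) = w s - w' s := by rw [map_sub, h3, h4]
    rw [e3] at e1 e2
    have e4 : inner ℝ (K₂ s (u s) - K₂ s (u' s)) (w s - w' s) ≤
        κ s * (‖u s - u' s‖ + ‖w s - w' s‖ * (1 + ‖u s‖ + ‖u' s‖)) * ‖w s - w' s‖ :=
      (real_inner_le_norm _ _).trans (by gcongr)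
    have e5 := mul_add_mul_le_quadratic (κ := κ s) (p := ‖u s - u' s‖) (A := ‖u s‖)
      (B := ‖u' s‖) (q := ‖w s - w' s‖) hθ
    have e6 : g s * ‖w s - w' s‖ ^ 2 = ((1 / (4 * θ) + 1) * κ s ^ 2 +
        (1 + ‖u s‖ ^ 2 + ‖u' s‖ ^ 2)) * ‖w s - w' s‖ ^ 2 +
        W * ‖w s - w' s‖ ^ 2 * (1 + ‖u s‖ ^ 2 + ‖u' s‖ ^ 2) := by
      simp only [hg]; ring
    linarith
  have hgw : Integrable (fun s => g s * ‖w s - w' s‖ ^ 2) (volume.restrict (Icc 0 b)) := by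
    obtain ⟨R, hR⟩ := isCompact_Icc.exists_bound_of_continuousOn (hsub.cont.norm.pow 2)
    refine hgi.mul_bdd (c := R)
      ((hsub.cont.norm.pow 2).aestronglyMeasurable measurableSet_Icc) ?_
    filter_upwards [ae_restrict_mem measurableSet_Icc] with t ht using hR t ht
  intro t ht
  have hgr := le_mul_exp_integral_of_le (E := fun s => ‖w s - w' s‖ ^ 2) (κ := fun s => 2 * g s)
    (c := 0) ht.1 ((hsub.cont.norm.pow 2).mono (Icc_subset_Icc_right ht.2))
    (intervalIntegrable_of_mem (hgi.const_mul 2) ht) (fun s => mul_nonneg two_pos.le (hg0 s))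
    (fun s hs => by
      have hs' : s ∈ Icc 0 b := ⟨hs.1, hs.2.trans ht.2⟩
      have e1 := hsub.energy hι hd hs'
      rw [e1, norm_zero, zero_pow two_ne_zero]
      gcongr
      simp only [mul_assoc]
      rw [intervalIntegral.integral_const_mul]
      gcongr
      exact intervalIntegral_mono_ae hs' hsub.integrable_energy hgw hle)
  rw [zero_mul] at hgr
  have h2 : ‖w t - w' t‖ ^ 2 = 0 := le_antisymm hgr (by positivity)
  exact sub_eq_zero.mp (norm_eq_zero.mp (pow_eq_zero_iff two_ne_zero |>.mp h2))

/-- The a priori bound that follows from coercivity. -/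
theorem IsEvol.apriori {ι : V →L[ℝ] H} (hι : Function.Injective ι) (hd : DenseRange ι)
    {b θ : ℝ} {K₁ : ℝ → V → StrongDual ℝ V} {K₂ : ℝ → V → H} (hθ : 0 < θ) {m p : ℝ → ℝ}
    (hm : Integrable m (volume.restrict (Icc 0 b))) (hp : Integrable p (volume.restrict (Icc 0 b)))
    (hm0 : ∀ t, 0 ≤ m t) (hp0 : ∀ t, 0 ≤ p t)
    (hco : ∀ t ∈ Icc 0 b, ∀ v, K₁ t v v + inner ℝ (K₂ t v) (ι v) ≤
      -θ * ‖v‖ ^ 2 + m t * ‖ι v‖ ^ 2 + p t) {x : H} {w : ℝ → H} {u : ℝ → V}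
    (hu : IsEvol ι 0 b x (fun t => K₁ t (u t)) (fun t => K₂ t (u t)) w u) {t : ℝ}
    (ht : t ∈ Icc 0 b) :
    ‖w t‖ ^ 2 + 2 * θ * ∫ s in (0 : ℝ)..t, ‖u s‖ ^ 2 ≤
      (‖x‖ ^ 2 + 2 * ∫ s in Icc 0 b, p s) * Real.exp (2 * ∫ s in Icc 0 b, m s) := by
  have hu2 := memLp_two_norm_sq_integrable hu.memV
  set E : ℝ → ℝ := fun t => ‖w t‖ ^ 2 + 2 * θ * ∫ s in (0 : ℝ)..t, ‖u s‖ ^ 2 with hE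
  have hEc : ContinuousOn E (Icc 0 b) :=
    (hu.cont.norm.pow 2).add (continuousOn_const.mul (continuousOn_primitive_Icc hu2))
  have hmw : ∀ {q : ℝ → ℝ}, ContinuousOn q (Icc 0 b) →
      Integrable (fun s => m s * q s) (volume.restrict (Icc 0 b)) := by
    intro q hq
    obtain ⟨R, hR⟩ := isCompact_Icc.exists_bound_of_continuousOn hq
    refine hm.mul_bdd (c := R) (hq.aestronglyMeasurable measurableSet_Icc) ?_
    filter_upwards [ae_restrict_mem measurableSet_Icc] with t ht using hR t ht
  have hP0 : 0 ≤ ∫ s in Icc 0 b, p s := integral_nonneg hp0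
  have hgr := le_mul_exp_integral_of_le (E := E) (κ := fun s => 2 * m s)
    (c := ‖x‖ ^ 2 + 2 * ∫ s in Icc 0 b, p s) ht.1 (hEc.mono (Icc_subset_Icc_right ht.2))
    (intervalIntegrable_of_mem (hm.const_mul 2) ht) (fun s => mul_nonneg two_pos.le (hm0 s))
    (fun r hr => by
      have hr' : r ∈ Icc 0 b := ⟨hr.1, hr.2.trans ht.2⟩
      have hmE := hmw hEc
      have hmEp : Integrable (fun s => m s * E s + p s) (volume.restrict (Icc 0 b)) := hmE.add hp
      have i1 : Integrable (fun s => -θ * ‖u s‖ ^ 2 + (m s * E s + p s))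
          (volume.restrict (Icc 0 b)) := (hu2.const_mul (-θ)).add hmEp
      have e2 : ∫ s in (0 : ℝ)..r, (K₁ s (u s) (u s) + inner ℝ (K₂ s (u s)) (w s)) ≤
          ∫ s in (0 : ℝ)..r, (-θ * ‖u s‖ ^ 2 + (m s * E s + p s)) := by
        refine intervalIntegral_mono_ae hr' hu.integrable_energy i1 ?_
        filter_upwards [hu.ae_eq, ae_restrict_mem measurableSet_Icc] with s h1 h2
        have h3 := hco s h2 (u s)
        rw [h1] at h3
        have h4 : 0 ≤ ∫ s in (0 : ℝ)..s, ‖u s‖ ^ 2 :=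
          intervalIntegral.integral_nonneg h2.1 fun s _ => by positivity
        have h5 : m s * ‖w s‖ ^ 2 ≤ m s * E s := by
          refine mul_le_mul_of_nonneg_left ?_ (hm0 s)
          have : 0 ≤ 2 * θ * ∫ s in (0 : ℝ)..s, ‖u s‖ ^ 2 := by positivity
          simp only [hE]
          linarith
        linarith
      rw [intervalIntegral.integral_add (intervalIntegrable_of_mem (hu2.const_mul (-θ)) hr')
        (intervalIntegrable_of_mem hmEp hr'),
        intervalIntegral.integral_add (intervalIntegrable_of_mem hmE hr')
        (intervalIntegrable_of_mem hp hr'), intervalIntegral.integral_const_mul] at e2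
      have e3 := intervalIntegral_le_of_nonneg hr' hp hp0
      simp only [mul_assoc]
      rw [intervalIntegral.integral_const_mul]
      simp only [hE] at e2 ⊢
      rw [hu.energy hι hd hr']
      linarith)
  refine hgr.trans ?_
  have h3 : ∫ s in (0 : ℝ)..t, 2 * m s ≤ 2 * ∫ s in Icc 0 b, m s := by
    rw [intervalIntegral.integral_const_mul]
    gcongr
    exact intervalIntegral_le_of_nonneg ht hm hm0
  gcongr

end Global

section Continuation

open Filter Topology

variable {V H : Type*} [NormedAddCommGroup V] [InnerProductSpace ℝ V] [CompleteSpace V]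
  [NormedAddCommGroup H] [InnerProductSpace ℝ H] [CompleteSpace H]

/-- Solutions on all intervals `[0, b]` with `b < β`, with uniform bounds, give a solution on
`[0, β]`: by uniqueness they agree, and the square integrability of the common representative makes
the energy regularity apply up to the end point. -/
theorem IsParabolic.exists_isEvol_of_forall_lt {ι : V →L[ℝ] H} (hι : Function.Injective ι)
    (hd : DenseRange ι) {T : ℝ} {K₁ : ℝ → V → StrongDual ℝ V} {K₂ : ℝ → V → H}
    (h : IsParabolic ι T K₁ K₂) {β R : ℝ} (hβ : 0 < β) (hβT : β ≤ T) {x : H}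
    (hex : ∀ b ∈ Ico 0 β, ∃ w u,
      IsEvol ι 0 b x (fun t => K₁ t (u t)) (fun t => K₂ t (u t)) w u)
    (hR : ∀ b ∈ Ico 0 β, ∀ w u,
      IsEvol ι 0 b x (fun t => K₁ t (u t)) (fun t => K₂ t (u t)) w u →
      (∀ t ∈ Icc 0 b, ‖w t‖ ≤ R) ∧ ∫ s in (0 : ℝ)..b, ‖u s‖ ^ 2 ≤ R) :
    ∃ w u, IsEvol ι 0 β x (fun t => K₁ t (u t)) (fun t => K₂ t (u t)) w u := by
  choose! W U hWU using hex
  set w : ℝ → H := fun t => W t t with hw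
  -- a pointwise preimage does not depend on `b`; it agrees almost everywhere with each `U b`
  set u : ℝ → V := fun t => Function.invFun ι (w t) with hu
  have hloc : ∀ b ∈ Ico 0 β, IsEvol ι 0 b x (fun t => K₁ t (u t)) (fun t => K₂ t (u t)) w u := by
    intro b hb
    have hEq : EqOn (W b) w (Icc 0 b) := fun t ht => by
      have ht' : t ∈ Ico 0 β := ⟨ht.1, ht.2.trans_lt hb.2⟩
      exact h.eqOn hι hd (ht'.2.le.trans hβT) ((hWU b hb).mono ht.2) (hWU t ht')
        ⟨ht.1, le_rfl⟩
    have hUu : ∀ᵐ t ∂volume.restrict (Icc 0 b), U b t = u t := by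
      filter_upwards [(hWU b hb).ae_eq, ae_restrict_mem measurableSet_Icc] with t h1 h2
      rw [hu]
      beta_reduce
      rw [← hEq h2, ← h1, Function.leftInverse_invFun hι]
    refine (hWU b hb).congr ?_ ?_ hEq hUu
    · filter_upwards [hUu] with t ht; rw [ht]
    · filter_upwards [hUu] with t ht; rw [ht]
  obtain ⟨bn, -, hbn, hbl⟩ := exists_seq_strictMono_tendsto' hβ
  have hbn' : ∀ n, bn n ∈ Ico 0 β := fun n => ⟨(hbn n).1.le, (hbn n).2⟩
  have hcov : AECover (volume.restrict (Icc 0 β)) atTop fun n => Icc 0 (bn n) :=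
    aecover_Icc_of_Icc tendsto_const_nhds hbl
  have hrr : ∀ n, (volume.restrict (Icc 0 β)).restrict (Icc 0 (bn n)) =
      (volume.restrict (Icc 0 (bn n)) : Measure ℝ) := fun n => by
    rw [Measure.restrict_restrict measurableSet_Icc,
      inter_eq_left.mpr (Icc_subset_Icc_right (hbn n).2.le)]
  have hum : AEStronglyMeasurable u (volume.restrict (Icc 0 β)) :=
    hcov.aestronglyMeasurable fun n => by
      rw [hrr]; exact (hloc _ (hbn' n)).memV.1
  have hu2 : MemLp u 2 (volume.restrict (Icc 0 β)) := by
    rw [← memLp_norm_iff hum, memLp_two_iff_integrable_sq_norm hum.norm]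
    simp only [norm_norm]
    have h1 : IntegrableOn (fun s => ‖u s‖ ^ 2) (Ioc 0 β) := by
      refine integrableOn_Ioc_of_intervalIntegral_norm_bounded_right (I := R) (fun n => ?_) hbl
        (Eventually.of_forall fun n => ?_)
      · exact IntegrableOn.mono_set (memLp_two_norm_sq_integrable (hloc _ (hbn' n)).memV)
          Ioc_subset_Icc_self
      · have := (hR _ (hbn' n) w u (hloc _ (hbn' n))).2
        rw [intervalIntegral.integral_of_le (hbn n).1.le] at this
        simpa using this
    rwa [IntegrableOn, restrict_Ioc_eq_restrict_Icc] at h1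
  have hlt : ∀ᵐ t ∂volume.restrict (Icc 0 β), t ∈ Ico 0 β := by
    rw [← restrict_Ico_eq_restrict_Icc]
    exact ae_restrict_mem measurableSet_Ico
  have hae : ∀ᵐ t ∂volume.restrict (Icc 0 β), ι (u t) = w t := by
    have h1 : ∀ᵐ t ∂volume.restrict (Icc 0 β), ∀ n, t ∈ Icc 0 (bn n) → ι (u t) = w t := by
      rw [ae_all_iff]
      intro n
      have h2 := (hloc _ (hbn' n)).ae_eq
      rw [← hrr, ae_restrict_iff' measurableSet_Icc] at h2
      exact h2
    filter_upwards [h1, hlt] with t h2 h3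
    obtain ⟨n, hn⟩ := (hbl.eventually (lt_mem_nhds h3.2)).exists
    exact h2 n ⟨h3.1, hn.le⟩
  have hbd : ∀ᵐ t ∂volume.restrict (Icc 0 β), ‖ι (u t)‖ ≤ R := by
    filter_upwards [hae, hlt] with t h1 h2
    rw [h1]
    exact (hR t h2 w u (hloc t h2)).1 t ⟨h2.1, le_rfl⟩
  obtain ⟨m1, m2⟩ := h.memLp le_rfl hβT hu2 hbd
  have hfin : ∀ᵐ t ∂volume.restrict (Icc 0 β), pivotCLM ι (ι (u t)) =
      pivotCLM ι x + ∫ s in (0 : ℝ)..t, (K₁ s (u s) + pivotCLM ι (K₂ s (u s))) := by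
    filter_upwards [hae, hlt] with t h1 h2
    rw [h1]
    exact (hloc t h2).eq t ⟨h2.1, le_rfl⟩
  obtain ⟨w', hw', -⟩ := exists_isEvol_energy hι hd hβ.le hu2 m1 m2 hfin
  exact ⟨w', u, hw'⟩

/-- Global existence under coercivity. -/
theorem IsParabolic.exists_isEvol {ι : V →L[ℝ] H} (hι : Function.Injective ι)
    (hd : DenseRange ι) {T : ℝ} (hT : 0 < T) {K₁ : ℝ → V → StrongDual ℝ V} {K₂ : ℝ → V → H}
    (h : IsParabolic ι T K₁ K₂) {θ : ℝ} (hθ : 0 < θ) {m p : ℝ → ℝ}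
    (hm : Integrable m (volume.restrict (Icc 0 T))) (hp : Integrable p (volume.restrict (Icc 0 T)))
    (hm0 : ∀ t, 0 ≤ m t) (hp0 : ∀ t, 0 ≤ p t)
    (hco : ∀ t ∈ Icc 0 T, ∀ v, K₁ t v v + inner ℝ (K₂ t v) (ι v) ≤
      -θ * ‖v‖ ^ 2 + m t * ‖ι v‖ ^ 2 + p t) (x : H) :
    ∃ w u, IsEvol ι 0 T x (fun t => K₁ t (u t)) (fun t => K₂ t (u t)) w u := by
  set R₀ := (‖x‖ ^ 2 + 2 * ∫ s in Icc 0 T, p s) * Real.exp (2 * ∫ s in Icc 0 T, m s) with hR₀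
  have hbound : ∀ b ∈ Icc 0 T, ∀ w u,
      IsEvol ι 0 b x (fun t => K₁ t (u t)) (fun t => K₂ t (u t)) w u →
      ∀ t ∈ Icc 0 b, ‖w t‖ ^ 2 + 2 * θ * ∫ s in (0 : ℝ)..t, ‖u s‖ ^ 2 ≤ R₀ := by
    intro b hb w u hwu t ht
    have hsub : Icc 0 b ⊆ Icc 0 T := Icc_subset_Icc_right hb.2
    have hle := restrict_Icc_le le_rfl hb.2
    refine (hwu.apriori hι hd hθ (hm.mono_measure hle) (hp.mono_measure hle) hm0 hp0
      (fun s hs => hco s (hsub hs)) ht).trans ?_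
    have h1 : ∫ s in Icc 0 b, p s ≤ ∫ s in Icc 0 T, p s :=
      setIntegral_mono_set hp (Eventually.of_forall hp0) hsub.eventuallyLE
    have h2 : ∫ s in Icc 0 b, m s ≤ ∫ s in Icc 0 T, m s :=
      setIntegral_mono_set hm (Eventually.of_forall hm0) hsub.eventuallyLE
    have h3 : 0 ≤ ∫ s in Icc 0 T, p s := integral_nonneg hp0
    rw [hR₀]
    gcongr
  set R := max (√R₀) (R₀ / (2 * θ)) with hR
  have hbound' : ∀ b ∈ Icc 0 T, ∀ w u,
      IsEvol ι 0 b x (fun t => K₁ t (u t)) (fun t => K₂ t (u t)) w u →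
      (∀ t ∈ Icc 0 b, ‖w t‖ ≤ R) ∧ ∫ s in (0 : ℝ)..b, ‖u s‖ ^ 2 ≤ R := by
    intro b hb w u hwu
    constructor
    · intro t ht
      have h1 := hbound b hb w u hwu t ht
      have h2 : 0 ≤ ∫ s in (0 : ℝ)..t, ‖u s‖ ^ 2 :=
        intervalIntegral.integral_nonneg ht.1 fun s _ => by positivity
      have h3 : 0 ≤ 2 * θ * ∫ s in (0 : ℝ)..t, ‖u s‖ ^ 2 := by positivity
      exact (Real.le_sqrt_of_sq_le (by linarith)).trans (le_max_left _ _)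
    · have h1 := hbound b hb w u hwu b ⟨hb.1, le_rfl⟩
      refine le_trans ?_ (le_max_right _ _)
      rw [le_div_iff₀ (by positivity)]
      nlinarith [sq_nonneg ‖w b‖]
  set S : Set ℝ := {b | b ∈ Icc 0 T ∧ ∃ w u,
    IsEvol ι 0 b x (fun t => K₁ t (u t)) (fun t => K₂ t (u t)) w u} with hS
  obtain ⟨b₀, hb₀, hb₀T, hsol₀⟩ := h.exists_local hι hd le_rfl hT x
  have hb₀S : b₀ ∈ S := ⟨⟨hb₀.le, hb₀T⟩, hsol₀⟩
  have hbdd : BddAbove S := ⟨T, fun b hb => hb.1.2⟩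
  set β := sSup S with hβ
  have hβ0 : 0 < β := hb₀.trans_le (le_csSup hbdd hb₀S)
  have hβT : β ≤ T := csSup_le ⟨b₀, hb₀S⟩ fun b hb => hb.1.2
  obtain ⟨w, u, hwu⟩ := h.exists_isEvol_of_forall_lt hι hd hβ0 hβT (x := x) (R := R)
    (fun b hb => by
      obtain ⟨b', ⟨hb'1, w, u, hwu⟩, hb'2⟩ := exists_lt_of_lt_csSup ⟨b₀, hb₀S⟩ hb.2
      exact ⟨w, u, hwu.mono hb'2.le⟩)
    (fun b hb => hbound' b ⟨hb.1, hb.2.le.trans hβT⟩)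
  rcases hβT.eq_or_lt with h1 | h1
  · rw [h1] at hwu
    exact ⟨w, u, hwu⟩
  · obtain ⟨b', hb', hb'T, w', u', hwu'⟩ := h.exists_local hι hd hβ0.le h1 (w β)
    obtain ⟨w'', u'', hwu''⟩ := hwu.exists_glue hι hd hβ0.le hb'.le hwu'
    have : b' ∈ S := ⟨⟨hβ0.le.trans hb'.le, hb'T⟩, w'', u'', hwu''⟩
    exact absurd (le_csSup hbdd this) (not_le.mpr hb')

/-- The bound in the norm of `C([0,T];H) ∩ L²(0,T;V)` that follows from coercivity. -/
theorem IsEvol.norm_add_le {ι : V →L[ℝ] H} (hι : Function.Injective ι) (hd : DenseRange ι)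
    {b θ : ℝ} {K₁ : ℝ → V → StrongDual ℝ V} {K₂ : ℝ → V → H} (hb : 0 ≤ b) (hθ : 0 < θ)
    {m p : ℝ → ℝ}
    (hm : Integrable m (volume.restrict (Icc 0 b))) (hp : Integrable p (volume.restrict (Icc 0 b)))
    (hm0 : ∀ t, 0 ≤ m t) (hp0 : ∀ t, 0 ≤ p t)
    (hco : ∀ t ∈ Icc 0 b, ∀ v, K₁ t v v + inner ℝ (K₂ t v) (ι v) ≤
      -θ * ‖v‖ ^ 2 + m t * ‖ι v‖ ^ 2 + p t) {x : H} {w : ℝ → H} {u : ℝ → V}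
    (hu : IsEvol ι 0 b x (fun t => K₁ t (u t)) (fun t => K₂ t (u t)) w u) {P : ℝ} (hP : 0 ≤ P)
    (hPp : ∫ s in Icc 0 b, p s = P ^ 2) {t : ℝ} (ht : t ∈ Icc 0 b) :
    ‖w t‖ + (eLpNorm u 2 (volume.restrict (Icc 0 b))).toReal ≤
      √(2 + 1 / θ) * (‖x‖ + √2 * P) * Real.exp (∫ s in Icc 0 b, m s) := by
  set Y := (eLpNorm u 2 (volume.restrict (Icc 0 b))).toReal with hY
  set e := Real.exp (∫ s in Icc 0 b, m s) with he
  have h1 := hu.apriori hι hd hθ hm hp hm0 hp0 hco ht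
  have h2 := hu.apriori hι hd hθ hm hp hm0 hp0 hco (t := b) ⟨hb, le_rfl⟩
  rw [intervalIntegral.integral_of_le hb, ← integral_Icc_eq_integral_Ioc,
    ← toReal_eLpNorm_two_sq hu.memV, ← hY] at h2
  have h3 : 0 ≤ 2 * θ * ∫ s in (0 : ℝ)..t, ‖u s‖ ^ 2 :=
    mul_nonneg (by positivity) (intervalIntegral.integral_nonneg ht.1 fun s _ => by positivity)
  have he2 : Real.exp (2 * ∫ s in Icc 0 b, m s) = e ^ 2 := by
    rw [he, ← Real.exp_nat_mul]; norm_num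
  rw [hPp, he2] at h1 h2
  set Z := ‖x‖ + √2 * P with hZ
  have hZ0 : 0 ≤ Z := by positivity
  have hRZ : ‖x‖ ^ 2 + 2 * P ^ 2 ≤ Z ^ 2 := by
    have h4 : Z ^ 2 = ‖x‖ ^ 2 + 2 * P ^ 2 + 2 * ‖x‖ * (√2 * P) := by
      rw [hZ, add_sq, mul_pow, Real.sq_sqrt two_pos.le]; ring
    have : 0 ≤ 2 * ‖x‖ * (√2 * P) := by positivity
    linarith
  have hD : (‖x‖ ^ 2 + 2 * P ^ 2) * e ^ 2 ≤ (Z * e) ^ 2 := by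
    rw [mul_pow]; gcongr
  have hw : ‖w t‖ ^ 2 ≤ (Z * e) ^ 2 := by linarith
  have hYY : Y ^ 2 ≤ 1 / (2 * θ) * (Z * e) ^ 2 := by
    rw [one_div, ← div_eq_inv_mul, le_div_iff₀ (by positivity)]
    nlinarith [sq_nonneg ‖w b‖]
  refine abs_le_of_sq_le_sq' ?_ (by positivity) |>.2
  rw [mul_assoc, mul_pow, Real.sq_sqrt (by positivity)]
  have h5 : (2 + 1 / θ) * (Z * e) ^ 2 = 2 * ((Z * e) ^ 2 + 1 / (2 * θ) * (Z * e) ^ 2) := by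
    field_simp
  rw [h5]
  nlinarith [sq_nonneg (‖w t‖ - Y)]

end Continuation

/-! ### The critical variational setting as a parabolic problem -/

section Critical

open Filter Topology

variable {V H U : Type*} [NormedAddCommGroup V] [InnerProductSpace ℝ V] [CompleteSpace V]
  [NormedAddCommGroup H] [InnerProductSpace ℝ H] [CompleteSpace H]
  [NormedAddCommGroup U] [InnerProductSpace ℝ U] [CompleteSpace U]

theorem aestronglyMeasurable_comp_Ici {E X : Type*} [TopologicalSpace E]
    [TopologicalSpace.PseudoMetrizableSpace E] [NormedAddCommGroup X] [MeasurableSpace X]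
    [BorelSpace X] {Φ : ℝ → X → E} (hΦ : StronglyMeasurable fun p : Ici (0 : ℝ) × X => Φ p.1 p.2)
    {a b : ℝ} (ha : 0 ≤ a) {u : ℝ → X}
    (hu : AEStronglyMeasurable u (volume.restrict (Icc a b))) :
    AEStronglyMeasurable (fun t => Φ t (u t)) (volume.restrict (Icc a b)) := by
  have h1 : Measurable fun t : ℝ =>
      ((⟨max t 0, mem_Ici.2 (le_max_right t 0)⟩ : Ici (0 : ℝ)), hu.mk u t) :=
    ((measurable_id.max measurable_const).subtype_mk).prodMk hu.stronglyMeasurable_mk.measurable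
  refine ⟨_, hΦ.comp_measurable h1, ?_⟩
  filter_upwards [hu.ae_eq_mk, ae_restrict_mem measurableSet_Icc] with t h2 h3
  simp only [Function.comp_apply]
  rw [← h2, max_eq_left (ha.trans h3.1)]

/-- Measurability in the operator argument for each fixed vector is enough, by separability of `V`:
the family is continuous in the vector. -/
theorem stronglyMeasurable_uncurry_clm {E X Y : Type*} [NormedAddCommGroup E] [NormedSpace ℝ E]
    [NormedAddCommGroup Y] [NormedSpace ℝ Y] [TopologicalSpace.SeparableSpace Y]
    [MeasurableSpace Y] [BorelSpace Y] [MeasurableSpace X] {Φ : X → Y →L[ℝ] E}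
    (hΦ : ∀ v, StronglyMeasurable fun p => Φ p v) :
    StronglyMeasurable fun q : X × Y => Φ q.1 q.2 := by
  have h1 : StronglyMeasurable (Function.uncurry fun (v : Y) (p : X) => Φ p v) := by
    refine stronglyMeasurable_uncurry_of_continuous_of_stronglyMeasurable (fun p => ?_) hΦ
    exact (Φ p).continuous
  exact h1.comp_measurable measurable_swap

/-- The growth and Lipschitz conditions with the interpolation norms estimated by the norms of `V`
and `H`; (sub)criticality is what makes the top order part arbitrarily small. -/
theorem exists_lipschitz_bounds {ι : V →L[ℝ] H} (hι : Function.Injective ι)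
    {A₀ : ℝ → H → V →L[ℝ] StrongDual ℝ V} {B₀ : ℝ → H → V →L[ℝ] HilbertSchmidt U H}
    {F : ℝ → V → StrongDual ℝ V} {G : ℝ → V → HilbertSchmidt U H} {mF mG : ℕ} {ρ β : ℕ → ℝ}
    (hβ : ∀ j ∈ Finset.Icc 1 (mF + mG),
        0 ≤ ρ j ∧ β j ∈ Ioo (1 / 2 : ℝ) 1 ∧ 2 * β j ≤ 1 + 1 / (1 + ρ j))
    {T n C : ℝ} (hn : 0 ≤ n)
    (hC : ∀ t ∈ Icc 0 T, ∀ u v w : V, ‖ι u‖ ≤ n → ‖ι v‖ ≤ n →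
          ‖A₀ t (ι u) w‖ ≤ C * (1 + ‖ι u‖) * ‖w‖ ∧
          ‖A₀ t (ι u) w - A₀ t (ι v) w‖ ≤ C * ‖ι u - ι v‖ * ‖w‖ ∧
          ‖B₀ t (ι u) w‖ ≤ C * (1 + ‖ι u‖) * ‖w‖ ∧
          ‖B₀ t (ι u) w - B₀ t (ι v) w‖ ≤ C * ‖ι u - ι v‖ * ‖w‖ ∧
          ‖F t u‖ ≤ C * ∑ j ∈ Finset.Icc 1 mF, (1 + interpNorm ι (β j) u ^ (ρ j + 1)) ∧
          ‖F t u - F t v‖ ≤ C * ∑ j ∈ Finset.Icc 1 mF,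
            (1 + interpNorm ι (β j) u ^ ρ j + interpNorm ι (β j) v ^ ρ j) *
              interpNorm ι (β j) (u - v) ∧
          ‖G t u‖ ≤ C * ∑ j ∈ Finset.Icc (mF + 1) (mF + mG),
            (1 + interpNorm ι (β j) u ^ (ρ j + 1)) ∧
          ‖G t u - G t v‖ ≤ C * ∑ j ∈ Finset.Icc (mF + 1) (mF + mG),
            (1 + interpNorm ι (β j) u ^ ρ j + interpNorm ι (β j) v ^ ρ j) *
              interpNorm ι (β j) (u - v)) :
    ∃ D : ℝ, 0 ≤ D ∧ (∀ t ∈ Icc 0 T, ‖F t 0‖ ≤ D ∧ ‖G t 0‖ ≤ D) ∧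
      (∀ t ∈ Icc 0 T, ∀ u v w : V, ‖ι u‖ ≤ n → ‖ι v‖ ≤ n →
        ‖A₀ t (ι u) w‖ ≤ D * ‖w‖ ∧ ‖A₀ t (ι u) w - A₀ t (ι v) w‖ ≤ D * ‖ι (u - v)‖ * ‖w‖ ∧
        ‖B₀ t (ι u) w‖ ≤ D * ‖w‖ ∧ ‖B₀ t (ι u) w - B₀ t (ι v) w‖ ≤ D * ‖ι (u - v)‖ * ‖w‖) ∧
      ∀ η : ℝ, 0 < η → ∃ K : ℝ, 0 ≤ K ∧ ∀ t ∈ Icc 0 T, ∀ u v : V, ‖ι u‖ ≤ n → ‖ι v‖ ≤ n →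
        ‖F t u - F t v‖ ≤ η * ‖u - v‖ + K * (‖ι (u - v)‖ * (1 + ‖u‖ + ‖v‖)) ∧
        ‖G t u - G t v‖ ≤ η * ‖u - v‖ + K * (‖ι (u - v)‖ * (1 + ‖u‖ + ‖v‖)) := by
  have h0 : ‖ι 0‖ ≤ n := by simpa using hn
  set cF := C * ∑ j ∈ Finset.Icc 1 mF, (1 + interpNorm ι (β j) 0 ^ (ρ j + 1))
  set cG := C * ∑ j ∈ Finset.Icc (mF + 1) (mF + mG), (1 + interpNorm ι (β j) 0 ^ (ρ j + 1))
  have hCn : C ≤ |C| * (1 + n) := by nlinarith [le_abs_self C, abs_nonneg C]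
  have hCg : ∀ u w : V, ‖ι u‖ ≤ n → C * (1 + ‖ι u‖) * ‖w‖ ≤
      (|C| * (1 + n) + |cF| + |cG|) * ‖w‖ := by
    intro u w hu
    have h1 : C * (1 + ‖ι u‖) ≤ |C| * (1 + n) := by
      have := le_abs_self C
      gcongr
    have := abs_nonneg cF
    have := abs_nonneg cG
    gcongr
    linarith
  have hCl : ∀ u v w : V, C * ‖ι u - ι v‖ * ‖w‖ ≤
      (|C| * (1 + n) + |cF| + |cG|) * ‖ι (u - v)‖ * ‖w‖ := by
    intro u v w
    rw [map_sub]
    have := abs_nonneg cF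
    have := abs_nonneg cG
    gcongr
    linarith
  refine ⟨|C| * (1 + n) + |cF| + |cG|, by positivity, fun t ht => ?_, fun t ht u v w hu hv => ?_,
    fun η hη => ?_⟩
  · obtain ⟨-, -, -, -, h5, -, h7, -⟩ := hC t ht 0 0 0 h0 h0
    have : 0 ≤ |C| * (1 + n) := by positivity
    have e1 : ‖F t 0‖ ≤ cF := h5
    have e2 : ‖G t 0‖ ≤ cG := h7
    constructor
    · linarith [le_abs_self cF, abs_nonneg cG]
    · linarith [le_abs_self cG, abs_nonneg cF]
  · obtain ⟨h1, h2, h3, h4, -⟩ := hC t ht u v w hu hv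
    exact ⟨h1.trans (hCg u w hu), h2.trans (hCl u v w), h3.trans (hCg u w hu),
      h4.trans (hCl u v w)⟩
  · obtain ⟨K₁, hK₁, h1⟩ := exists_sum_interp_lipschitz_le hι
      (s := Finset.Icc 1 mF) (fun j hj => hβ j (by
        rw [Finset.mem_Icc] at hj ⊢; omega)) hn C hη
    obtain ⟨K₂, hK₂, h2⟩ := exists_sum_interp_lipschitz_le hι
      (s := Finset.Icc (mF + 1) (mF + mG)) (fun j hj => hβ j (by
        rw [Finset.mem_Icc] at hj ⊢; omega)) hn C hη
    refine ⟨max K₁ K₂, hK₁.trans (le_max_left _ _), fun t ht u v hu hv => ?_⟩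
    obtain ⟨-, -, -, -, -, h6, -, h8⟩ := hC t ht u v 0 hu hv
    refine ⟨(h6.trans (h1 u v hu hv)).trans ?_, (h8.trans (h2 u v hu hv)).trans ?_⟩
    · gcongr; exact le_max_left _ _
    · gcongr; exact le_max_right _ _

end Critical

section CriticalParabolic

open Filter Topology

variable {V H U : Type*} [NormedAddCommGroup V] [InnerProductSpace ℝ V] [CompleteSpace V]
  [NormedAddCommGroup H] [InnerProductSpace ℝ H] [CompleteSpace H]
  [NormedAddCommGroup U] [InnerProductSpace ℝ U] [CompleteSpace U]

/-- The local coercivity, growth and Lipschitz conditions on `[0, T]`, for arguments in the ball of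
radius `n` of `H`, in terms of the norms of `V` and `H` only. -/
structure IsQuasilinearOn (ι : V →L[ℝ] H) (T n : ℝ) (A₀ : ℝ → H → V →L[ℝ] StrongDual ℝ V)
    (B₀ : ℝ → H → V →L[ℝ] HilbertSchmidt U H) (F : ℝ → V → StrongDual ℝ V)
    (G : ℝ → V → HilbertSchmidt U H) (θ M D : ℝ) : Prop where
  θ_pos : 0 < θ
  M_nonneg : 0 ≤ M
  D_nonneg : 0 ≤ D
  coercive : ∀ t ∈ Icc 0 T, ∀ (u : H) (v : V), ‖u‖ ≤ n →
    θ * ‖v‖ ^ 2 - M * ‖ι v‖ ^ 2 ≤ A₀ t u v v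
  zero_le : ∀ t ∈ Icc 0 T, ‖F t 0‖ ≤ D ∧ ‖G t 0‖ ≤ D
  lip : ∀ t ∈ Icc 0 T, ∀ u v w : V, ‖ι u‖ ≤ n → ‖ι v‖ ≤ n →
    ‖A₀ t (ι u) w‖ ≤ D * ‖w‖ ∧ ‖A₀ t (ι u) w - A₀ t (ι v) w‖ ≤ D * ‖ι (u - v)‖ * ‖w‖ ∧
    ‖B₀ t (ι u) w‖ ≤ D * ‖w‖ ∧ ‖B₀ t (ι u) w - B₀ t (ι v) w‖ ≤ D * ‖ι (u - v)‖ * ‖w‖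
  lip_lower : ∀ η : ℝ, 0 < η → ∃ K : ℝ, 0 ≤ K ∧ ∀ t ∈ Icc 0 T, ∀ u v : V, ‖ι u‖ ≤ n → ‖ι v‖ ≤ n →
    ‖F t u - F t v‖ ≤ η * ‖u - v‖ + K * (‖ι (u - v)‖ * (1 + ‖u‖ + ‖v‖)) ∧
    ‖G t u - G t v‖ ≤ η * ‖u - v‖ + K * (‖ι (u - v)‖ * (1 + ‖u‖ + ‖v‖))

section Estimates

variable {ι : V →L[ℝ] H} {T n θ M D : ℝ} {A₀ : ℝ → H → V →L[ℝ] StrongDual ℝ V}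
  {B₀ : ℝ → H → V →L[ℝ] HilbertSchmidt U H} {F : ℝ → V → StrongDual ℝ V}
  {G : ℝ → V → HilbertSchmidt U H}

theorem IsQuasilinearOn.norm_drift_le (h : IsQuasilinearOn ι T n A₀ B₀ F G θ M D) (hn : 0 ≤ n) :
    ∃ C : ℝ, ∀ t ∈ Icc 0 T, ∀ v : V, ‖ι v‖ ≤ n →
      ‖-(A₀ t (ι v) v) + F t v‖ ≤ C + C * ‖v‖ := by
  obtain ⟨K, hK, hl⟩ := h.lip_lower 1 one_pos
  refine ⟨D + (1 + K * n), fun t ht v hv => ?_⟩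
  obtain ⟨h1, -⟩ := h.lip t ht v v v hv hv
  obtain ⟨h2, -⟩ := hl t ht v 0 hv (by simpa using hn)
  obtain ⟨h3, -⟩ := h.zero_le t ht
  rw [sub_zero, norm_zero, add_zero] at h2
  have h4 : ‖F t v‖ ≤ ‖F t v - F t 0‖ + ‖F t 0‖ := norm_le_norm_sub_add _ _
  have h5 : K * (‖ι v‖ * (1 + ‖v‖)) ≤ K * (n * (1 + ‖v‖)) := by gcongr
  refine (norm_add_le _ _).trans ?_
  rw [norm_neg]
  linarith [norm_nonneg v]

theorem IsQuasilinearOn.norm_diffusion_sub_le (h : IsQuasilinearOn ι T n A₀ B₀ F G θ M D) :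
    ∃ C : ℝ, 0 ≤ C ∧ ∀ t ∈ Icc 0 T, ∀ u v : V, ‖ι u‖ ≤ n → ‖ι v‖ ≤ n →
      ‖(B₀ t (ι u) u + G t u) - (B₀ t (ι v) v + G t v)‖ ≤
        C * (‖u - v‖ + ‖ι (u - v)‖ * (1 + ‖u‖ + ‖v‖)) := by
  obtain ⟨K, hK, hl⟩ := h.lip_lower 1 one_pos
  have hD := h.D_nonneg
  refine ⟨D + 1 + K, by positivity, fun t ht u v hu hv => ?_⟩
  obtain ⟨-, -, h1, -⟩ := h.lip t ht u v (u - v) hu hv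
  obtain ⟨-, -, -, h2⟩ := h.lip t ht u v v hu hv
  obtain ⟨-, h3⟩ := hl t ht u v hu hv
  have e : (B₀ t (ι u) u + G t u) - (B₀ t (ι v) v + G t v) =
      B₀ t (ι u) (u - v) + (B₀ t (ι u) v - B₀ t (ι v) v) + (G t u - G t v) := by
    rw [map_sub]; abel
  rw [e]
  have h4 := norm_add₃_le (a := B₀ t (ι u) (u - v)) (b := B₀ t (ι u) v - B₀ t (ι v) v)
    (c := G t u - G t v)
  have p1 : 0 ≤ D * ‖ι (u - v)‖ * (1 + ‖u‖) := by positivity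
  have p2 : 0 ≤ ‖ι (u - v)‖ * (1 + ‖u‖ + ‖v‖) := by positivity
  have p3 : 0 ≤ K * ‖u - v‖ := by positivity
  linarith

/-- The drift minus its linearization at the frozen coefficient `A₀(t, v₀)`: the leading error
`(A₀(t, u) - A₀(t, v₀)) (u - v)` is small because `u` stays close to `v₀` in `H`, the lower order
term because of (sub)criticality. The multiple `M` of the pivot embedding makes the linear operator
coercive. -/
theorem IsQuasilinearOn.frozen (h : IsQuasilinearOn ι T n A₀ B₀ F G θ M D) {lam : ℝ}
    (hlam : 0 < lam) :
    ∃ r L : ℝ, 0 < r ∧ 0 ≤ L ∧ ∀ t ∈ Icc 0 T, ∀ u v v₀ : V, ‖ι u‖ ≤ n → ‖ι v‖ ≤ n → ‖ι v₀‖ ≤ n →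
      ‖ι u - ι v₀‖ ≤ r →
      ‖(A₀ t (ι v₀) (u - v) + M • pivotCLM ι (ι (u - v))) +
        ((-(A₀ t (ι u) u) + F t u) - (-(A₀ t (ι v) v) + F t v))‖ ≤
          lam * ‖u - v‖ + L * ‖ι (u - v)‖ * (1 + ‖u‖ + ‖v‖) := by
  obtain ⟨K, hK, hl⟩ := h.lip_lower (lam / 2) (by positivity)
  have hD := h.D_nonneg
  have hM := h.M_nonneg
  refine ⟨lam / (2 * (D + 1)), D + M * ‖ι‖ + K, by positivity, by positivity,
    fun t ht u v v₀ hu hv hv₀ hr => ?_⟩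
  obtain ⟨-, h1, -⟩ := h.lip t ht v₀ u (u - v) hv₀ hu
  obtain ⟨-, h2, -⟩ := h.lip t ht v u v hv hu
  obtain ⟨h3, -⟩ := hl t ht u v hu hv
  have h4 : ‖M • pivotCLM ι (ι (u - v))‖ ≤ M * (‖ι‖ * ‖ι (u - v)‖) := by
    rw [norm_smul, Real.norm_of_nonneg hM]
    gcongr
    exact norm_pivotCLM_apply_le _ _
  have e : (A₀ t (ι v₀) (u - v) + M • pivotCLM ι (ι (u - v))) +
        ((-(A₀ t (ι u) u) + F t u) - (-(A₀ t (ι v) v) + F t v)) =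
      ((A₀ t (ι v₀) (u - v) - A₀ t (ι u) (u - v)) + (A₀ t (ι v) v - A₀ t (ι u) v)) +
        (M • pivotCLM ι (ι (u - v)) + (F t u - F t v)) := by
    rw [map_sub (A₀ t (ι u))]; abel
  rw [e]
  have h5 := norm_add_le ((A₀ t (ι v₀) (u - v) - A₀ t (ι u) (u - v)) +
    (A₀ t (ι v) v - A₀ t (ι u) v)) (M • pivotCLM ι (ι (u - v)) + (F t u - F t v))
  have h6 := norm_add_le (A₀ t (ι v₀) (u - v) - A₀ t (ι u) (u - v))
    (A₀ t (ι v) v - A₀ t (ι u) v)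
  have h7 := norm_add_le (M • pivotCLM ι (ι (u - v))) (F t u - F t v)
  have h8 : D * ‖ι (v₀ - u)‖ * ‖u - v‖ ≤ lam / 2 * ‖u - v‖ := by
    gcongr
    rw [map_sub, norm_sub_rev]
    calc D * ‖ι u - ι v₀‖ ≤ (D + 1) * (lam / (2 * (D + 1))) := by gcongr; linarith
      _ = lam / 2 := by field_simp
  have h9 : ‖ι (v - u)‖ = ‖ι (u - v)‖ := by rw [← norm_neg, ← map_neg, neg_sub]
  rw [h9] at h2
  have p1 : 0 ≤ D * ‖ι (u - v)‖ * (1 + ‖u‖) := by positivity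
  have p2 : 0 ≤ M * ‖ι‖ * ‖ι (u - v)‖ * (‖u‖ + ‖v‖) := by positivity
  linarith

/-- Local monotonicity of the drift, with a weight that is integrable along solutions. -/
theorem IsQuasilinearOn.monotone (h : IsQuasilinearOn ι T n A₀ B₀ F G θ M D) :
    ∃ W : ℝ, 0 ≤ W ∧ ∀ t ∈ Icc 0 T, ∀ u v : V, ‖ι u‖ ≤ n → ‖ι v‖ ≤ n →
      ((-(A₀ t (ι u) u) + F t u) - (-(A₀ t (ι v) v) + F t v)) (u - v) ≤
        -(θ / 2) * ‖u - v‖ ^ 2 + W * ‖ι (u - v)‖ ^ 2 * (1 + ‖u‖ ^ 2 + ‖v‖ ^ 2) := by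
  have hθ := h.θ_pos
  obtain ⟨K, hK, hl⟩ := h.lip_lower (θ / 4) (by positivity)
  have hD := h.D_nonneg
  have hM := h.M_nonneg
  refine ⟨M + 3 * (D + K) ^ 2 / θ, by positivity, fun t ht u v hu hv => ?_⟩
  have h1 := h.coercive t ht (ι u) (u - v) hu
  obtain ⟨-, h2, -⟩ := h.lip t ht v u v hv hu
  obtain ⟨h3, -⟩ := hl t ht u v hu hv
  have h9 : ‖ι (v - u)‖ = ‖ι (u - v)‖ := by rw [← norm_neg, ← map_neg, neg_sub]
  rw [h9] at h2
  have e : ((-(A₀ t (ι u) u) + F t u) - (-(A₀ t (ι v) v) + F t v)) (u - v) =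
      -(A₀ t (ι u) (u - v) (u - v)) + ((A₀ t (ι v) v - A₀ t (ι u) v) (u - v) +
        (F t u - F t v) (u - v)) := by
    have : (-(A₀ t (ι u) u) + F t u) - (-(A₀ t (ι v) v) + F t v) =
      -(A₀ t (ι u) (u - v)) + ((A₀ t (ι v) v - A₀ t (ι u) v) + (F t u - F t v)) := by
      rw [map_sub (A₀ t (ι u))]; abel
    rw [this]; rfl
  rw [e]
  have h4 : (A₀ t (ι v) v - A₀ t (ι u) v) (u - v) ≤ D * ‖ι (u - v)‖ * ‖v‖ * ‖u - v‖ :=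
    (Real.le_norm_self _).trans ((ContinuousLinearMap.le_opNorm _ _).trans (by gcongr))
  have h5 : (F t u - F t v) (u - v) ≤
      (θ / 4 * ‖u - v‖ + K * (‖ι (u - v)‖ * (1 + ‖u‖ + ‖v‖))) * ‖u - v‖ :=
    (Real.le_norm_self _).trans ((ContinuousLinearMap.le_opNorm _ _).trans (by gcongr))
  have hq0 := norm_nonneg (ι (u - v))
  have hp0 := norm_nonneg (u - v)
  generalize ‖ι (u - v)‖ = q at *
  generalize ‖u - v‖ = p at *
  have hu0 := norm_nonneg u
  have hv0 := norm_nonneg v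
  generalize ‖u‖ = a at *
  generalize ‖v‖ = b at *
  have h6 : (D + K) * q * (1 + a + b) * p ≤
      θ / 4 * p ^ 2 + 3 * (D + K) ^ 2 / θ * q ^ 2 * (1 + a ^ 2 + b ^ 2) := by
    have e1 : θ / 4 * p ^ 2 + (D + K) ^ 2 / θ * q ^ 2 * (1 + a + b) ^ 2 -
        (D + K) * q * (1 + a + b) * p =
        θ * (p / 2 - (D + K) * q * (1 + a + b) / θ) ^ 2 := by field_simp; ring
    have e2 : 0 ≤ θ * (p / 2 - (D + K) * q * (1 + a + b) / θ) ^ 2 := by positivity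
    have e3 : (1 + a + b) ^ 2 ≤ 3 * (1 + a ^ 2 + b ^ 2) := by
      nlinarith [sq_nonneg (1 - a), sq_nonneg (1 - b), sq_nonneg (a - b)]
    have e4 : (D + K) ^ 2 / θ * q ^ 2 * (1 + a + b) ^ 2 ≤
        (D + K) ^ 2 / θ * q ^ 2 * (3 * (1 + a ^ 2 + b ^ 2)) := by gcongr
    have e5 : (D + K) ^ 2 / θ * q ^ 2 * (3 * (1 + a ^ 2 + b ^ 2)) =
      3 * (D + K) ^ 2 / θ * q ^ 2 * (1 + a ^ 2 + b ^ 2) := by ring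
    linarith
  have h7 : 0 ≤ D * q * (1 + a) * p := by positivity
  have h8 : 0 ≤ M * q ^ 2 * (a ^ 2 + b ^ 2) := by positivity
  linarith

end Estimates

/-- Local bounds on all balls of `H` make the skeleton equation parabolic; the control `ψ` enters
only through the square integrable weight `κ` of the diffusion term. -/
theorem isParabolic_of_isQuasilinearOn [TopologicalSpace.SeparableSpace V] [MeasurableSpace V]
    [BorelSpace V] [MeasurableSpace H] [BorelSpace H] {ι : V →L[ℝ] H} {T : ℝ}
    {A₀ : ℝ → H → V →L[ℝ] StrongDual ℝ V} {B₀ : ℝ → H → V →L[ℝ] HilbertSchmidt U H}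
    {F : ℝ → V → StrongDual ℝ V} {G : ℝ → V → HilbertSchmidt U H}
    {f : ℝ → StrongDual ℝ V} {g : ℝ → HilbertSchmidt U H} {ψ : ℝ → U}
    (hA : ∀ v : V, StronglyMeasurable fun p : Ici (0 : ℝ) × H => A₀ p.1 p.2 v)
    (hB : ∀ v : V, StronglyMeasurable fun p : Ici (0 : ℝ) × H => B₀ p.1 p.2 v)
    (hF : StronglyMeasurable fun p : Ici (0 : ℝ) × V => F p.1 p.2)
    (hG : StronglyMeasurable fun p : Ici (0 : ℝ) × V => G p.1 p.2)
    (hf : MemLp f 2 (volume.restrict (Icc 0 T))) (hg : MemLp g 2 (volume.restrict (Icc 0 T)))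
    (hψ : MemLp ψ 2 (volume.restrict (Icc 0 T)))
    (h : ∀ n : ℝ, 0 ≤ n → ∃ θ M D, IsQuasilinearOn ι T n A₀ B₀ F G θ M D) :
    IsParabolic ι T (fun t v => -(A₀ t (ι v) v) + F t v + f t)
      (fun t v => HilbertSchmidt.toCLM (B₀ t (ι v) v + G t v + g t) (ψ t)) := by
  have hmA : StronglyMeasurable fun p : Ici (0 : ℝ) × V => A₀ p.1 (ι p.2) p.2 := by
    have h1 := stronglyMeasurable_uncurry_clm (Φ := fun p : Ici (0 : ℝ) × H => A₀ p.1 p.2) hA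
    have h2 : Measurable fun p : Ici (0 : ℝ) × V => (((p.1, ι p.2) : Ici (0 : ℝ) × H), p.2) :=
      (measurable_fst.prodMk (ι.continuous.measurable.comp measurable_snd)).prodMk measurable_snd
    exact h1.comp_measurable h2
  have hmB : StronglyMeasurable fun p : Ici (0 : ℝ) × V => B₀ p.1 (ι p.2) p.2 := by
    have h1 := stronglyMeasurable_uncurry_clm (Φ := fun p : Ici (0 : ℝ) × H => B₀ p.1 p.2) hB
    have h2 : Measurable fun p : Ici (0 : ℝ) × V => (((p.1, ι p.2) : Ici (0 : ℝ) × H), p.2) :=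
      (measurable_fst.prodMk (ι.continuous.measurable.comp measurable_snd)).prodMk measurable_snd
    exact h1.comp_measurable h2
  have hmA₀ : ∀ v₀ : V, StronglyMeasurable fun p : Ici (0 : ℝ) × V => A₀ p.1 (ι v₀) p.2 := by
    intro v₀
    have h1 := stronglyMeasurable_uncurry_clm (Φ := fun p : Ici (0 : ℝ) × H => A₀ p.1 p.2) hA
    have h2 : Measurable fun p : Ici (0 : ℝ) × V => (((p.1, ι v₀) : Ici (0 : ℝ) × H), p.2) :=
      (measurable_fst.prodMk measurable_const).prodMk measurable_snd
    exact h1.comp_measurable h2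
  have hmeas2 : ∀ a b : ℝ, 0 ≤ a → b ≤ T → ∀ u : ℝ → V,
      AEStronglyMeasurable u (volume.restrict (Icc a b)) → AEStronglyMeasurable
        (fun t => HilbertSchmidt.toCLM (B₀ t (ι (u t)) (u t) + G t (u t) + g t) (ψ t))
        (volume.restrict (Icc a b)) := by
    intro a b ha hb u hu
    exact (HilbertSchmidt.evalCLM U H).aestronglyMeasurable_comp₂
      (((aestronglyMeasurable_comp_Ici (Φ := fun t v => B₀ t (ι v) v) hmB ha hu).add
      (aestronglyMeasurable_comp_Ici hG ha hu)).add
      (hg.1.mono_measure (restrict_Icc_le ha hb))) (hψ.1.mono_measure (restrict_Icc_le ha hb))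
  refine ⟨?_, hmeas2, ?_, ?_, ?_, ?_, ?_⟩
  · intro a b ha hb u hu
    exact ((aestronglyMeasurable_comp_Ici (Φ := fun t v => A₀ t (ι v) v) hmA ha hu).neg.add
      (aestronglyMeasurable_comp_Ici hF ha hu)).add (hf.1.mono_measure (restrict_Icc_le ha hb))
  · intro n
    obtain ⟨θ, M, D, hq⟩ := h (max n 0) (le_max_right _ _)
    obtain ⟨C, hC⟩ := hq.norm_drift_le (le_max_right _ _)
    refine ⟨fun t => C + ‖f t‖, C, memLp_two_fun_add (memLp_const C) hf.norm,
      fun t ht v hv => ?_⟩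
    have h1 := hC t ht v (hv.trans (le_max_left _ _))
    have h2 := norm_add_le (-(A₀ t (ι v) v) + F t v) (f t)
    linarith
  · obtain ⟨θ, M, D, hq⟩ := h 0 le_rfl
    have h1 : MemLp (fun t => D + ‖g t‖) 2 (volume.restrict (Icc 0 T)) :=
      memLp_two_fun_add (memLp_const D) hg.norm
    refine Integrable.mono' (integrable_norm_mul h1 hψ)
      (hmeas2 0 T le_rfl le_rfl (fun _ => 0) aestronglyMeasurable_const) ?_
    filter_upwards [ae_restrict_mem measurableSet_Icc] with t ht
    refine (HilbertSchmidt.norm_toCLM_apply_le _ _).trans ?_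
    gcongr
    rw [map_zero, zero_add]
    refine ((norm_add_le _ _).trans ?_).trans (le_abs_self _)
    gcongr
    exact (hq.zero_le t ht).2
  · intro n
    obtain ⟨θ, M, D, hq⟩ := h (max n 0) (le_max_right _ _)
    obtain ⟨C, hC0, hC⟩ := hq.norm_diffusion_sub_le
    refine ⟨fun t => C * ‖ψ t‖, hψ.norm.const_mul C, fun t => by positivity,
      fun t ht u v hu hv => ?_⟩
    have h1 := hC t ht u v (hu.trans (le_max_left _ _)) (hv.trans (le_max_left _ _))
    rw [← sub_apply, ← map_sub, add_sub_add_right_eq_sub]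
    refine (HilbertSchmidt.norm_toCLM_apply_le _ _).trans ?_
    calc _ ≤ C * (‖u - v‖ + ‖ι (u - v)‖ * (1 + ‖u‖ + ‖v‖)) * ‖ψ t‖ := by gcongr
      _ = _ := by ring
  · intro n
    obtain ⟨θ, M, D, hq⟩ := h (max n 0 + 1) (by positivity)
    have hn : n ≤ max n 0 := le_max_left _ _
    refine ⟨θ, hq.θ_pos, fun lam hlam => ?_⟩
    obtain ⟨r, L, hr, hL, hfr⟩ := hq.frozen hlam
    refine ⟨min r 1, L, lt_min hr one_pos, hL, fun v₀ hv₀ => ?_⟩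
    have hv₀' : ‖ι v₀‖ ≤ max n 0 + 1 := by linarith
    refine ⟨fun t => A₀ t (ι v₀) + M • (pivotCLM ι).comp ι, D + M * (‖ι‖ * ‖ι‖),
      fun a b ha hb => ⟨fun u hu => ?_, fun t ht v => ?_⟩, fun t ht v => ?_,
      fun t ht u v hu hv => ?_⟩
    · exact (aestronglyMeasurable_comp_Ici (Φ := fun t v => A₀ t (ι v₀) v) (hmA₀ v₀) ha hu).add
        ((M • (pivotCLM ι).comp ι).continuous.comp_aestronglyMeasurable hu)
    · obtain ⟨h1, -⟩ := hq.lip t ⟨ha.trans ht.1, ht.2.trans hb⟩ v₀ v₀ v hv₀' hv₀'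
      have hM := hq.M_nonneg
      have h2 : ‖M • pivotCLM ι (ι v)‖ ≤ M * (‖ι‖ * (‖ι‖ * ‖v‖)) := by
        rw [norm_smul, Real.norm_of_nonneg hM]
        gcongr
        exact (norm_pivotCLM_apply_le _ _).trans (by gcongr; exact ι.le_opNorm v)
      refine (norm_add_le (A₀ t (ι v₀) v) (M • pivotCLM ι (ι v))).trans ?_
      linarith
    · have h1 := hq.coercive t ht (ι v₀) v hv₀'
      have h2 : (A₀ t (ι v₀) + M • (pivotCLM ι).comp ι) v v = A₀ t (ι v₀) v v + M * ‖ι v‖ ^ 2 := by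
        rw [← real_inner_self_eq_norm_sq]; rfl
      rw [h2]
      linarith
    · have hb : ∀ u : V, ‖ι u - ι v₀‖ ≤ min r 1 → ‖ι u‖ ≤ max n 0 + 1 := fun u hu => by
        have h1 := norm_le_norm_sub_add (ι u) (ι v₀)
        have h2 := hu.trans (min_le_right _ _)
        linarith
      have h1 := hfr t ht u v v₀ (hb u hu) (hb v hv) hv₀' (hu.trans (min_le_left _ _))
      rw [add_sub_add_right_eq_sub]
      exact h1
  · intro n
    obtain ⟨θ, M, D, hq⟩ := h (max n 0) (le_max_right _ _)
    obtain ⟨W, hW0, hW⟩ := hq.monotone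
    refine ⟨θ / 2, W, half_pos hq.θ_pos, hW0, fun t ht u v hu hv => ?_⟩
    rw [add_sub_add_right_eq_sub]
    exact hW t ht u v (hu.trans (le_max_left _ _)) (hv.trans (le_max_left _ _))

end CriticalParabolic

/-! ### The skeleton equation -/

section Skeleton

open Filter Topology

variable {V H U : Type*} [NormedAddCommGroup V] [InnerProductSpace ℝ V] [CompleteSpace V]
  [NormedAddCommGroup H] [InnerProductSpace ℝ H] [CompleteSpace H]
  [NormedAddCommGroup U] [InnerProductSpace ℝ U] [CompleteSpace U]

theorem CriticalVariational.exists_isParabolic [TopologicalSpace.SeparableSpace V]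
    [MeasurableSpace V] [BorelSpace V] [MeasurableSpace H] [BorelSpace H] {ι : V →L[ℝ] H}
    (hι : Function.Injective ι) {A : ℝ → V → StrongDual ℝ V} {B : ℝ → V → HilbertSchmidt U H}
    (hAB : CriticalVariational ι A B) {ψ : ℝ → U} (hψ : MemL2Loc ψ) {T : ℝ} (hT : 0 < T) :
    ∃ (K₁ : ℝ → V → StrongDual ℝ V) (K₂ : ℝ → V → H), IsParabolic ι T K₁ K₂ ∧
      (∀ t, 0 ≤ t → ∀ v, K₁ t v = -A t v) ∧
      ∀ t, 0 ≤ t → ∀ v, K₂ t v = HilbertSchmidt.toCLM (B t v) (ψ t) := by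
  obtain ⟨A₀, B₀, F, G, f, g, ⟨hA, hB, hmA, hmB, hmF, hmG, -, -, hf, hg⟩, hco, mF, mG, ρ, β, hβ,
    hlip⟩ := hAB
  refine ⟨_, _, isParabolic_of_isQuasilinearOn hmA hmB hmF hmG (hf T hT) (hg T hT) (hψ T hT)
    fun n hn => ?_, fun t ht v => ?_, fun t ht v => ?_⟩
  · obtain ⟨θ, M, hθ, hM, hco⟩ := hco T hT n hn
    obtain ⟨C, hC⟩ := hlip T hT n hn
    obtain ⟨D, hD, h1, h2, h3⟩ := exists_lipschitz_bounds hι hβ hn hC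
    exact ⟨θ, M, D, hθ, hM.le, hD, fun t ht u v hu =>
      (hco t ht u v hu).trans (sub_le_self _ (by positivity)), h1, h2, h3⟩
  · rw [hA t ht]; abel
  · rw [hB t ht]

/-- The term `½ ‖B‖²` of the coercivity condition absorbs `‖B‖ ‖ψ‖ ‖v‖_H`, at the cost of
`½ ‖ψ‖² ‖v‖_H²`. -/
theorem CoerciveWith.skeleton_le {ι : V →L[ℝ] H} {A : ℝ → V → StrongDual ℝ V}
    {B : ℝ → V → HilbertSchmidt U H} {T θ M : ℝ} {φ : ℝ → ℝ} (h : CoerciveWith ι A B T θ M φ)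
    (ψ : ℝ → U) {t : ℝ} (ht : t ∈ Icc 0 T) (v : V) :
    (-A t v) v + inner ℝ (HilbertSchmidt.toCLM (B t v) (ψ t)) (ι v) ≤
      -θ * ‖v‖ ^ 2 + (M + 1 / 2 * ‖ψ t‖ ^ 2) * ‖ι v‖ ^ 2 + |φ t| ^ 2 := by
  have h1 := h.2.2.2 v t ht
  have h2 : inner ℝ (HilbertSchmidt.toCLM (B t v) (ψ t)) (ι v) ≤ ‖B t v‖ * ‖ψ t‖ * ‖ι v‖ :=
    (real_inner_le_norm _ _).trans (by gcongr; exact HilbertSchmidt.norm_toCLM_apply_le _ _)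
  have h3 : (-A t v) v = -(A t v v) := rfl
  rw [h3]
  nlinarith [sq_nonneg (‖B t v‖ - ‖ψ t‖ * ‖ι v‖)]

/-- Strong solutions in `MR(0,T)` solve the evolution equation in the sense of `IsEvol`. -/
theorem IsStrongSolution.isEvol {ι : V →L[ℝ] H} {A : ℝ → V → StrongDual ℝ V}
    {B : ℝ → V → HilbertSchmidt U H} {ψ : ℝ → U} {T : ℝ} (hT : 0 ≤ T)
    {K₁ : ℝ → V → StrongDual ℝ V} {K₂ : ℝ → V → H} (hK : IsParabolic ι T K₁ K₂)
    (hK₁ : ∀ t, 0 ≤ t → ∀ v, K₁ t v = -A t v)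
    (hK₂ : ∀ t, 0 ≤ t → ∀ v, K₂ t v = HilbertSchmidt.toCLM (B t v) (ψ t)) {x : H} {z : MR ι T}
    (hz : IsStrongSolution ι (skeletonOp ι A B ψ) x z) :
    IsEvol ι 0 T x (fun t => K₁ t (z.toL2 t)) (fun t => K₂ t (z.toL2 t))
      (fun t => z.toCont (projIcc 0 T hT t)) z.toL2 := by
  have hmem : MemLp z.toL2 2 (volume.restrict (Icc 0 T)) := Lp.memLp z.toL2
  have hae : ∀ᵐ t ∂volume.restrict (Icc 0 T), ι (z.toL2 t) = z.toCont (projIcc 0 T hT t) := by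
    filter_upwards [z.compat, ae_restrict_mem measurableSet_Icc] with t h1 h2
    rw [h1 h2, projIcc_of_mem hT h2]
  obtain ⟨m1, m2⟩ := hK.memLp (n := ‖z.toCont‖) le_rfl le_rfl hmem
    (hae.mono fun t ht => by rw [ht]; exact z.toCont.norm_coe_le_norm _)
  refine ⟨(z.toCont.continuous.comp continuous_projIcc).continuousOn, hmem, m1, m2, hae,
    fun t ht => ?_⟩
  have h1 := hz.2 ⟨t, ht⟩
  rw [projIcc_of_mem hT ht]
  refine h1.trans ?_
  rw [sub_eq_add_neg, ← intervalIntegral.integral_neg]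
  congr 1
  refine intervalIntegral.integral_congr fun s hs => ?_
  rw [uIcc_of_le ht.1] at hs
  rw [hK₁ s hs.1, hK₂ s hs.1, skeletonOp, pivotCLM_eq]
  abel

theorem IsEvol.exists_isStrongSolution {ι : V →L[ℝ] H} {A : ℝ → V → StrongDual ℝ V}
    {B : ℝ → V → HilbertSchmidt U H} {ψ : ℝ → U} {T : ℝ} {K₁ : ℝ → V → StrongDual ℝ V}
    {K₂ : ℝ → V → H} (hK₁ : ∀ t, 0 ≤ t → ∀ v, K₁ t v = -A t v)
    (hK₂ : ∀ t, 0 ≤ t → ∀ v, K₂ t v = HilbertSchmidt.toCLM (B t v) (ψ t)) {x : H}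
    {w : ℝ → H} {u : ℝ → V}
    (h : IsEvol ι 0 T x (fun t => K₁ t (u t)) (fun t => K₂ t (u t)) w u) :
    ∃ z : MR ι T, IsStrongSolution ι (skeletonOp ι A B ψ) x z := by
  have hV : MemLp u 2 (volIcc T) := h.memV
  let z : MR ι T := ⟨⟨(Icc 0 T).domRestrict w, continuousOn_iff_continuous_domRestrict.1 h.cont⟩,
    hV.toLp u, by
      filter_upwards [hV.coeFn_toLp, h.ae_eq] with t h1 h2 ht
      exact (congrArg ι h1).trans h2⟩
  have hzu : ∀ᵐ t ∂volume.restrict (Icc 0 T), z.toL2 t = u t := hV.coeFn_toLp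
  have hop : ∀ᵐ t ∂volume.restrict (Icc 0 T), skeletonOp ι A B ψ t (z.toL2 t) =
      -K₁ t (u t) + pivotCLM ι (-K₂ t (u t)) := by
    filter_upwards [hzu, ae_restrict_mem measurableSet_Icc] with t h1 h2
    rw [h1, hK₁ t h2.1, hK₂ t h2.1, skeletonOp, map_neg, neg_neg, sub_eq_add_neg, pivotCLM_eq]
  refine ⟨z, ⟨fun t => -K₁ t (u t), fun t => -K₂ t (u t), h.mem1.neg,
    memLp_one_iff_integrable.2 h.int2.neg, ?_⟩, fun t => ?_⟩
  · filter_upwards [hop] with t ht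
    rw [ht, pivotCLM_eq]
  · have h1 : ∫ s in (0 : ℝ)..t, skeletonOp ι A B ψ s (z.toL2 s) =
        ∫ s in (0 : ℝ)..t, -(K₁ s (u s) + pivotCLM ι (K₂ s (u s))) := by
      refine intervalIntegral_congr_ae_of_mem t.2 ?_
      filter_upwards [hop] with s hs
      rw [hs, map_neg, neg_add]
    rw [h1, intervalIntegral.integral_neg, sub_neg_eq_add]
    exact h.eq t t.2

/-- As `ι` is injective, the continuous representative determines the element of `MR(0,T)`. -/
theorem MR.ext_of_toCont {ι : V →L[ℝ] H} (hι : Function.Injective ι) {T : ℝ} {y z : MR ι T}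
    (h : y.toCont = z.toCont) : y = z := by
  have h2 : y.toL2 = z.toL2 := by
    refine Lp.ext ?_
    filter_upwards [y.compat, z.compat, ae_restrict_mem measurableSet_Icc] with t h3 h4 h5
    exact hι (by rw [h3 h5, h4 h5, h])
  cases y
  cases z
  simp only at h h2
  subst h h2
  rfl

end Skeleton

theorem theorem3p16 {V H U : Type*}
    [NormedAddCommGroup V] [InnerProductSpace ℝ V] [CompleteSpace V]
    [TopologicalSpace.SeparableSpace V] [MeasurableSpace V] [BorelSpace V]
    [NormedAddCommGroup H] [InnerProductSpace ℝ H] [CompleteSpace H]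
    [TopologicalSpace.SeparableSpace H] [MeasurableSpace H] [BorelSpace H]
    [NormedAddCommGroup U] [InnerProductSpace ℝ U] [CompleteSpace U]
    (ι : V →L[ℝ] H) (hι_inj : Function.Injective ι) (hι_dense : DenseRange ι)
    (A : ℝ → V → StrongDual ℝ V) (B : ℝ → V → HilbertSchmidt U H)
    (hAB : CriticalVariational ι A B) (hcoer : Coercive ι A B)
    (ψ : ℝ → U) (hψ : MemL2Loc ψ) (x : H) (T : ℝ) (hT : 0 < T) :
    ∃ u : MR ι T, IsStrongSolution ι (skeletonOp ι A B ψ) x u ∧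
      (∀ w : MR ι T, IsStrongSolution ι (skeletonOp ι A B ψ) x w → w = u) ∧
      ∀ (θ M : ℝ) (φ : ℝ → ℝ), CoerciveWith ι A B T θ M φ →
        ‖u‖ ≤ (2 + 1 / θ) ^ (1 / 2 : ℝ) *
          (‖x‖ + Real.sqrt 2 * (eLpNorm φ 2 (volIcc T)).toReal) *
          Real.exp (M * T + 1 / 2 * (eLpNorm ψ 2 (volIcc T)).toReal ^ 2) := by
  obtain ⟨K₁, K₂, hK, hK₁, hK₂⟩ := hAB.exists_isParabolic hι_inj hψ hT
  have hψT : MemLp ψ 2 (volume.restrict (Icc 0 T)) := hψ T hT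
  have hm : ∀ M : ℝ, Integrable (fun t => M + 1 / 2 * ‖ψ t‖ ^ 2) (volume.restrict (Icc 0 T)) :=
    fun M => (integrable_const M).add ((memLp_two_norm_sq_integrable hψT).const_mul _)
  have hp : ∀ φ : ℝ → ℝ, MemLp φ 2 (volume.restrict (Icc 0 T)) →
      Integrable (fun t => |φ t| ^ 2) (volume.restrict (Icc 0 T)) :=
    fun φ hφ => memLp_two_norm_sq_integrable hφ
  have hco : ∀ (θ M : ℝ) (φ : ℝ → ℝ), CoerciveWith ι A B T θ M φ → ∀ t ∈ Icc 0 T, ∀ v,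
      K₁ t v v + inner ℝ (K₂ t v) (ι v) ≤
        -θ * ‖v‖ ^ 2 + (M + 1 / 2 * ‖ψ t‖ ^ 2) * ‖ι v‖ ^ 2 + |φ t| ^ 2 := by
    intro θ M φ h t ht v
    rw [hK₁ t ht.1, hK₂ t ht.1]
    exact h.skeleton_le ψ ht v
  obtain ⟨θ, M, φ, hc⟩ := hcoer T hT
  have hM := hc.2.1
  obtain ⟨w, u, hwu⟩ := hK.exists_isEvol hι_inj hι_dense hT hc.1 (hm M) (hp φ hc.2.2.1)
    (fun t => by positivity) (fun t => by positivity) (hco θ M φ hc) x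
  obtain ⟨z, hz⟩ := hwu.exists_isStrongSolution hK₁ hK₂
  have hzE := hz.isEvol hT.le hK hK₁ hK₂
  refine ⟨z, hz, fun y hy => ?_, fun θ M φ hc => ?_⟩
  · refine MR.ext_of_toCont hι_inj (ContinuousMap.ext fun t => ?_)
    have h1 := hK.eqOn hι_inj hι_dense le_rfl (hy.isEvol hT.le hK hK₁ hK₂) hzE t.2
    simpa only [projIcc_val] using h1
  · have hM := hc.2.1
    have hP : ∫ s in Icc 0 T, |φ s| ^ 2 = (eLpNorm φ 2 (volIcc T)).toReal ^ 2 :=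
      (toReal_eLpNorm_two_sq hc.2.2.1).symm
    have hb := fun t (ht : t ∈ Icc 0 T) => hzE.norm_add_le hι_inj hι_dense hT.le hc.1 (hm M)
      (hp φ hc.2.2.1) (fun t => by positivity) (fun t => by positivity) (hco θ M φ hc)
      ENNReal.toReal_nonneg hP ht
    have hint : ∫ s in Icc 0 T, (M + 1 / 2 * ‖ψ s‖ ^ 2) =
        M * T + 1 / 2 * (eLpNorm ψ 2 (volIcc T)).toReal ^ 2 := by
      rw [integral_add (integrable_const M) ((memLp_two_norm_sq_integrable hψT).const_mul _),
        integral_const_mul, ← toReal_eLpNorm_two_sq hψT, setIntegral_const]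
      simp [volIcc, hT.le, mul_comm]
    rw [hint] at hb
    rw [← Real.sqrt_eq_rpow]
    have hn : ‖z‖ = ‖z.toCont‖ + (eLpNorm z.toL2 2 (volume.restrict (Icc 0 T))).toReal := by
      change ‖z.toCont‖ + ‖z.toL2‖ = _
      rw [Lp.norm_def]; rfl
    rw [hn, ← le_sub_iff_add_le]
    have : Nonempty (Icc (0 : ℝ) T) := ⟨⟨0, le_rfl, hT.le⟩⟩
    rw [ContinuousMap.norm_le_of_nonempty]
    intro t
    have h1 := hb t t.2
    rw [projIcc_val] at h1
    exact le_sub_iff_add_le.mpr h1
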